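/- **Setting.** For each $n$, let $\mathbf d_n=((d_v^-,d_v^+))_{v\in[n]}$ be a bi-degree sequence of non-negative integers with $\sum_v d_v^+=\sum_v d_v^-$. Assume that there are constants $\eta,C>0$ and an integer $K\ge 2$ such that, for all $n$, $2\le d_v^+\le K$ for all $v\in[n]$ and $\sum_{v\in[n]}(d_v^-)^{2+\eta}\le Cn$. Let $G_n$ be the directed configuration model: attach $d_v^+$ tails and $d_v^-$ heads to each vertex $v$, match tails to heads by a uniformly random bijection, and put an edge $(u,v)$ for each tail of $u$ matched to a head of $v$. Let $P(y,x)=m(y,x)/d_y^+$, where $m(y,x)$ is the multiplicity of the edge $(y,x)$. Events hold whp if their probability tends to $1$ as $n\to\infty$. For an empirical distribution $\mu_n=\frac1n\sum_{v\in[n]}\delta_{x_v}$ on $[0,\infty)$ write $\mu_n(t,\infty)=\frac1n|\{v: x_v>t\}|$. Let $\kappa>2$ and assume that the empirical in-degree distribution $\phi_n$ (with $x_v=d_v^-$) has power-law behavior with index $\kappa$: for all $\varepsilon>0$ and all $a\in(0,1/\kappa)$, for all sufficiently large $n$, $$n^{-a\kappa-\varepsilon}\le\phi_n(n^a,\infty)\le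 n^{-a\kappa+\varepsilon},\qquad \phi_n(n^{1/\kappa+\varepsilon},\infty)=0 .$$ For $n\ge1$ let $\lambda=\lambda_n$ be a (deterministic) probability distribution on $[n]$ such that for all $\varepsilon>0$, for all sufficiently large $n$, $n^{-1-\varepsilon}\le\lambda_n(x)\le n^{-1+\varepsilon}$ for all $x\in[n]$. For $\alpha\in[0,1]$ let $\pi_{\alpha,\lambda}$ be the PageRank score, i.e. the unique stationary probability distribution (when there is exactly one) of the transition matrix $P_{\alpha,\lambda}(x,y)=(1-\alpha)P(x,y)+\alpha\lambda(y)$, and let $\psi_{\alpha,\lambda}=\frac1n\sum_{v\in[n]}\delta_{n\pi_{\alpha,\lambda}(v)}$. **Theorem.** 1. For every constant $\alpha\in(0,1)$, the distribution $\psi_{\alpha,\lambda}$ has power-law behavior with the same index $\kappa$ whp, in the following sense: for all $\varepsilon>0$ and all $b\in(0,1/\kappa)$, whp $\pi_{\alpha,\lambda}$ is well defined, $\psi_{\alpha,\lambda}(n^{1/\kappa+\varepsilon},\infty)=0$, $\psi_{\alpha,\lambda}(n^a,\infty)\le n^{-a\kappa+\varepsilon}$ for all $a\in(0,1/\kappa)$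 simultaneously, and $\psi_{\alpha,\lambda}(n^a,\infty)\ge n^{-a\kappa-\varepsilon}$ for all $a\in(0,b]$ simultaneously. 2. The upper tail bound is uniform in $\alpha\in[0,1]$: for all $\varepsilon>0$ and $\delta>0$ there is $n_0$ such that for all $n\ge n_0$ and all $\alpha\in[0,1]$, with probability at least $1-\delta$, $\pi_{\alpha,\lambda}$ is well defined, $\psi_{\alpha,\lambda}(n^{1/\kappa+\varepsilon},\infty)=0$, and $\psi_{\alpha,\lambda}(n^a,\infty)\le n^{-a\kappa+\varepsilon}$ for all $a\in(0,1/\kappa)$. Equivalently, for an arbitrary sequence $\alpha_n\in[0,1]$ these upper bounds hold whp for $\psi_{\alpha_n,\lambda}$. -/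

import Mathlib

open Filter Topology MeasureTheory ProbabilityTheory
open scoped Matrix

namespace DCM

/-- A bi-degree sequence on the vertex set `Fin n`: in-degrees and out-degrees with the same sum. -/
structure BiDegree (n : ℕ) where
  inDeg : Fin n → ℕ
  outDeg : Fin n → ℕ
  sum_eq : ∑ v, outDeg v = ∑ v, inDeg v

namespace BiDegree

variable {n : ℕ}

/-- The tails: `d⁺_v` of them at each vertex `v`. -/
abbrev Tail (d : BiDegree n) : Type := Σ v : Fin n, Fin (d.outDeg v)

/-- The heads: `d⁻_v` of them at each vertex `v`. -/
abbrev Head (d : BiDegree n) : Type := Σ v : Fin n, Fin (d.inDeg v)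

/-- The configurations: bijections from tails to heads. Each of them is a directed multigraph
on `Fin n`, with one edge `(u, v)` for each tail of `u` that is matched to a head of `v`. -/
abbrev Matching (d : BiDegree n) : Type := d.Tail ≃ d.Head

/-- All sets of matchings are events. -/
instance instMeasurableSpaceMatching (d : BiDegree n) : MeasurableSpace d.Matching := ⊤

/-- The law of the directed configuration model: a uniformly random matching. -/
noncomputable def law (d : BiDegree n) : Measure d.Matching :=
  uniformOn (Set.univ : Set d.Matching)

/-- The multiplicity of the directed edge `(y, x)`. -/
noncomputable def mult (d : BiDegree n) (σ : d.Matching) (y x : Fin n) : ℕ :=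
  Nat.card {i : Fin (d.outDeg y) // (σ ⟨y, i⟩).1 = x}

/-- The transition matrix of the simple random walk on the multigraph. -/
noncomputable def walk (d : BiDegree n) (σ : d.Matching) : Matrix (Fin n) (Fin n) ℝ :=
  fun y x => (d.mult σ y x : ℝ) / (d.outDeg y : ℝ)

/-- The transition matrix of the PageRank surfer with teleporting probability `α` and
teleporting distribution `lam`. -/
noncomputable def surfer (d : BiDegree n) (σ : d.Matching) (α : ℝ) (lam : Fin n → ℝ) :
    Matrix (Fin n) (Fin n) ℝ :=
  fun x y => (1 - α) * d.walk σ x y + α * lam y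

end BiDegree

/-- `π` is a stationary probability distribution of the transition matrix `P`. -/
def IsStationary {n : ℕ} (P : Matrix (Fin n) (Fin n) ℝ) (π : Fin n → ℝ) : Prop :=
  π ∈ stdSimplex ℝ (Fin n) ∧ π ᵥ* P = π

/-- `π` is the stationary distribution of `P`, that is, the only one. -/
def IsTheStationary {n : ℕ} (P : Matrix (Fin n) (Fin n) ℝ) (π : Fin n → ℝ) : Prop :=
  IsStationary P π ∧ ∀ π' : Fin n → ℝ, IsStationary P π' → π' = π

/-- The assumption on the degrees: out-degrees between `2` and a constant `K`, and a bounded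
`(2 + η)`-moment of the in-degrees. -/
def DegreeAssumption (d : ∀ n : ℕ, BiDegree n) : Prop :=
  ∃ η C : ℝ, ∃ K : ℕ, 0 < η ∧ 0 < C ∧ 2 ≤ K ∧ ∀ n : ℕ,
    (∀ v, 2 ≤ (d n).outDeg v) ∧ (∀ v, (d n).outDeg v ≤ K) ∧
    ∑ v, ((d n).inDeg v : ℝ) ^ (2 + η) ≤ C * (n : ℝ)

/-- The right tail `μ (t, ∞)` of the empirical distribution `μ = (1 / n) ∑ᵥ δ_{x v}`. -/
noncomputable def tail {n : ℕ} (x : Fin n → ℝ) (t : ℝ) : ℝ :=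
  (Nat.card {v : Fin n // t < x v} : ℝ) / (n : ℝ)

/-- Power-law behaviour with index `κ` of the empirical distributions of the vectors `x n`. -/
def HasPowerLaw (κ : ℝ) (x : ∀ n : ℕ, Fin n → ℝ) : Prop :=
  ∀ ε : ℝ, 0 < ε → ∀ a : ℝ, 0 < a → a < 1 / κ → ∀ᶠ n : ℕ in atTop,
    (n : ℝ) ^ (-a * κ - ε) ≤ tail (x n) ((n : ℝ) ^ a) ∧
    tail (x n) ((n : ℝ) ^ a) ≤ (n : ℝ) ^ (-a * κ + ε) ∧
    tail (x n) ((n : ℝ) ^ (1 / κ + ε)) = 0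

/-- The upper half of the power-law bounds at size `n`, with error exponent `ε`, simultaneously
for all exponents `a ∈ (0, 1 / κ)`. -/
def UpperBounds {n : ℕ} (κ ε : ℝ) (x : Fin n → ℝ) : Prop :=
  tail x ((n : ℝ) ^ (1 / κ + ε)) = 0 ∧
  ∀ a : ℝ, 0 < a → a < 1 / κ → tail x ((n : ℝ) ^ a) ≤ (n : ℝ) ^ (-a * κ + ε)

/-- The lower half of the power-law bounds at size `n`, with error exponent `ε`, simultaneously
for all exponents `a ∈ (0, b]`. -/
def LowerBounds {n : ℕ} (κ ε b : ℝ) (x : Fin n → ℝ) : Prop :=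
  ∀ a : ℝ, 0 < a → a ≤ b → (n : ℝ) ^ (-a * κ - ε) ≤ tail x ((n : ℝ) ^ a)

/-- `lam n` is, for each `n ≥ 1`, a probability distribution on `Fin n`, uniform up to
sub-polynomial factors. -/
def NearUniform (lam : ∀ n : ℕ, Fin n → ℝ) : Prop :=
  (∀ n : ℕ, 1 ≤ n → lam n ∈ stdSimplex ℝ (Fin n)) ∧
  ∀ ε : ℝ, 0 < ε → ∀ᶠ n : ℕ in atTop, ∀ x : Fin n,
    (n : ℝ) ^ (-1 - ε) ≤ lam n x ∧ lam n x ≤ (n : ℝ) ^ (-1 + ε)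

end DCM

/-! Write `P` for `d.walk σ` and `m` for the number of tails, so that `m ≥ 2n`. The score of `v` is
compared with the influence of `v`, which is the largest value of `inDeg w * (P ^ t) w v` over all
`w` and `t ≤ T`, with floor `1`; here `T` is of order `log n`.

The tail of the influence is controlled for every matching (`card_lt_influence_le`). Each row of `P
^ t` has mass at most `1`, so at most `inDeg w / D` vertices receive more than `D` from `w`, and
this is at most `(inDeg w / D) ^ κ` when it is not below `1`. Since `∑ inDeg w ^ κ` is at most `n ^
(1 + ε)`, the influence inherits the upper tail of the in-degrees. It remains to show that, with
high probability, `n * π v` is at most `n ^ ε` times the influence of `v`, for all `v` and all `α`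
together.

Unrolling the stationarity equation writes `π` as a mixture of `lam * P ^ k`, `k < T`, and `π * P ^
T`, with weights that depend on `α` but sum to `1`. So it is enough to bound `(1 / n) * ∑ x, (P ^ k)
x v` and every `(P ^ T) x v` by `n ^ (ε - 1)` times the influence, and these events do not involve
`α`. For this, high moments are computed by running `q` walks and revealing the matching along them
(`cylExp_walk_le`, `cylExp_pow_le`). A fresh tail hits a revealed vertex `w` with probability at
most `inDeg w / (m - L)`, where `L` bounds the number of revealed tails; from there the chance to
reach `v` is at most the influence divided by `inDeg w`. The in-degree cancels, so after division by
the influence an entrance into the revealed part costs about `L / n`, however heavy the in-degrees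
are. Markov's inequality with large fixed `q` then beats a union bound.

For the long walks, a walk confined to the few revealed edges must die out. This follows once `P ^
R`, with `R` about `log₂ n`, has all its entries below a negative power of `n`. If the revealed
graph has at most one collision, it has at most `t + 1` paths of length `t` between two vertices,
each of weight at most `2 ^ (-t)`. Two collisions have probability about `n ^ (-2 + 2 / κ)`, and `κ
> 2` makes this summable over the `n` starting points (`cylExp_sum_pow_le`).

Uniqueness is clear for `α > 0`, since `lam` is positive. For `α = 0`, two stationary distributions
would give two disjoint absorbing sets. The bound on `P ^ T` makes absorbing sets much larger than
`√n`, and explorations of that size from two vertices meet, as in the birthday problem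
(`cylExp_split_le`).

The lower tail bound is deterministic: teleportation gives each vertex about `1 / n`, and one step
of the walk turns this into a score of order `inDeg v / n`, up to sub-polynomial factors. -/

namespace DCM
namespace BiDegree
variable {n : ℕ}

/-! ### The walk on a set of revealed tails -/

/-- The walk that uses only the tails in `S`, killed when it takes another one. -/
noncomputable def walkOn (d : BiDegree n) (S : Finset d.Tail) (σ : d.Matching) :
    Matrix (Fin n) (Fin n) ℝ :=
  fun y x => ∑ i : Fin (d.outDeg y),
    if (⟨y, i⟩ : d.Tail) ∈ S ∧ (σ ⟨y, i⟩).1 = x then (d.outDeg y : ℝ)⁻¹ else 0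

theorem walkOn_univ (d : BiDegree n) (σ : d.Matching) :
    d.walkOn Finset.univ σ = d.walk σ := by
  ext y x
  simp only [walkOn, walk, mult, Finset.mem_univ, true_and, Nat.card_eq_fintype_card,
    Fintype.card_subtype, ← Finset.sum_filter, Finset.sum_const, nsmul_eq_mul, div_eq_mul_inv]

theorem walkOn_nonneg (d : BiDegree n) (S : Finset d.Tail) (σ : d.Matching) (y x : Fin n) :
    0 ≤ d.walkOn S σ y x :=
  Finset.sum_nonneg fun i _ => by split_ifs <;> positivity

theorem walkOn_congr (d : BiDegree n) {S : Finset d.Tail} {σ τ : d.Matching}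
    (h : ∀ e ∈ S, σ e = τ e) : d.walkOn S σ = d.walkOn S τ := by
  ext y x
  refine Finset.sum_congr rfl fun i _ => ?_
  by_cases hi : (⟨y, i⟩ : d.Tail) ∈ S
  · simp [hi, h _ hi]
  · simp [hi]

theorem walkOn_mono (d : BiDegree n) {S S' : Finset d.Tail} (h : S ⊆ S') (σ : d.Matching)
    (y x : Fin n) : d.walkOn S σ y x ≤ d.walkOn S' σ y x := by
  refine Finset.sum_le_sum fun i _ => ?_
  by_cases hi : (⟨y, i⟩ : d.Tail) ∈ S
  · simp [hi, h hi]
  · simp only [hi, false_and, if_false]; split_ifs <;> positivity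

theorem walkOn_mulVec (d : BiDegree n) (S : Finset d.Tail) (σ : d.Matching) (y : Fin n)
    (g : Fin n → ℝ) : ∑ x, d.walkOn S σ y x * g x = (d.outDeg y : ℝ)⁻¹ *
      ∑ i : Fin (d.outDeg y), if (⟨y, i⟩ : d.Tail) ∈ S then g (σ ⟨y, i⟩).1 else 0 := by
  simp only [walkOn, Finset.sum_mul]
  rw [Finset.sum_comm, Finset.mul_sum]
  refine Finset.sum_congr rfl fun i _ => ?_
  by_cases hi : (⟨y, i⟩ : d.Tail) ∈ S <;> simp [hi]

theorem walkOn_pow_succ (d : BiDegree n) (S : Finset d.Tail) (σ : d.Matching) (t : ℕ)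
    (y v : Fin n) : (d.walkOn S σ ^ (t + 1)) y v = (d.outDeg y : ℝ)⁻¹ *
      ∑ i : Fin (d.outDeg y),
        if (⟨y, i⟩ : d.Tail) ∈ S then (d.walkOn S σ ^ t) (σ ⟨y, i⟩).1 v else 0 := by
  rw [pow_succ', Matrix.mul_apply, walkOn_mulVec d S σ y (fun x => (d.walkOn S σ ^ t) x v)]

end BiDegree

theorem matrix_pow_mono {n : ℕ} {A B : Matrix (Fin n) (Fin n) ℝ} (hA : ∀ x y, 0 ≤ A x y)
    (hAB : ∀ x y, A x y ≤ B x y) (t : ℕ) (x y : Fin n) :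
    0 ≤ (A ^ t) x y ∧ (A ^ t) x y ≤ (B ^ t) x y := by
  induction t generalizing x y with
  | zero => simp [Matrix.one_apply]; split_ifs <;> norm_num
  | succ t ih =>
    simp only [pow_succ', Matrix.mul_apply]
    exact ⟨Finset.sum_nonneg fun z _ => mul_nonneg (hA _ _) (ih _ _).1,
      Finset.sum_le_sum fun z _ => mul_le_mul (hAB _ _) (ih _ _).2 (ih _ _).1
        ((hA _ _).trans (hAB _ _))⟩

namespace BiDegree
variable {n : ℕ}

theorem walkOn_pow_nonneg (d : BiDegree n) (S : Finset d.Tail) (σ : d.Matching) (t : ℕ)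
    (y x : Fin n) : 0 ≤ (d.walkOn S σ ^ t) y x :=
  (matrix_pow_mono (d.walkOn_nonneg S σ) (fun _ _ => le_rfl) t y x).1

theorem walkOn_pow_mono (d : BiDegree n) {S S' : Finset d.Tail} (h : S ⊆ S') (σ : d.Matching)
    (t : ℕ) (y x : Fin n) : (d.walkOn S σ ^ t) y x ≤ (d.walkOn S' σ ^ t) y x :=
  (matrix_pow_mono (d.walkOn_nonneg S σ) (d.walkOn_mono h σ) t y x).2

theorem walkOn_pow_le_walk (d : BiDegree n) (S : Finset d.Tail) (σ : d.Matching)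
    (t : ℕ) (y x : Fin n) : (d.walkOn S σ ^ t) y x ≤ (d.walk σ ^ t) y x := by
  rw [← walkOn_univ]; exact d.walkOn_pow_mono (Finset.subset_univ S) σ t y x

theorem walk_pow_nonneg (d : BiDegree n) (σ : d.Matching) (t : ℕ)
    (y x : Fin n) : 0 ≤ (d.walk σ ^ t) y x := by
  rw [← walkOn_univ]; exact d.walkOn_pow_nonneg _ σ t y x

theorem walk_pow_succ (d : BiDegree n) (σ : d.Matching) (t : ℕ) (y v : Fin n) :
    (d.walk σ ^ (t + 1)) y v = (d.outDeg y : ℝ)⁻¹ *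
      ∑ i : Fin (d.outDeg y), (d.walk σ ^ t) (σ ⟨y, i⟩).1 v := by
  rw [← walkOn_univ, walkOn_pow_succ]; simp

/-- The walk on `S` stops at vertices without tails in `S`. -/
theorem walkOn_pow_eq_zero (d : BiDegree n) {S : Finset d.Tail} (σ : d.Matching) (t : ℕ)
    {w v : Fin n} (hw : ∀ e ∈ S, e.1 ≠ w) (hv : w ≠ v) : (d.walkOn S σ ^ t) w v = 0 := by
  cases t with
  | zero => simp [hv]
  | succ t =>
    rw [walkOn_pow_succ, Finset.sum_eq_zero, mul_zero]
    intro i _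
    rw [if_neg]
    exact fun h => hw _ h rfl

theorem walkOn_row_sum_le (d : BiDegree n) (S : Finset d.Tail) (σ : d.Matching) (t : ℕ)
    (y : Fin n) : ∑ x, (d.walkOn S σ ^ t) y x ≤ 1 := by
  induction t generalizing y with
  | zero => simp [Matrix.one_apply]
  | succ t ih =>
    simp only [walkOn_pow_succ]
    rw [← Finset.mul_sum, Finset.sum_comm]
    calc (d.outDeg y : ℝ)⁻¹ * ∑ i : Fin (d.outDeg y), ∑ x,
          (if (⟨y, i⟩ : d.Tail) ∈ S then (d.walkOn S σ ^ t) (σ ⟨y, i⟩).1 x else 0)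
        ≤ (d.outDeg y : ℝ)⁻¹ * ∑ _i : Fin (d.outDeg y), 1 := by
          gcongr with i
          by_cases hi : (⟨y, i⟩ : d.Tail) ∈ S
          · simpa [hi] using ih _
          · simp [hi]
      _ ≤ 1 := by
          simp only [Finset.sum_const, Finset.card_univ, Fintype.card_fin, nsmul_eq_mul, mul_one]
          exact inv_mul_le_one

theorem walkOn_pow_le_one (d : BiDegree n) (S : Finset d.Tail) (σ : d.Matching) (t : ℕ)
    (y x : Fin n) : (d.walkOn S σ ^ t) y x ≤ 1 :=
  (Finset.single_le_sum (fun z _ => d.walkOn_pow_nonneg S σ t y z) (Finset.mem_univ x)).trans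
    (d.walkOn_row_sum_le S σ t y)

theorem walk_pow_le_one (d : BiDegree n) (σ : d.Matching) (t : ℕ)
    (y x : Fin n) : (d.walk σ ^ t) y x ≤ 1 := by
  rw [← walkOn_univ]; exact d.walkOn_pow_le_one _ σ t y x

theorem walk_row_sum_le (d : BiDegree n) (σ : d.Matching) (t : ℕ) (y : Fin n) :
    ∑ x, (d.walk σ ^ t) y x ≤ 1 := by
  rw [← walkOn_univ]; exact d.walkOn_row_sum_le _ σ t y

/-! ### Averages over the matchings that extend a partial matching -/

theorem card_head (d : BiDegree n) : Fintype.card d.Head = Fintype.card d.Tail := by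
  simp [d.sum_eq]

instance (d : BiDegree n) : Nonempty d.Matching :=
  ⟨Fintype.equivOfCardEq d.card_head.symm⟩

/-- The matchings that agree with `σ₀` on the tails in `S`. -/
def cyl (d : BiDegree n) (S : Finset d.Tail) (σ₀ : d.Matching) : Finset d.Matching :=
  Finset.univ.filter fun σ => ∀ e ∈ S, σ e = σ₀ e

theorem mem_cyl {d : BiDegree n} {S : Finset d.Tail} {σ₀ σ : d.Matching} :
    σ ∈ d.cyl S σ₀ ↔ ∀ e ∈ S, σ e = σ₀ e := by simp [cyl]

theorem cyl_insert_subset (d : BiDegree n) (S : Finset d.Tail) (e : d.Tail)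
    {σ₀ σ₁ : d.Matching} (h : σ₁ ∈ d.cyl S σ₀) : d.cyl (insert e S) σ₁ ⊆ d.cyl S σ₀ := by
  intro σ hσ
  rw [mem_cyl] at *
  intro e' he'
  rw [hσ e' (Finset.mem_insert_of_mem he'), h e' he']

/-- Composition with `σ₀.symm` turns the cylinder into the permutations of the tails that fix `S`
pointwise. That the size depends only on `S.card` is what makes the tower property a double count.
-/
theorem card_cyl (d : BiDegree n) (S : Finset d.Tail) (σ₀ : d.Matching) :
    (d.cyl S σ₀).card = (Fintype.card d.Tail - S.card).factorial := by
  have e1 : {σ // σ ∈ d.cyl S σ₀} ≃ {f : Equiv.Perm d.Tail // ∀ a, ¬ (a ∉ S) → f a = a} :=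
    { toFun := fun σ => ⟨σ.1.trans σ₀.symm, fun a ha => by
        have := mem_cyl.1 σ.2 a (not_not.1 ha); simp [this]⟩
      invFun := fun f => ⟨f.1.trans σ₀, mem_cyl.2 fun a ha => by
        have := f.2 a (not_not.2 ha); simp [this]⟩
      left_inv := fun σ => by ext a : 2; simp
      right_inv := fun f => by ext a : 2; simp }
  have e2 := e1.trans (Equiv.Perm.subtypeEquivSubtypePerm (fun a => a ∉ S)).symm
  rw [← Fintype.card_coe, Fintype.card_congr e2, Fintype.card_perm, Fintype.card_subtype_compl,
    Fintype.card_coe]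

/-- The average of `g` over the matchings that agree with `σ₀` on `S`. -/
noncomputable def cylExp (d : BiDegree n) (S : Finset d.Tail) (g : d.Matching → ℝ)
    (σ₀ : d.Matching) : ℝ :=
  (∑ σ ∈ d.cyl S σ₀, g σ) / (d.cyl S σ₀).card

theorem card_cyl_pos (d : BiDegree n) (S : Finset d.Tail) (σ₀ : d.Matching) :
    (0 : ℝ) < (d.cyl S σ₀).card := by
  rw [card_cyl]; exact_mod_cast Nat.factorial_pos _

theorem cylExp_mono (d : BiDegree n) {S : Finset d.Tail} {g g' : d.Matching → ℝ}
    {σ₀ : d.Matching} (h : ∀ σ ∈ d.cyl S σ₀, g σ ≤ g' σ) :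
    d.cylExp S g σ₀ ≤ d.cylExp S g' σ₀ := by
  unfold cylExp; gcongr with σ hσ; exact h σ hσ

theorem cylExp_congr (d : BiDegree n) {S : Finset d.Tail} {g g' : d.Matching → ℝ}
    {σ₀ : d.Matching} (h : ∀ σ ∈ d.cyl S σ₀, g σ = g' σ) :
    d.cylExp S g σ₀ = d.cylExp S g' σ₀ := by
  unfold cylExp; rw [Finset.sum_congr rfl h]

theorem cylExp_const (d : BiDegree n) (S : Finset d.Tail) (c : ℝ) (σ₀ : d.Matching) :
    d.cylExp S (fun _ => c) σ₀ = c := by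
  unfold cylExp
  rw [Finset.sum_const, nsmul_eq_mul, mul_div_cancel_left₀ _ (d.card_cyl_pos S σ₀).ne']

theorem cylExp_le_const (d : BiDegree n) {S : Finset d.Tail} {g : d.Matching → ℝ} {c : ℝ}
    {σ₀ : d.Matching} (h : ∀ σ ∈ d.cyl S σ₀, g σ ≤ c) : d.cylExp S g σ₀ ≤ c :=
  (d.cylExp_mono h).trans_eq (d.cylExp_const S c σ₀)

theorem cylExp_add (d : BiDegree n) (S : Finset d.Tail) (g g' : d.Matching → ℝ)
    (σ₀ : d.Matching) :
    d.cylExp S (fun σ => g σ + g' σ) σ₀ = d.cylExp S g σ₀ + d.cylExp S g' σ₀ := by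
  unfold cylExp; rw [Finset.sum_add_distrib, add_div]

theorem cylExp_const_mul (d : BiDegree n) (S : Finset d.Tail) (c : ℝ) (g : d.Matching → ℝ)
    (σ₀ : d.Matching) : d.cylExp S (fun σ => c * g σ) σ₀ = c * d.cylExp S g σ₀ := by
  unfold cylExp; rw [← Finset.mul_sum, mul_div_assoc]

theorem cylExp_sum (d : BiDegree n) (S : Finset d.Tail) {ι : Type*} (s : Finset ι)
    (g : ι → d.Matching → ℝ) (σ₀ : d.Matching) :
    d.cylExp S (fun σ => ∑ i ∈ s, g i σ) σ₀ = ∑ i ∈ s, d.cylExp S (g i) σ₀ := by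
  unfold cylExp; rw [Finset.sum_comm, Finset.sum_div]

/-- Agreement on `insert e S` is a symmetric relation inside the cylinder of `σ₀`, and all its
classes have the same size. Exchanging the two sums therefore counts each `σ` exactly once. -/
theorem cylExp_tower (d : BiDegree n) (S : Finset d.Tail) (e : d.Tail) (g : d.Matching → ℝ)
    (σ₀ : d.Matching) :
    d.cylExp S g σ₀ = d.cylExp S (fun σ₁ => d.cylExp (insert e S) g σ₁) σ₀ := by
  unfold cylExp
  congr 1
  simp only [Finset.sum_div]
  rw [Finset.sum_comm' (t' := d.cyl S σ₀) (s' := fun σ => d.cyl (insert e S) σ)]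
  · refine Finset.sum_congr rfl fun σ hσ => ?_
    simp only [card_cyl d (insert e S)]
    rw [Finset.sum_const, card_cyl, nsmul_eq_mul, mul_div_cancel₀]
    exact_mod_cast (Nat.factorial_pos _).ne'
  · intro σ₁ σ
    constructor
    · rintro ⟨h1, h2⟩
      exact ⟨mem_cyl.2 fun e he => (mem_cyl.1 h2 e he).symm, d.cyl_insert_subset S e h1 h2⟩
    · rintro ⟨h1, h2⟩
      exact ⟨d.cyl_insert_subset S e h2 h1, mem_cyl.2 fun e he => (mem_cyl.1 h1 e he).symm⟩

theorem card_lt_card_tail (d : BiDegree n) {S : Finset d.Tail} {e : d.Tail} (he : e ∉ S) :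
    S.card < Fintype.card d.Tail := by
  have := Finset.card_le_univ (insert e S)
  rw [Finset.card_insert_of_notMem he] at this; omega

theorem cylExp_eq_head_le (d : BiDegree n) {S : Finset d.Tail} {e : d.Tail} (he : e ∉ S)
    (f : d.Head) (σ₀ : d.Matching) :
    d.cylExp S (fun σ => if σ e = f then 1 else 0) σ₀ ≤
      ((Fintype.card d.Tail : ℝ) - S.card)⁻¹ := by
  have hlt := d.card_lt_card_tail he
  have hpos : (0 : ℝ) < (Fintype.card d.Tail : ℝ) - S.card := by
    rw [sub_pos]; exact_mod_cast hlt
  unfold cylExp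
  rw [← Finset.sum_filter, Finset.sum_const, nsmul_eq_mul, mul_one,
    div_le_iff₀ (d.card_cyl_pos S σ₀), inv_mul_eq_div, le_div_iff₀ hpos]
  have key : ((d.cyl S σ₀).filter fun σ => σ e = f).card ≤
      (Fintype.card d.Tail - (S.card + 1)).factorial := by
    rcases ((d.cyl S σ₀).filter fun σ => σ e = f).eq_empty_or_nonempty with h | ⟨σ₁, h₁⟩
    · rw [h]; simp
    · rw [← Finset.card_insert_of_notMem he, ← card_cyl d (insert e S) σ₁]
      refine Finset.card_le_card fun σ hσ => ?_
      simp only [Finset.mem_filter, mem_cyl] at h₁ hσ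
      rw [mem_cyl]
      intro e' he'
      rcases Finset.mem_insert.1 he' with rfl | h
      · rw [hσ.2, h₁.2]
      · rw [hσ.1 e' h, h₁.1 e' h]
  rw [card_cyl]
  obtain ⟨k, hk⟩ : ∃ k, Fintype.card d.Tail = S.card + 1 + k := ⟨_, (Nat.add_sub_of_le hlt).symm⟩
  rw [hk] at key ⊢
  have h1 : S.card + 1 + k - S.card = k + 1 := by omega
  have h2 : S.card + 1 + k - (S.card + 1) = k := by omega
  rw [h2] at key
  rw [h1, Nat.factorial_succ]
  have h3 : ((S.card + 1 + k : ℕ) : ℝ) - S.card = ((k + 1 : ℕ) : ℝ) := by push_cast; ring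
  rw [h3, mul_comm, Nat.cast_mul]
  gcongr

/-- A revealed tail is matched to each of the remaining heads with the same probability. -/
theorem cylExp_head_le (d : BiDegree n) {S : Finset d.Tail} {e : d.Tail} (he : e ∉ S)
    (σ₀ : d.Matching) {φ : d.Head → ℝ} (hφ : ∀ f, 0 ≤ φ f) (B : Finset d.Head)
    (hB : ∀ f, f ∉ B → φ f ≠ 0 → ∃ e' ∈ S, σ₀ e' = f) :
    d.cylExp S (fun σ => φ (σ e)) σ₀ ≤ (∑ f ∈ B, φ f) / ((Fintype.card d.Tail : ℝ) - S.card) := by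
  calc d.cylExp S (fun σ => φ (σ e)) σ₀
      = d.cylExp S (fun σ => ∑ f ∈ B, φ f * if σ e = f then 1 else 0) σ₀ := by
        refine d.cylExp_congr fun σ hσ => ?_
        simp only [mul_ite, mul_one, mul_zero, Finset.sum_ite_eq]
        split_ifs with h
        · rfl
        · by_contra h0
          obtain ⟨e', he', h1⟩ := hB _ h h0
          rw [← mem_cyl.1 hσ e' he'] at h1
          exact he (σ.injective h1 ▸ he')
    _ ≤ ∑ f ∈ B, φ f * ((Fintype.card d.Tail : ℝ) - S.card)⁻¹ := by
        rw [cylExp_sum]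
        refine Finset.sum_le_sum fun f _ => ?_
        rw [cylExp_const_mul]
        exact mul_le_mul_of_nonneg_left (d.cylExp_eq_head_le he f σ₀) (hφ f)
    _ = _ := by rw [← Finset.sum_mul, div_eq_mul_inv]

theorem law_real_eq_cylExp (d : BiDegree n) (p : d.Matching → Prop) [DecidablePred p]
    (σ₀ : d.Matching) :
    d.law.real {σ | p σ} = d.cylExp ∅ (fun σ => if p σ then 1 else 0) σ₀ := by
  have : d.cyl ∅ σ₀ = Finset.univ := by ext; simp [mem_cyl]
  unfold cylExp law
  rw [this, Measure.real, uniformOn_univ, ← Finset.sum_filter, Finset.sum_const, nsmul_eq_mul,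
    mul_one, ENNReal.toReal_div, Measure.count_apply_finite _ (Set.toFinite _), Finset.card_univ]
  simp

instance (d : BiDegree n) : IsProbabilityMeasure d.law := by
  unfold law; exact isProbabilityMeasure_uniformOn Set.finite_univ Set.univ_nonempty

/-- One step of the walk, with the matching revealed along the way. -/
theorem cylExp_walk_step (d : BiDegree n) (S : Finset d.Tail) (g : d.Matching → ℝ) (t : ℕ)
    (y v : Fin n) (σ₀ : d.Matching) :
    d.cylExp S (fun σ => g σ * (d.walk σ ^ (t + 1)) y v) σ₀ =
      (d.outDeg y : ℝ)⁻¹ * ∑ i : Fin (d.outDeg y),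
        if (⟨y, i⟩ : d.Tail) ∈ S then
          d.cylExp S (fun σ => g σ * (d.walk σ ^ t) (σ₀ ⟨y, i⟩).1 v) σ₀
        else d.cylExp S (fun σ₁ => d.cylExp (insert ⟨y, i⟩ S)
          (fun σ => g σ * (d.walk σ ^ t) (σ₁ ⟨y, i⟩).1 v) σ₁) σ₀ := by
  have : ∀ σ, g σ * (d.walk σ ^ (t + 1)) y v = (d.outDeg y : ℝ)⁻¹ *
      ∑ i : Fin (d.outDeg y), g σ * (d.walk σ ^ t) (σ ⟨y, i⟩).1 v := by
    intro σ; rw [walk_pow_succ, ← Finset.mul_sum]; ring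
  simp only [this]
  rw [cylExp_const_mul, cylExp_sum]
  congr 1
  refine Finset.sum_congr rfl fun i _ => ?_
  split_ifs with hi
  · exact d.cylExp_congr fun σ hσ => by rw [mem_cyl.1 hσ _ hi]
  · rw [cylExp_tower d S ⟨y, i⟩]
    refine d.cylExp_congr fun σ₁ _ => d.cylExp_congr fun σ hσ => ?_
    rw [mem_cyl.1 hσ _ (Finset.mem_insert_self _ _)]

end BiDegree
end DCM
-- Moments of walks revealed along the way
namespace DCM
namespace BiDegree
variable {n : ℕ}

/-- Averaging over the tails of a vertex does not amplify an additive error. Nonnegativity of `B`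
covers `k = 0`, where the inverse is `0`. -/
theorem inv_mul_sum_le {k : ℕ} {a : Fin k → ℝ} {B : ℝ} (hB : 0 ≤ B) (b : Fin k → ℝ)
    (h : ∀ i, b i ≤ a i + B) : (k : ℝ)⁻¹ * ∑ i, b i ≤ (k : ℝ)⁻¹ * ∑ i, a i + B := by
  calc (k : ℝ)⁻¹ * ∑ i, b i ≤ (k : ℝ)⁻¹ * ∑ i, (a i + B) := by gcongr with i; exact h i
    _ = (k : ℝ)⁻¹ * ∑ i, a i + (k : ℝ)⁻¹ * k * B := by
        rw [Finset.sum_add_distrib]; simp; ring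
    _ ≤ _ := by
        have : (k : ℝ)⁻¹ * k ≤ 1 := inv_mul_le_one
        nlinarith

/-- Induction step for walks averaged over the matching: revealed tails reproduce one step of the
walk on `S`, while a fresh tail may contribute only to the error term. -/
theorem cylExp_walk_step_le (d : BiDegree n) {S : Finset d.Tail} {g : d.Matching → ℝ} {t : ℕ}
    {y v : Fin n} {σ₀ : d.Matching} {A B : ℝ} (hB : 0 ≤ B)
    (hold : ∀ i, (⟨y, i⟩ : d.Tail) ∈ S →
      d.cylExp S (fun σ => g σ * (d.walk σ ^ t) (σ₀ ⟨y, i⟩).1 v) σ₀ ≤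
        A * (d.walkOn S σ₀ ^ t) (σ₀ ⟨y, i⟩).1 v + B)
    (hnew : ∀ i, (⟨y, i⟩ : d.Tail) ∉ S → d.cylExp S (fun σ₁ => d.cylExp (insert ⟨y, i⟩ S)
          (fun σ => g σ * (d.walk σ ^ t) (σ₁ ⟨y, i⟩).1 v) σ₁) σ₀ ≤ B) :
    d.cylExp S (fun σ => g σ * (d.walk σ ^ (t + 1)) y v) σ₀ ≤
      A * (d.walkOn S σ₀ ^ (t + 1)) y v + B := by
  rw [cylExp_walk_step, walkOn_pow_succ, mul_left_comm, Finset.mul_sum (a := A)]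
  refine inv_mul_sum_le hB _ fun i => ?_
  split_ifs with hi
  · exact hold i hi
  · rw [mul_zero, zero_add]; exact hnew i hi

theorem sum_heads (d : BiDegree n) (φ : Fin n → ℝ) :
    ∑ f : d.Head, φ f.1 = ∑ w, (d.inDeg w : ℝ) * φ w := by
  rw [Fintype.sum_sigma]; simp

/-- One more walk: given what has been revealed, it reaches `v` along revealed edges, or else
enters the revealed part through a fresh edge. -/
theorem cylExp_walk_le (d : BiDegree n) {g k : d.Matching → ℝ} (hg : ∀ σ, 0 ≤ g σ)
    (hk : ∀ σ, 0 ≤ k σ) (v : Fin n) {L h : ℕ} (hL : L < Fintype.card d.Tail)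
    (hkv : ∀ σ w, ∀ t ≤ h, k σ * ((d.inDeg w : ℝ) * (d.walk σ ^ t) w v) ≤ 1)
    {G : ℝ} (hG : ∀ S σ₀, S.card ≤ L → d.cylExp S g σ₀ ≤ G) (hG0 : 0 ≤ G) :
    ∀ t ≤ h, ∀ (S : Finset d.Tail) (σ₀ : d.Matching) (y : Fin n), S.card + t ≤ L →
      d.cylExp S (fun σ => g σ * k σ * (d.walk σ ^ t) y v) σ₀ ≤
        d.cylExp S (fun σ => g σ * k σ) σ₀ * (d.walkOn S σ₀ ^ t) y v +
          t * (((L : ℝ) + 2) / ((Fintype.card d.Tail : ℝ) - L) * G) := by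
  have hmL : (0 : ℝ) < (Fintype.card d.Tail : ℝ) - L := by rw [sub_pos]; exact_mod_cast hL
  set c : ℝ := ((L : ℝ) + 2) / ((Fintype.card d.Tail : ℝ) - L) * G with hc
  have hc0 : 0 ≤ c := by positivity
  intro t
  induction t with
  | zero =>
    intro _ S σ₀ y _
    simp only [pow_zero, Nat.cast_zero, zero_mul, add_zero]
    exact le_of_eq (by rw [mul_comm, ← cylExp_const_mul]; simp only [mul_comm])
  | succ t ih =>
    intro ht S σ₀ y hS
    refine d.cylExp_walk_step_le (by positivity) (fun i hi => ?_) (fun i hi => ?_)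
    · refine (ih (by omega) S σ₀ _ (by omega)).trans ?_
      push_cast; linarith
    · set e : d.Tail := ⟨y, i⟩ with he
      -- Outside `W` the walk has no revealed tail to continue with and has not reached `v`, so its
      -- revealed part contributes nothing.
      set W : Finset (Fin n) := insert v ((insert e S).image Sigma.fst) with hW
      set φ : d.Head → ℝ := fun f => if f.1 ∈ W then (d.inDeg f.1 : ℝ)⁻¹ else 0 with hφ
      have hφ0 : ∀ f, 0 ≤ φ f := fun f => by simp only [hφ]; split_ifs <;> positivity
      have hcard : (insert e S).card = S.card + 1 := Finset.card_insert_of_notMem hi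
      have hWc : W.card ≤ L + 2 := by
        refine (Finset.card_insert_le _ _).trans ?_
        have := Finset.card_image_le (s := insert e S) (f := Sigma.fst)
        omega
      have h1 : ∀ σ₁, d.cylExp (insert e S)
          (fun σ => g σ * k σ * (d.walk σ ^ t) (σ₁ e).1 v) σ₁ ≤ G * φ (σ₁ e) + t * c := by
        intro σ₁
        refine (ih (by omega) (insert e S) σ₁ _ (by omega)).trans ?_
        refine add_le_add_left ?_ _
        by_cases hw : (σ₁ e).1 ∈ W
        · simp only [hφ, hw, if_true]
          have hd : (0 : ℝ) < d.inDeg (σ₁ e).1 := by exact_mod_cast (σ₁ e).2.pos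
          rw [mul_comm, ← cylExp_const_mul]
          -- The revealed walk is constant on the cylinder, so it can be moved inside the average.
          -- There it is dominated by the full walk, which `k` bounds by the inverse in-degree of
          -- the vertex just entered.
          calc d.cylExp (insert e S) (fun σ => (d.walkOn (insert e S) σ₁ ^ t) (σ₁ e).1 v *
                  (g σ * k σ)) σ₁
              ≤ d.cylExp (insert e S) (fun σ => (d.inDeg (σ₁ e).1 : ℝ)⁻¹ * g σ) σ₁ := by
                refine d.cylExp_mono fun σ hσ => ?_
                have h2 : (d.walkOn (insert e S) σ₁ ^ t) (σ₁ e).1 v ≤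
                    (d.walk σ ^ t) (σ₁ e).1 v := by
                  rw [d.walkOn_congr (fun e' he' => (mem_cyl.1 hσ e' he').symm)]
                  exact d.walkOn_pow_le_walk _ _ _ _ _
                have h3 := hkv σ (σ₁ e).1 t (by omega)
                have h4 : k σ * (d.walk σ ^ t) (σ₁ e).1 v ≤ (d.inDeg (σ₁ e).1 : ℝ)⁻¹ := by
                  rw [← one_div, le_div_iff₀ hd]; linarith
                calc _ ≤ (d.walk σ ^ t) (σ₁ e).1 v * (g σ * k σ) := by
                      have := mul_nonneg (hg σ) (hk σ); gcongr
                  _ = k σ * (d.walk σ ^ t) (σ₁ e).1 v * g σ := by ring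
                  _ ≤ _ := mul_le_mul_of_nonneg_right h4 (hg σ)
            _ = (d.inDeg (σ₁ e).1 : ℝ)⁻¹ * d.cylExp (insert e S) g σ₁ := cylExp_const_mul ..
            _ ≤ (d.inDeg (σ₁ e).1 : ℝ)⁻¹ * G := by
                gcongr; exact hG _ _ (by omega)
            _ = _ := mul_comm _ _
        · rw [walkOn_pow_eq_zero]
          · simp only [mul_zero]; exact mul_nonneg hG0 (hφ0 _)
          · intro e' he' h'
            exact hw (Finset.mem_insert_of_mem (Finset.mem_image.2 ⟨e', he', h'⟩))
          · intro h'; exact hw (h' ▸ Finset.mem_insert_self _ _)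
      -- The cancellation: a vertex is hit in proportion to its in-degree, and `φ` is the inverse
      -- in-degree, so each vertex of `W` counts at most once.
      have h5 : ∑ f, φ f ≤ (L : ℝ) + 2 := by
        have : ∑ f, φ f = ∑ w, (d.inDeg w : ℝ) * (if w ∈ W then (d.inDeg w : ℝ)⁻¹ else 0) :=
          d.sum_heads (fun w => if w ∈ W then (d.inDeg w : ℝ)⁻¹ else 0)
        rw [this]
        calc _ ≤ ∑ w, if w ∈ W then (1 : ℝ) else 0 := by
              refine Finset.sum_le_sum fun w _ => ?_
              split_ifs
              · exact mul_inv_le_one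
              · simp
          _ = W.card := by simp
          _ ≤ _ := by exact_mod_cast hWc
      calc _ ≤ d.cylExp S (fun σ₁ => G * φ (σ₁ e) + t * c) σ₀ := d.cylExp_mono fun σ₁ _ => h1 σ₁
        _ = G * d.cylExp S (fun σ₁ => φ (σ₁ e)) σ₀ + t * c := by
            rw [cylExp_add, cylExp_const_mul, cylExp_const]
        _ ≤ G * (((L : ℝ) + 2) / ((Fintype.card d.Tail : ℝ) - L)) + t * c := by
            gcongr
            refine (d.cylExp_head_le hi σ₀ hφ0 Finset.univ (fun f hf => by simp at hf)).trans ?_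
            have : (S.card : ℝ) ≤ L := by exact_mod_cast (by omega : S.card ≤ L)
            gcongr
        _ = ((t + 1 : ℕ) : ℝ) * c := by rw [hc]; push_cast; ring

/-- Moments of the probability to be at `v`, relative to a weight `k` for which all entrances
into the revealed part are cheap. -/
theorem cylExp_pow_le (d : BiDegree n) {ind k : d.Matching → ℝ} (hi0 : ∀ σ, 0 ≤ ind σ)
    (hi1 : ∀ σ, ind σ ≤ 1) (hk : ∀ σ, 0 ≤ k σ) (v : Fin n) {L h : ℕ}
    (hL : L < Fintype.card d.Tail)
    (hkv : ∀ σ w, ∀ t ≤ h, k σ * ((d.inDeg w : ℝ) * (d.walk σ ^ t) w v) ≤ 1)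
    {ν : Fin n → ℝ} (hν : ∀ x, 0 ≤ ν x) (hν1 : ∑ x, ν x ≤ 1) {β : ℝ} (hβ0 : 0 ≤ β)
    (hβ : ∀ σ (S : Finset d.Tail), ind σ ≠ 0 → S.card ≤ L →
      k σ * ∑ x, ν x * (d.walkOn S σ ^ h) x v ≤ β) (q : ℕ) :
    ∀ (S : Finset d.Tail) (σ₀ : d.Matching), S.card + q * h ≤ L →
      d.cylExp S (fun σ => ind σ * (k σ * ∑ x, ν x * (d.walk σ ^ h) x v) ^ q) σ₀ ≤
        (β + h * (((L : ℝ) + 2) / ((Fintype.card d.Tail : ℝ) - L))) ^ q := by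
  have hmL : (0 : ℝ) < (Fintype.card d.Tail : ℝ) - L := by rw [sub_pos]; exact_mod_cast hL
  set c : ℝ := ((L : ℝ) + 2) / ((Fintype.card d.Tail : ℝ) - L) with hc
  have hc0 : 0 ≤ c := by positivity
  have hb0 : 0 ≤ β + h * c := by positivity
  induction q with
  | zero => intro S σ₀ _; exact d.cylExp_le_const fun σ _ => by simpa using hi1 σ
  | succ q ih =>
    intro S σ₀ hS
    have hqh : q * h ≤ L := by
      have : (q + 1) * h = q * h + h := by ring
      omega
    -- The first `q` walks are kept as the weight of the next one. That walk may leave at most `L -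
    -- q * h` revealed tails, so that the induction hypothesis still has room for `q` walks.
    set g : d.Matching → ℝ := fun σ => ind σ * (k σ * ∑ x, ν x * (d.walk σ ^ h) x v) ^ q with hg
    have hg0 : ∀ σ, 0 ≤ g σ := fun σ => mul_nonneg (hi0 σ) (pow_nonneg (mul_nonneg (hk σ)
      (Finset.sum_nonneg fun x _ => mul_nonneg (hν x) (d.walk_pow_nonneg σ h x v))) q)
    set G : ℝ := (β + h * c) ^ q with hG
    have hG0 : 0 ≤ G := pow_nonneg hb0 q
    have hS' : S.card + h ≤ L - q * h := by
      have : (q + 1) * h = q * h + h := by ring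
      omega
    have hc' : (((L - q * h : ℕ) : ℝ) + 2) / ((Fintype.card d.Tail : ℝ) - (L - q * h : ℕ)) ≤ c := by
      have : ((L - q * h : ℕ) : ℝ) ≤ L := by exact_mod_cast Nat.sub_le _ _
      rw [hc]; gcongr
    have hwalk : ∀ x, d.cylExp S (fun σ => g σ * k σ * (d.walk σ ^ h) x v) σ₀ ≤
        d.cylExp S (fun σ => g σ * k σ) σ₀ * (d.walkOn S σ₀ ^ h) x v + h * (c * G) := fun x =>
      (d.cylExp_walk_le hg0 hk v (L := L - q * h) (h := h) (by omega) hkv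
        (fun S' τ hS' => ih S' τ (by omega)) hG0 h le_rfl S σ₀ x hS').trans (by gcongr)
    have hold : d.cylExp S (fun σ => g σ * k σ) σ₀ * ∑ x, ν x * (d.walkOn S σ₀ ^ h) x v ≤
        β * G := by
      rw [mul_comm, ← cylExp_const_mul]
      calc _ ≤ d.cylExp S (fun σ => β * g σ) σ₀ := by
            refine d.cylExp_mono fun σ hσ => ?_
            rw [← d.walkOn_congr (mem_cyl.1 hσ)]
            -- The bound `β` is known only where `ind` does not vanish; elsewhere the weight `g` is
            -- zero.
            by_cases hi : ind σ = 0
            · simp [hg, hi]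
            · have := mul_le_mul_of_nonneg_right (hβ σ S hi (by omega)) (hg0 σ)
              linarith
        _ = β * d.cylExp S g σ₀ := cylExp_const_mul ..
        _ ≤ β * G := by gcongr; exact ih S σ₀ (by omega)
    calc d.cylExp S (fun σ => ind σ * (k σ * ∑ x, ν x * (d.walk σ ^ h) x v) ^ (q + 1)) σ₀
        = ∑ x, ν x * d.cylExp S (fun σ => g σ * k σ * (d.walk σ ^ h) x v) σ₀ := by
          simp only [← cylExp_const_mul, ← cylExp_sum]
          refine d.cylExp_congr fun σ _ => ?_
          rw [pow_succ, ← mul_assoc, ← mul_assoc, Finset.mul_sum]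
          exact Finset.sum_congr rfl fun x _ => by rw [hg]; ring
      _ ≤ ∑ x, ν x * (d.cylExp S (fun σ => g σ * k σ) σ₀ * (d.walkOn S σ₀ ^ h) x v +
            h * (c * G)) := Finset.sum_le_sum fun x _ =>
          mul_le_mul_of_nonneg_left (hwalk x) (hν x)
      _ = d.cylExp S (fun σ => g σ * k σ) σ₀ * (∑ x, ν x * (d.walkOn S σ₀ ^ h) x v) +
            (∑ x, ν x) * (h * (c * G)) := by
          rw [Finset.mul_sum, Finset.sum_mul, ← Finset.sum_add_distrib]
          exact Finset.sum_congr rfl fun x _ => by ring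
      _ ≤ β * G + 1 * (h * (c * G)) := by gcongr
      _ = (β + h * c) ^ (q + 1) := by rw [pow_succ, ← hG]; ring
end BiDegree
end DCM
-- Counting paths in the revealed graph
namespace DCM

/-- Expansion according to the last use of `E`, after which `b` steps remain. -/
theorem matrix_add_pow {n : ℕ} {R : Type*} [CommSemiring R] (A E : Matrix (Fin n) (Fin n) R)
    (t : ℕ) : (A + E) ^ t = A ^ t + ∑ b ∈ Finset.range t, (A + E) ^ (t - 1 - b) * E * A ^ b := by
  induction t with
  | zero => simp
  | succ t ih =>
    have h : (A + E) ^ t * A = A ^ (t + 1) +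
        ∑ b ∈ Finset.range t, (A + E) ^ (t - 1 - b) * E * A ^ (b + 1) := by
      conv_lhs => rw [ih]
      rw [add_mul, ← pow_succ, Finset.sum_mul]
      simp only [mul_assoc, pow_succ]
    rw [pow_succ, mul_add, h, Finset.sum_range_succ', add_assoc]
    congr 1
    simp only [Nat.add_sub_cancel, pow_zero, mul_one, Nat.sub_zero]
    congr 1
    refine Finset.sum_congr rfl fun b _ => ?_
    rw [show t - (b + 1) = t - 1 - b by omega]

theorem matrix_add_single_pow {n : ℕ} (A : Matrix (Fin n) (Fin n) ℕ) (p w : Fin n) (t : ℕ)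
    (u z : Fin n) : ((A + Matrix.single p w 1 : Matrix (Fin n) (Fin n) ℕ) ^ t) u z = (A ^ t) u z +
      ∑ b ∈ Finset.range t,
        ((A + Matrix.single p w 1 : Matrix (Fin n) (Fin n) ℕ) ^ (t - 1 - b)) u p * (A ^ b) w z := by
  rw [matrix_add_pow, Matrix.add_apply, Matrix.sum_apply]
  congr 1
  refine Finset.sum_congr rfl fun b _ => ?_
  rw [Matrix.mul_apply, Finset.sum_eq_single w]
  · simp
  · intro x _ hx
    rw [Matrix.mul_single_apply_of_ne _ _ _ _ _ hx, zero_mul]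
  · simp

namespace BiDegree
variable {n : ℕ}

/-- The number of edges from `y` to `x` that start at a tail in `S`. -/
def countOn (d : BiDegree n) (S : Finset d.Tail) (σ : d.Matching) : Matrix (Fin n) (Fin n) ℕ :=
  fun y x => (S.filter fun e => e.1 = y ∧ (σ e).1 = x).card

theorem countOn_congr (d : BiDegree n) {S : Finset d.Tail} {σ τ : d.Matching}
    (h : ∀ e ∈ S, σ e = τ e) : d.countOn S σ = d.countOn S τ := by
  ext y x
  unfold countOn
  congr 1
  exact Finset.filter_congr fun e he => by rw [h e he]

theorem countOn_insert (d : BiDegree n) {S : Finset d.Tail} {e : d.Tail} (he : e ∉ S)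
    (σ : d.Matching) :
    d.countOn (insert e S) σ = d.countOn S σ + Matrix.single e.1 (σ e).1 1 := by
  ext y x
  simp only [countOn, Matrix.add_apply, Matrix.single_apply]
  rw [Finset.filter_insert]
  split_ifs with h
  · rw [Finset.card_insert_of_notMem]
    simp [he]
  · rfl

theorem walkOn_eq_countOn (d : BiDegree n) (S : Finset d.Tail) (σ : d.Matching) (y x : Fin n) :
    d.walkOn S σ y x = (d.countOn S σ y x : ℝ) * (d.outDeg y : ℝ)⁻¹ := by
  have : d.countOn S σ y x = ∑ e : d.Tail, if e ∈ S ∧ e.1 = y ∧ (σ e).1 = x then 1 else 0 := by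
    rw [countOn, Finset.card_filter, ← Finset.sum_filter_add_sum_filter_not Finset.univ (· ∈ S)]
    simp only [Finset.filter_mem_eq_inter, Finset.univ_inter]
    rw [Finset.sum_eq_zero (s := Finset.filter _ _), add_zero]
    · exact Finset.sum_congr rfl fun e he => by simp [he]
    · intro e he; simp only [Finset.mem_filter] at he; simp [he.2]
  rw [this, Fintype.sum_sigma, Finset.sum_eq_single y, walkOn]
  · push_cast
    rw [Finset.sum_mul]
    refine Finset.sum_congr rfl fun i _ => ?_
    simp
  · intro b _ hb
    exact Finset.sum_eq_zero fun i _ => by simp [hb]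
  · simp

/-- A path of length `t` has weight at most `2 ^ (-t)`, since all out-degrees are at least `2`. -/
theorem walkOn_pow_le_countOn (d : BiDegree n) (hout : ∀ v, 2 ≤ d.outDeg v) (S : Finset d.Tail)
    (σ : d.Matching) (t : ℕ) (y x : Fin n) :
    (d.walkOn S σ ^ t) y x ≤ (1 / 2) ^ t * ((d.countOn S σ ^ t) y x : ℝ) := by
  induction t generalizing y with
  | zero => simp [Matrix.one_apply]
  | succ t ih =>
    rw [pow_succ', pow_succ' (d.countOn S σ), Matrix.mul_apply, Matrix.mul_apply, Nat.cast_sum,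
      Finset.mul_sum]
    refine Finset.sum_le_sum fun z _ => ?_
    have h1 : d.walkOn S σ y z ≤ 1 / 2 * (d.countOn S σ y z : ℝ) := by
      rw [walkOn_eq_countOn, mul_comm]
      have : (d.outDeg y : ℝ)⁻¹ ≤ 1 / 2 := by
        rw [one_div]; gcongr; exact_mod_cast hout y
      gcongr
    calc _ ≤ (1 / 2 * (d.countOn S σ y z : ℝ)) * ((1 / 2) ^ t * ((d.countOn S σ ^ t) z x : ℝ)) :=
          mul_le_mul h1 (ih z) (d.walkOn_pow_nonneg S σ t z x) (by positivity)
      _ = _ := by push_cast; ring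

/-- The revealed edges contain at most one path between any two vertices. -/
def UniquePaths (d : BiDegree n) (S : Finset d.Tail) (σ : d.Matching) : Prop :=
  ∀ u z N, ∑ t ∈ Finset.range N, (d.countOn S σ ^ t) u z ≤ 1

/-- The revealed edges contain at most `t + 1` paths of length `t` between any two vertices. -/
def FewPaths (d : BiDegree n) (S : Finset d.Tail) (σ : d.Matching) : Prop :=
  ∀ u z t, (d.countOn S σ ^ t) u z ≤ t + 1

theorem UniquePaths.congr {d : BiDegree n} {S : Finset d.Tail} {σ τ : d.Matching}
    (h : d.UniquePaths S σ) (hστ : τ ∈ d.cyl S σ) : d.UniquePaths S τ := by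
  unfold UniquePaths; rw [d.countOn_congr (mem_cyl.1 hστ)]; exact h

theorem FewPaths.congr {d : BiDegree n} {S : Finset d.Tail} {σ τ : d.Matching}
    (h : d.FewPaths S σ) (hστ : τ ∈ d.cyl S σ) : d.FewPaths S τ := by
  unfold FewPaths; rw [d.countOn_congr (mem_cyl.1 hστ)]; exact h

theorem UniquePaths.le_one {d : BiDegree n} {S : Finset d.Tail} {σ : d.Matching}
    (h : d.UniquePaths S σ) (u z : Fin n) (t : ℕ) : (d.countOn S σ ^ t) u z ≤ 1 :=
  (Finset.single_le_sum (f := fun t => (d.countOn S σ ^ t) u z) (fun _ _ => Nat.zero_le _)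
    (Finset.self_mem_range_succ t)).trans (h u z (t + 1))

theorem UniquePaths.fewPaths {d : BiDegree n} {S : Finset d.Tail} {σ : d.Matching}
    (h : d.UniquePaths S σ) : d.FewPaths S σ :=
  fun u z t => (h.le_one u z t).trans (by omega)

theorem uniquePaths_empty (d : BiDegree n) (σ : d.Matching) : d.UniquePaths ∅ σ := by
  intro u z N
  have h0 : d.countOn ∅ σ = 0 := by ext; simp [countOn]
  rw [h0]
  calc ∑ t ∈ Finset.range N, ((0 : Matrix (Fin n) (Fin n) ℕ) ^ t) u z
      ≤ ∑ t ∈ Finset.range N, if t = 0 then 1 else 0 := by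
        refine Finset.sum_le_sum fun t _ => ?_
        cases t with
        | zero => simp [Matrix.one_apply]; split_ifs <;> simp
        | succ t => simp
    _ ≤ 1 := by rw [Finset.sum_ite_eq' ]; split_ifs <;> simp

/-- A path either avoids the new edge, in at most one way, or is cut at its last use of that edge.
The part before the cut is shorter than `t`, so by induction it has at most `t` choices; the part
after it has at most one choice over all lengths together. This last point is why `UniquePaths` sums
over the lengths. -/
theorem UniquePaths.insert {d : BiDegree n} {S : Finset d.Tail} {σ : d.Matching}
    (h : d.UniquePaths S σ) {e : d.Tail} (he : e ∉ S) : d.FewPaths (insert e S) σ := by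
  intro u z t
  induction t using Nat.strong_induction_on generalizing u z with
  | _ t ih =>
    rw [countOn_insert d he, matrix_add_single_pow, ← countOn_insert d he]
    calc _ ≤ 1 + ∑ b ∈ Finset.range t, t * (d.countOn S σ ^ b) (σ e).1 z := by
          refine Nat.add_le_add (h.le_one u z t) (Finset.sum_le_sum fun b hb => ?_)
          have hb' := Finset.mem_range.1 hb
          refine Nat.mul_le_mul_right _ ((ih (t - 1 - b) (by omega) u e.1).trans (by omega))
      _ ≤ 1 + t * 1 := by rw [← Finset.mul_sum]; gcongr; exact h _ _ _
      _ = t + 1 := by ring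

section Fresh
variable {d : BiDegree n} {S : Finset d.Tail} {σ : d.Matching} {e : d.Tail}

theorem countOn_pow_row_eq_zero {w : Fin n} (hw : ∀ e' ∈ S, e'.1 ≠ w) (b : ℕ) (z : Fin n)
    (h : b ≠ 0 ∨ w ≠ z) : (d.countOn S σ ^ b) w z = 0 := by
  cases b with
  | zero => simp only [ne_eq, not_true_eq_false, false_or] at h; simp [h]
  | succ b =>
    rw [pow_succ', Matrix.mul_apply]
    refine Finset.sum_eq_zero fun x _ => ?_
    rw [show d.countOn S σ w x = 0 from ?_, zero_mul]
    rw [countOn, Finset.card_eq_zero, Finset.filter_eq_empty_iff]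
    exact fun e' he' h' => hw e' he' h'.1

theorem countOn_pow_col_eq_zero {w : Fin n} (hw : ∀ e' ∈ S, (σ e').1 ≠ w) (b : ℕ) (u : Fin n)
    (h : b ≠ 0 ∨ u ≠ w) : (d.countOn S σ ^ b) u w = 0 := by
  cases b with
  | zero => simp only [ne_eq, not_true_eq_false, false_or] at h; simp [h]
  | succ b =>
    rw [pow_succ, Matrix.mul_apply]
    refine Finset.sum_eq_zero fun x _ => ?_
    rw [show d.countOn S σ x w = 0 from ?_, mul_zero]
    rw [countOn, Finset.card_eq_zero, Finset.filter_eq_empty_iff]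
    exact fun e' he' h' => hw e' he' h'.2

theorem countOn_insert_pow_of_ne (he : e ∉ S) (hrow : ∀ e' ∈ S, e'.1 ≠ (σ e).1) {u z : Fin n}
    (hz : z ≠ (σ e).1) (t : ℕ) :
    (d.countOn (insert e S) σ ^ t) u z = (d.countOn S σ ^ t) u z := by
  rw [countOn_insert d he, matrix_add_single_pow, Finset.sum_eq_zero, add_zero]
  exact fun b _ => by rw [countOn_pow_row_eq_zero hrow b z (Or.inr hz.symm), mul_zero]

/-- A fresh endpoint has the new edge as its only incoming edge and no outgoing one, so a path to it
is a path to `e.1` followed by that edge. -/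
theorem countOn_insert_pow_succ (he : e ∉ S) (hne : e.1 ≠ (σ e).1)
    (hrow : ∀ e' ∈ S, e'.1 ≠ (σ e).1) (hcol : ∀ e' ∈ S, (σ e').1 ≠ (σ e).1) (u : Fin n) (t : ℕ) :
    (d.countOn (insert e S) σ ^ (t + 1)) u (σ e).1 = (d.countOn S σ ^ t) u e.1 := by
  conv_lhs => rw [countOn_insert d he, matrix_add_single_pow, ← countOn_insert d he]
  rw [countOn_pow_col_eq_zero hcol _ _ (Or.inl (Nat.succ_ne_zero t)), zero_add,
    Finset.sum_range_succ', Finset.sum_eq_zero, zero_add]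
  · simp [countOn_insert_pow_of_ne he hrow hne]
  · intro b _
    rw [countOn_pow_row_eq_zero hrow _ _ (Or.inl (Nat.succ_ne_zero b)), mul_zero]

theorem UniquePaths.insert_fresh (h : d.UniquePaths S σ) (he : e ∉ S) (hne : e.1 ≠ (σ e).1)
    (hrow : ∀ e' ∈ S, e'.1 ≠ (σ e).1) (hcol : ∀ e' ∈ S, (σ e').1 ≠ (σ e).1) :
    d.UniquePaths (Insert.insert e S) σ := by
  intro u z N
  by_cases hz : z = (σ e).1
  · subst hz
    cases N with
    | zero => simp
    | succ N =>
      rw [Finset.sum_range_succ', pow_zero]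
      simp only [countOn_insert_pow_succ he hne hrow hcol]
      by_cases hu : u = (σ e).1
      · rw [Finset.sum_eq_zero]
        · rw [hu, Matrix.one_apply_eq, zero_add]
        · intro t _
          rw [hu]
          exact countOn_pow_row_eq_zero hrow _ _ (Or.inr hne.symm)
      · rw [Matrix.one_apply_ne hu, add_zero]; exact h _ _ _
  · simp only [countOn_insert_pow_of_ne he hrow hz]; exact h _ _ _

theorem FewPaths.insert_fresh (h : d.FewPaths S σ) (he : e ∉ S) (hne : e.1 ≠ (σ e).1)
    (hrow : ∀ e' ∈ S, e'.1 ≠ (σ e).1) (hcol : ∀ e' ∈ S, (σ e').1 ≠ (σ e).1) :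
    d.FewPaths (Insert.insert e S) σ := by
  intro u z t
  by_cases hz : z = (σ e).1
  · subst hz
    cases t with
    | zero => simp [Matrix.one_apply]; split_ifs <;> simp
    | succ t => rw [countOn_insert_pow_succ he hne hrow hcol]; exact (h _ _ _).trans (by omega)
  · rw [countOn_insert_pow_of_ne he hrow hz]; exact h _ _ _

end Fresh

/-- The vertices seen so far, when the tail `e` is about to be revealed. -/
def seen (d : BiDegree n) (S : Finset d.Tail) (σ : d.Matching) (e : d.Tail) : Finset (Fin n) :=
  insert e.1 (S.image Sigma.fst ∪ S.image fun e' => (σ e').1)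

theorem card_seen_le (d : BiDegree n) (S : Finset d.Tail) (σ : d.Matching) (e : d.Tail) :
    (d.seen S σ e).card ≤ 2 * S.card + 1 := by
  have h1 := Finset.card_insert_le e.1 (S.image Sigma.fst ∪ S.image fun e' => (σ e').1)
  have h2 := Finset.card_union_le (S.image Sigma.fst) (S.image fun e' => (σ e').1)
  have h3 := Finset.card_image_le (s := S) (f := Sigma.fst)
  have h4 := Finset.card_image_le (s := S) (f := fun e' => (σ e').1)
  unfold seen
  omega

theorem fresh_of_notMem_seen {d : BiDegree n} {S : Finset d.Tail} {σ₀ σ : d.Matching} {e : d.Tail}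
    (hσ : σ ∈ d.cyl S σ₀) (h : (σ e).1 ∉ d.seen S σ₀ e) : e.1 ≠ (σ e).1 ∧
      (∀ e' ∈ S, e'.1 ≠ (σ e).1) ∧ ∀ e' ∈ S, (σ e').1 ≠ (σ e).1 := by
  simp only [seen, Finset.mem_insert, Finset.mem_union, Finset.mem_image, not_or, not_exists,
    not_and] at h
  refine ⟨fun h' => h.1 h'.symm, h.2.1, fun e' he' => ?_⟩
  rw [mem_cyl.1 hσ e' he']; exact h.2.2 e' he'

/-- The new tail hits the small set `V` with probability at most `ρ`, since `V` carries at most `(2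
* L + 2) * Δ` heads. The extra cost `X` is paid only in that case. -/
theorem cylExp_fresh_le (d : BiDegree n) {S : Finset d.Tail} {e : d.Tail} (he : e ∉ S)
    {Δ ρ : ℝ} {L : ℕ} (hL : L < Fintype.card d.Tail) (hS : S.card ≤ L)
    (hΔ : ∀ w, (d.inDeg w : ℝ) ≤ Δ) (hΔ0 : 0 ≤ Δ)
    (hρ : (2 * (L : ℝ) + 2) * Δ ≤ ρ * ((Fintype.card d.Tail : ℝ) - L))
    (V : Finset (Fin n)) (hV : V.card ≤ 2 * L + 2) {F : d.Matching → ℝ} {σ₀ : d.Matching}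
    {B X : ℝ} (hX : 0 ≤ X) (h1 : ∀ σ ∈ d.cyl S σ₀, (σ e).1 ∉ V → F σ ≤ B)
    (h2 : ∀ σ ∈ d.cyl S σ₀, F σ ≤ B + X) : d.cylExp S F σ₀ ≤ B + ρ * X := by
  have hmL : (0 : ℝ) < (Fintype.card d.Tail : ℝ) - L := by rw [sub_pos]; exact_mod_cast hL
  set φ : d.Head → ℝ := fun f => if f.1 ∈ V then 1 else 0 with hφ
  calc d.cylExp S F σ₀ ≤ d.cylExp S (fun σ => B + X * φ (σ e)) σ₀ := by
        refine d.cylExp_mono fun σ hσ => ?_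
        by_cases hw : (σ e).1 ∈ V
        · simpa [hφ, hw] using h2 σ hσ
        · simpa [hφ, hw] using h1 σ hσ hw
    _ = B + X * d.cylExp S (fun σ => φ (σ e)) σ₀ := by
        rw [cylExp_add, cylExp_const_mul, cylExp_const]
    _ ≤ B + X * ρ := by
        gcongr
        refine (d.cylExp_head_le he σ₀ (fun f => ?_) Finset.univ (fun f hf => by simp at hf)).trans ?_
        · simp only [hφ]; split_ifs <;> norm_num
        have h3 : (∑ f, φ f) ≤ (2 * (L : ℝ) + 2) * Δ := by
          have : ∑ f, φ f = ∑ w, (d.inDeg w : ℝ) * (if w ∈ V then 1 else 0) :=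
            d.sum_heads (fun w => if w ∈ V then 1 else 0)
          rw [this]
          simp only [mul_ite, mul_one, mul_zero, Finset.sum_ite_mem, Finset.univ_inter]
          calc ∑ w ∈ V, (d.inDeg w : ℝ) ≤ ∑ _w ∈ V, Δ := Finset.sum_le_sum fun w _ => hΔ w
            _ = V.card * Δ := by simp
            _ ≤ _ := by gcongr; exact_mod_cast hV
        have h4 : (S.card : ℝ) ≤ L := by exact_mod_cast hS
        have h5 : 0 ≤ (2 * (L : ℝ) + 2) * Δ := by positivity
        calc _ ≤ (2 * (L : ℝ) + 2) * Δ / ((Fintype.card d.Tail : ℝ) - L) := by gcongr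
          _ ≤ ρ := by rw [div_le_iff₀ hmL]; exact hρ
    _ = _ := by rw [mul_comm X]

end BiDegree
end DCM
-- Walks with at most one collision
namespace DCM
namespace BiDegree
variable {n : ℕ}

section Collisions
variable {d : BiDegree n} {Δ ρ : ℝ} {L : ℕ}

/-- A walk that starts in a revealed part with few paths. -/
theorem cylExp_walk_le_of_fewPaths (hL : L < Fintype.card d.Tail)
    (hΔ : ∀ w, (d.inDeg w : ℝ) ≤ Δ) (hΔ0 : 0 ≤ Δ) (hρ0 : 0 ≤ ρ)
    (hρ : (2 * (L : ℝ) + 2) * Δ ≤ ρ * ((Fintype.card d.Tail : ℝ) - L))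
    {g : d.Matching → ℝ} (hg1 : ∀ σ, g σ ≤ 1) (z : Fin n) {G₁ : ℝ}
    (hG₁ : ∀ S σ, S.card ≤ L → d.FewPaths S σ → d.cylExp S g σ ≤ G₁) (t : ℕ) :
    ∀ (S : Finset d.Tail) (σ₀ : d.Matching) (y : Fin n), S.card + t ≤ L → d.FewPaths S σ₀ →
      d.cylExp S (fun σ => g σ * (d.walk σ ^ t) y z) σ₀ ≤
        G₁ * (d.walkOn S σ₀ ^ t) y z + t * ρ := by
  induction t with
  | zero =>
    intro S σ₀ y hS h
    simp only [pow_zero, Nat.cast_zero, zero_mul, add_zero]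
    simp only [mul_comm _ ((1 : Matrix (Fin n) (Fin n) ℝ) y z)]
    rw [cylExp_const_mul]
    gcongr
    · simp only [Matrix.one_apply]; split_ifs <;> norm_num
    · exact hG₁ S σ₀ (by omega) h
  | succ t ih =>
    intro S σ₀ y hS h
    refine d.cylExp_walk_step_le (by positivity) (fun i hi => ?_) (fun i hi => ?_)
    · refine (ih S σ₀ _ (by omega) h).trans ?_
      push_cast; linarith
    · set e : d.Tail := ⟨y, i⟩ with he
      have hcard : (insert e S).card = S.card + 1 := Finset.card_insert_of_notMem hi
      -- The target `z` joins the vertices to avoid: from any other fresh vertex no revealed edge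
      -- leads on, so the revealed walk cannot reach `z`.
      refine (d.cylExp_fresh_le hi hL (by omega) hΔ hΔ0 hρ (insert z (d.seen S σ₀ e)) ?_
        (B := t * ρ) (X := 1) zero_le_one ?_ ?_).trans (by push_cast; linarith)
      · have := d.card_seen_le S σ₀ e
        have := Finset.card_insert_le z (d.seen S σ₀ e)
        omega
      · intro σ hσ hw
        simp only [Finset.mem_insert, not_or] at hw
        obtain ⟨hne, hrow, hcol⟩ := fresh_of_notMem_seen hσ hw.2
        refine (ih _ σ _ (by omega) ((h.congr hσ).insert_fresh hi hne hrow hcol)).trans ?_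
        rw [walkOn_pow_eq_zero, mul_zero, zero_add]
        · intro e' he'
          rcases Finset.mem_insert.1 he' with rfl | h'
          · exact hne
          · exact hrow e' h'
        · exact hw.1
      · intro σ hσ
        have : (0 : ℝ) ≤ t * ρ := by positivity
        refine (d.cylExp_le_const fun τ _ => ?_).trans (by linarith : (1 : ℝ) ≤ _)
        exact mul_le_one₀ (hg1 τ) (d.walk_pow_nonneg τ t _ _) (d.walk_pow_le_one τ t _ _)

/-- A walk that starts in a revealed part with unique paths. -/
theorem cylExp_walk_le_of_uniquePaths (hL : L < Fintype.card d.Tail)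
    (hΔ : ∀ w, (d.inDeg w : ℝ) ≤ Δ) (hΔ0 : 0 ≤ Δ) (hρ0 : 0 ≤ ρ)
    (hρ : (2 * (L : ℝ) + 2) * Δ ≤ ρ * ((Fintype.card d.Tail : ℝ) - L))
    {g : d.Matching → ℝ} (hg1 : ∀ σ, g σ ≤ 1) (z : Fin n) {G₀ G₁ : ℝ}
    (hG₁0 : 0 ≤ G₁)
    (hG₁ : ∀ S σ, S.card ≤ L → d.FewPaths S σ → d.cylExp S g σ ≤ G₁)
    (hG₀ : ∀ S σ, S.card ≤ L → d.UniquePaths S σ → d.cylExp S g σ ≤ G₀) (t : ℕ) :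
    ∀ (S : Finset d.Tail) (σ₀ : d.Matching) (y : Fin n), S.card + t ≤ L → d.UniquePaths S σ₀ →
      d.cylExp S (fun σ => g σ * (d.walk σ ^ t) y z) σ₀ ≤
        G₀ * (d.walkOn S σ₀ ^ t) y z + t * ρ * (G₁ + L * ρ) := by
  induction t with
  | zero =>
    intro S σ₀ y hS h
    simp only [pow_zero, Nat.cast_zero, zero_mul, add_zero]
    simp only [mul_comm _ ((1 : Matrix (Fin n) (Fin n) ℝ) y z)]
    rw [cylExp_const_mul]
    gcongr
    · simp only [Matrix.one_apply]; split_ifs <;> norm_num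
    · exact hG₀ S σ₀ (by omega) h
  | succ t ih =>
    intro S σ₀ y hS h
    refine d.cylExp_walk_step_le (by positivity) (fun i hi => ?_) (fun i hi => ?_)
    · refine (ih S σ₀ _ (by omega) h).trans ?_
      have : 0 ≤ ρ * (G₁ + L * ρ) := by positivity
      push_cast; linarith
    · set e : d.Tail := ⟨y, i⟩ with he
      have hcard : (insert e S).card = S.card + 1 := Finset.card_insert_of_notMem hi
      refine (d.cylExp_fresh_le hi hL (by omega) hΔ hΔ0 hρ (insert z (d.seen S σ₀ e)) ?_
        (B := t * ρ * (G₁ + L * ρ)) (X := G₁ + L * ρ) (by positivity) ?_ ?_).trans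
        (by push_cast; linarith)
      · have := d.card_seen_le S σ₀ e
        have := Finset.card_insert_le z (d.seen S σ₀ e)
        omega
      · intro σ hσ hw
        simp only [Finset.mem_insert, not_or] at hw
        obtain ⟨hne, hrow, hcol⟩ := fresh_of_notMem_seen hσ hw.2
        refine (ih _ σ _ (by omega) ((h.congr hσ).insert_fresh hi hne hrow hcol)).trans ?_
        rw [walkOn_pow_eq_zero, mul_zero, zero_add]
        · intro e' he'
          rcases Finset.mem_insert.1 he' with rfl | h'
          · exact hne
          · exact hrow e' h'
        · exact hw.1
      · intro σ hσ
        have h1 : (0 : ℝ) ≤ t * ρ * (G₁ + L * ρ) := by positivity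
        -- The first collision only degrades unique paths to few paths, so it costs `G₁ + L * ρ`
        -- rather than `1`: a second factor `ρ` or a small `G₁` remains.
        have h2 := cylExp_walk_le_of_fewPaths hL hΔ hΔ0 hρ0 hρ hg1 z hG₁ t (insert e S) σ
          (σ e).1 (by omega) ((h.congr hσ).insert hi)
        have h3 : G₁ * (d.walkOn (insert e S) σ ^ t) (σ e).1 z ≤ G₁ :=
          mul_le_of_le_one_right hG₁0 (d.walkOn_pow_le_one _ _ _ _ _)
        have h4 : (t : ℝ) * ρ ≤ L * ρ := by gcongr; omega
        linarith

/-- Moments of the probability to be at `z` for a walk whose revealed part has few paths. -/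
theorem cylExp_pow_le_of_fewPaths (hL : L < Fintype.card d.Tail)
    (hout : ∀ v, 2 ≤ d.outDeg v)
    (hΔ : ∀ w, (d.inDeg w : ℝ) ≤ Δ) (hΔ0 : 0 ≤ Δ) (hρ0 : 0 ≤ ρ)
    (hρ : (2 * (L : ℝ) + 2) * Δ ≤ ρ * ((Fintype.card d.Tail : ℝ) - L))
    {R : ℕ} {β : ℝ} (hβ : ((R : ℝ) + 1) * (1 / 2) ^ R ≤ β) (hβ1 : β ≤ 1) (y z : Fin n) (j : ℕ) :
    ∀ (S : Finset d.Tail) (σ₀ : d.Matching), S.card + j * R ≤ L → d.FewPaths S σ₀ →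
      d.cylExp S (fun σ => ((d.walk σ ^ R) y z) ^ j) σ₀ ≤ β ^ j + j * (L * ρ) := by
  have hβ0 : 0 ≤ β := le_trans (by positivity) hβ
  induction j with
  | zero => intro S σ₀ _ _; simp [cylExp_const]
  | succ j ih =>
    intro S σ₀ hS h
    have hjR : (j + 1) * R = j * R + R := by ring
    have hle : ((L - j * R : ℕ) : ℝ) ≤ L := by exact_mod_cast Nat.sub_le _ _
    have h1 := cylExp_walk_le_of_fewPaths (L := L - j * R) (ρ := ρ) (by omega) hΔ hΔ0 hρ0 (by
        refine le_trans (by gcongr) (hρ.trans ?_); gcongr)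
      (g := fun σ => ((d.walk σ ^ R) y z) ^ j)
      (fun σ => pow_le_one₀ (d.walk_pow_nonneg σ R y z) (d.walk_pow_le_one σ R y z)) z
      (fun S' σ hS' => ih S' σ (by omega)) R S σ₀ y (by omega) h
    simp only [← pow_succ] at h1
    -- At most `R + 1` revealed paths, each of weight at most `2 ^ (-R)`.
    have h2 : (d.walkOn S σ₀ ^ R) y z ≤ β := by
      refine (d.walkOn_pow_le_countOn hout S σ₀ R y z).trans (le_trans ?_ hβ)
      rw [mul_comm]; gcongr; exact_mod_cast h y z R
    have h3 : (R : ℝ) * ρ ≤ L * ρ := by gcongr; omega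
    have h4 : 0 ≤ (j : ℝ) * (L * ρ) := by positivity
    calc _ ≤ _ := h1
      _ ≤ (β ^ j + j * (L * ρ)) * β + L * ρ := by gcongr
      _ = β ^ (j + 1) + j * (L * ρ) * β + L * ρ := by ring
      _ ≤ β ^ (j + 1) + j * (L * ρ) * 1 + L * ρ := by gcongr
      _ = _ := by push_cast; ring

/-- The three terms correspond to no collision, to one collision, which can spoil a single factor
`β`, and to two collisions. -/
theorem cylExp_pow_le_of_uniquePaths (hL : L < Fintype.card d.Tail)
    (hout : ∀ v, 2 ≤ d.outDeg v)
    (hΔ : ∀ w, (d.inDeg w : ℝ) ≤ Δ) (hΔ0 : 0 ≤ Δ) (hρ0 : 0 ≤ ρ)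
    (hρ : (2 * (L : ℝ) + 2) * Δ ≤ ρ * ((Fintype.card d.Tail : ℝ) - L))
    {R : ℕ} {β : ℝ} (hβ : ((R : ℝ) + 1) * (1 / 2) ^ R ≤ β) (hβ1 : β ≤ 1) (y z : Fin n) (j : ℕ) :
    ∀ (S : Finset d.Tail) (σ₀ : d.Matching), S.card + j * R ≤ L → d.UniquePaths S σ₀ →
      d.cylExp S (fun σ => ((d.walk σ ^ R) y z) ^ j) σ₀ ≤
        β ^ j + j * (L * ρ) * β ^ (j - 1) + j ^ 2 * (L * ρ) ^ 2 := by
  have hβ0 : 0 ≤ β := le_trans (by positivity) hβ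
  induction j with
  | zero => intro S σ₀ _ _; simp [cylExp_const]
  | succ j ih =>
    intro S σ₀ hS h
    have hjR : (j + 1) * R = j * R + R := by ring
    have hle : ((L - j * R : ℕ) : ℝ) ≤ L := by exact_mod_cast Nat.sub_le _ _
    have hx0 : 0 ≤ L * ρ := by positivity
    have h1 := cylExp_walk_le_of_uniquePaths (L := L - j * R) (ρ := ρ) (by omega) hΔ hΔ0 hρ0 (by
        refine le_trans (by gcongr) (hρ.trans ?_); gcongr)
      (g := fun σ => ((d.walk σ ^ R) y z) ^ j)
      (fun σ => pow_le_one₀ (d.walk_pow_nonneg σ R y z) (d.walk_pow_le_one σ R y z)) z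
      (G₁ := β ^ j + j * (L * ρ)) (by positivity)
      (fun S' σ hS' h' => cylExp_pow_le_of_fewPaths hL hout hΔ hΔ0 hρ0 hρ hβ hβ1 y z j S' σ
        (by omega) h')
      (fun S' σ hS' => ih S' σ (by omega)) R S σ₀ y (by omega) h
    simp only [← pow_succ] at h1
    have h2 : (d.walkOn S σ₀ ^ R) y z ≤ β := by
      refine (d.walkOn_pow_le_countOn hout S σ₀ R y z).trans (le_trans ?_ hβ)
      rw [mul_comm]; gcongr; exact_mod_cast h.fewPaths y z R
    have h3 : (R : ℝ) * ρ ≤ L * ρ := by gcongr; omega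
    have h5 : (j : ℝ) * (L * ρ) * β ^ (j - 1) * β = j * (L * ρ) * β ^ j := by
      cases j with
      | zero => simp
      | succ j => rw [Nat.add_sub_cancel]; ring
    have h6 : (j : ℝ) ^ 2 * (L * ρ) ^ 2 * β ≤ (j : ℝ) ^ 2 * (L * ρ) ^ 2 * 1 := by gcongr
    calc _ ≤ _ := h1
      _ ≤ (β ^ j + j * (L * ρ) * β ^ (j - 1) + j ^ 2 * (L * ρ) ^ 2) * β +
          L * ρ * (β ^ j + j * (L * ρ) + L * ρ) := by gcongr
      _ = β ^ (j + 1) + j * (L * ρ) * β ^ (j - 1) * β + j ^ 2 * (L * ρ) ^ 2 * β +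
          L * ρ * (β ^ j + j * (L * ρ) + L * ρ) := by ring
      _ ≤ β ^ (j + 1) + j * (L * ρ) * β ^ j + j ^ 2 * (L * ρ) ^ 2 * 1 +
          L * ρ * (β ^ j + j * (L * ρ) + L * ρ) := by rw [h5]; gcongr
      _ ≤ _ := by
        rw [Nat.add_sub_cancel]; push_cast
        nlinarith [mul_nonneg (Nat.cast_nonneg (α := ℝ) j) (sq_nonneg (L * ρ))]

/-- A walk followed by a functional of its endpoint. -/
theorem cylExp_sum_walk_step_le {S : Finset d.Tail} {g : Fin n → d.Matching → ℝ} {t : ℕ}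
    {y : Fin n} {σ₀ : d.Matching} {B C : ℝ} (hB : 0 ≤ B) (hC : 0 ≤ C)
    (hold : ∀ i, (⟨y, i⟩ : d.Tail) ∈ S →
      d.cylExp S (fun σ => ∑ z, g z σ * (d.walk σ ^ t) (σ₀ ⟨y, i⟩).1 z) σ₀ ≤ C + B)
    (hnew : ∀ i, (⟨y, i⟩ : d.Tail) ∉ S → d.cylExp S (fun σ₁ => d.cylExp (insert ⟨y, i⟩ S)
          (fun σ => ∑ z, g z σ * (d.walk σ ^ t) (σ₁ ⟨y, i⟩).1 z) σ₁) σ₀ ≤ C + B) :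
    d.cylExp S (fun σ => ∑ z, g z σ * (d.walk σ ^ (t + 1)) y z) σ₀ ≤ C + B := by
  rw [cylExp_sum]
  simp only [cylExp_walk_step]
  rw [← Finset.mul_sum, Finset.sum_comm]
  calc _ ≤ (d.outDeg y : ℝ)⁻¹ * ∑ _i : Fin (d.outDeg y), (0 : ℝ) + (C + B) := by
        refine inv_mul_sum_le (by positivity) _ fun i => ?_
        rw [zero_add]
        by_cases hi : (⟨y, i⟩ : d.Tail) ∈ S
        · simp only [hi, if_true]
          rw [← cylExp_sum]; exact hold i hi
        · simp only [hi, if_false]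
          simp only [cylExp_sum] at hnew
          exact hnew i hi
    _ = C + B := by simp

/-- The endpoint `z` is chosen by the walk itself, so staying in the revealed part is harmless as
long as `g z` is controlled for every `z`. Only collisions add to `G₁`. -/
theorem cylExp_sum_walk_le_of_fewPaths (hL : L < Fintype.card d.Tail)
    (hΔ : ∀ w, (d.inDeg w : ℝ) ≤ Δ) (hΔ0 : 0 ≤ Δ) (hρ0 : 0 ≤ ρ)
    (hρ : (2 * (L : ℝ) + 2) * Δ ≤ ρ * ((Fintype.card d.Tail : ℝ) - L))
    {g : Fin n → d.Matching → ℝ} (hg1 : ∀ z σ, g z σ ≤ 1) {G₁ : ℝ} (hG₁0 : 0 ≤ G₁)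
    (hG₁ : ∀ z S σ, S.card ≤ L → d.FewPaths S σ → d.cylExp S (g z) σ ≤ G₁) (t : ℕ) :
    ∀ (S : Finset d.Tail) (σ₀ : d.Matching) (y : Fin n), S.card + t ≤ L → d.FewPaths S σ₀ →
      d.cylExp S (fun σ => ∑ z, g z σ * (d.walk σ ^ t) y z) σ₀ ≤ G₁ + t * ρ := by
  induction t with
  | zero =>
    intro S σ₀ y hS h
    simpa [Matrix.one_apply] using hG₁ y S σ₀ (by omega) h
  | succ t ih =>
    intro S σ₀ y hS h
    refine cylExp_sum_walk_step_le (by positivity) hG₁0 (fun i hi => ?_) (fun i hi => ?_)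
    · refine (ih S σ₀ _ (by omega) h).trans ?_
      push_cast; linarith
    · set e : d.Tail := ⟨y, i⟩ with he
      have hcard : (insert e S).card = S.card + 1 := Finset.card_insert_of_notMem hi
      refine (d.cylExp_fresh_le hi hL (by omega) hΔ hΔ0 hρ (d.seen S σ₀ e) ?_
        (B := G₁ + t * ρ) (X := 1) zero_le_one ?_ ?_).trans (by push_cast; linarith)
      · have := d.card_seen_le S σ₀ e
        omega
      · intro σ hσ hw
        obtain ⟨hne, hrow, hcol⟩ := fresh_of_notMem_seen hσ hw
        exact ih _ σ _ (by omega) ((h.congr hσ).insert_fresh hi hne hrow hcol)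
      · intro σ hσ
        have : (0 : ℝ) ≤ t * ρ := by positivity
        refine (d.cylExp_le_const fun τ _ => ?_).trans (by linarith : (1 : ℝ) ≤ _)
        refine le_trans (Finset.sum_le_sum fun z _ => ?_) (d.walk_row_sum_le τ t (σ e).1)
        exact mul_le_of_le_one_left (d.walk_pow_nonneg τ t _ _) (hg1 z τ)

theorem cylExp_sum_walk_le_of_uniquePaths (hL : L < Fintype.card d.Tail)
    (hΔ : ∀ w, (d.inDeg w : ℝ) ≤ Δ) (hΔ0 : 0 ≤ Δ) (hρ0 : 0 ≤ ρ)
    (hρ : (2 * (L : ℝ) + 2) * Δ ≤ ρ * ((Fintype.card d.Tail : ℝ) - L))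
    {g : Fin n → d.Matching → ℝ} (hg1 : ∀ z σ, g z σ ≤ 1) {G₀ G₁ : ℝ} (hG₁0 : 0 ≤ G₁)
    (hG₀0 : 0 ≤ G₀)
    (hG₁ : ∀ z S σ, S.card ≤ L → d.FewPaths S σ → d.cylExp S (g z) σ ≤ G₁)
    (hG₀ : ∀ z S σ, S.card ≤ L → d.UniquePaths S σ → d.cylExp S (g z) σ ≤ G₀) (t : ℕ) :
    ∀ (S : Finset d.Tail) (σ₀ : d.Matching) (y : Fin n), S.card + t ≤ L → d.UniquePaths S σ₀ →
      d.cylExp S (fun σ => ∑ z, g z σ * (d.walk σ ^ t) y z) σ₀ ≤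
        G₀ + t * ρ * (G₁ + L * ρ) := by
  induction t with
  | zero =>
    intro S σ₀ y hS h
    simpa [Matrix.one_apply] using hG₀ y S σ₀ (by omega) h
  | succ t ih =>
    intro S σ₀ y hS h
    refine cylExp_sum_walk_step_le (by positivity) hG₀0 (fun i hi => ?_) (fun i hi => ?_)
    · refine (ih S σ₀ _ (by omega) h).trans ?_
      have : 0 ≤ ρ * (G₁ + L * ρ) := by positivity
      push_cast; linarith
    · set e : d.Tail := ⟨y, i⟩ with he
      have hcard : (insert e S).card = S.card + 1 := Finset.card_insert_of_notMem hi
      refine (d.cylExp_fresh_le hi hL (by omega) hΔ hΔ0 hρ (d.seen S σ₀ e) ?_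
        (B := G₀ + t * ρ * (G₁ + L * ρ)) (X := G₁ + L * ρ) (by positivity) ?_ ?_).trans
          (by push_cast; linarith)
      · have := d.card_seen_le S σ₀ e
        omega
      · intro σ hσ hw
        obtain ⟨hne, hrow, hcol⟩ := fresh_of_notMem_seen hσ hw
        exact ih _ σ _ (by omega) ((h.congr hσ).insert_fresh hi hne hrow hcol)
      · intro σ hσ
        have h1 : (0 : ℝ) ≤ t * ρ * (G₁ + L * ρ) := by positivity
        have h2 := cylExp_sum_walk_le_of_fewPaths hL hΔ hΔ0 hρ0 hρ hg1 hG₁0 hG₁ t (insert e S) σ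
          (σ e).1 (by omega) ((h.congr hσ).insert hi)
        have h4 : (t : ℝ) * ρ ≤ L * ρ := by gcongr; omega
        linarith

/-- The walk started at `y` is spread out, except with a probability of order `(L * ρ) ^ 2`. -/
theorem cylExp_sum_pow_le (hout : ∀ v, 2 ≤ d.outDeg v)
    (hΔ : ∀ w, (d.inDeg w : ℝ) ≤ Δ) (hΔ0 : 0 ≤ Δ) (hρ0 : 0 ≤ ρ) {R : ℕ}
    (hL : 4 * R < Fintype.card d.Tail)
    (hρ : (2 * ((4 * R : ℕ) : ℝ) + 2) * Δ ≤ ρ * ((Fintype.card d.Tail : ℝ) - (4 * R : ℕ)))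
    {β : ℝ} (hβ : ((R : ℝ) + 1) * (1 / 2) ^ R ≤ β) (hβ1 : β ≤ 1) (y : Fin n)
    (σ₀ : d.Matching) {x : ℝ} (hx : ((4 * R : ℕ) : ℝ) * ρ ≤ x) (hβx : β ≤ x) (hx1 : x ≤ 1) :
    d.cylExp ∅ (fun σ => ∑ z, ((d.walk σ ^ R) y z) ^ 4) σ₀ ≤ 19 * x ^ 2 := by
  have hβ0 : 0 ≤ β := le_trans (by positivity) hβ
  have hx0 : 0 ≤ x := hβ0.trans hβx
  have hle : ((R : ℕ) : ℝ) ≤ (4 * R : ℕ) := by exact_mod_cast (by omega)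
  have hle3 : ((3 * R : ℕ) : ℝ) ≤ (4 * R : ℕ) := by exact_mod_cast (by omega)
  have hρ' : (2 * ((R : ℕ) : ℝ) + 2) * Δ ≤ ρ * ((Fintype.card d.Tail : ℝ) - (R : ℕ)) := by
    refine le_trans (by gcongr) (hρ.trans ?_); gcongr
  set X : ℝ := ((4 * R : ℕ) : ℝ) * ρ with hX
  have hX0 : 0 ≤ X := by positivity
  -- Of the four walks in the fourth power, one chooses the endpoint `z` and the other three have to
  -- find it; together they reveal at most `4 * R` tails.
  have h1 := cylExp_sum_walk_le_of_uniquePaths (L := R) (ρ := ρ) (by omega) hΔ hΔ0 hρ0 hρ'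
    (g := fun z σ => ((d.walk σ ^ R) y z) ^ 3)
    (fun z σ => pow_le_one₀ (d.walk_pow_nonneg σ R y z) (d.walk_pow_le_one σ R y z))
    (G₁ := β ^ 3 + 3 * X) (G₀ := β ^ 3 + 3 * X * β ^ 2 + 9 * X ^ 2) (by positivity)
    (by positivity)
    (fun z S σ hS h => by
      refine (cylExp_pow_le_of_fewPaths hL hout hΔ hΔ0 hρ0 hρ hβ hβ1 y z 3 S σ
        (by omega) h).trans (le_of_eq ?_)
      push_cast; norm_num [hX])
    (fun z S σ hS h => by
      refine (cylExp_pow_le_of_uniquePaths hL hout hΔ hΔ0 hρ0 hρ hβ hβ1 y z 3 S σ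
        (by omega) h).trans (le_of_eq ?_)
      push_cast; norm_num [hX])
    R ∅ σ₀ y (by simp) (d.uniquePaths_empty σ₀)
  simp only [← pow_succ] at h1
  refine h1.trans ?_
  have h2 : (R : ℝ) * ρ ≤ x := (mul_le_mul_of_nonneg_right hle hρ0).trans hx
  have h3 : β ^ 3 ≤ x ^ 2 := by
    calc β ^ 3 = β ^ 2 * β := by ring
      _ ≤ x ^ 2 * 1 := by gcongr
      _ = x ^ 2 := mul_one _
  have h4 : 3 * X * β ^ 2 ≤ 3 * x ^ 2 := by
    calc 3 * X * β ^ 2 ≤ 3 * x * x ^ 2 := by gcongr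
      _ ≤ 3 * 1 * x ^ 2 := by gcongr
      _ = _ := by ring
  have h5 : β ^ 3 ≤ x := by
    calc β ^ 3 ≤ β ^ 1 := pow_le_pow_of_le_one hβ0 hβ1 (by norm_num)
      _ ≤ x := by simpa using hβx
  calc _ ≤ x ^ 2 + 3 * x ^ 2 + 9 * x ^ 2 + x * (x + 3 * x + x) := by gcongr
    _ ≤ 19 * x ^ 2 := by nlinarith [sq_nonneg x]

end Collisions
end BiDegree
end DCM
-- Disjoint absorbing sets
namespace DCM
namespace BiDegree
variable {n : ℕ}

/-- A set of vertices that the walk cannot leave. -/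
def Absorbing (d : BiDegree n) (σ : d.Matching) (C : Finset (Fin n)) : Prop :=
  ∀ e : d.Tail, e.1 ∈ C → (σ e).1 ∈ C

/-- All absorbing sets are large, and two disjoint ones contain `x` and `x'`. -/
def Split (d : BiDegree n) (N : ℕ) (x x' : Fin n) (σ : d.Matching) : Prop :=
  (∀ C, d.Absorbing σ C → C.Nonempty → N ≤ C.card) ∧
    ∃ C C', d.Absorbing σ C ∧ d.Absorbing σ C' ∧ Disjoint C C' ∧ x ∈ C ∧ x' ∈ C'

section Split
variable {d : BiDegree n} {N : ℕ} {x x' : Fin n}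

open scoped Classical in
theorem cylExp_split_eq_zero {S : Finset d.Tail} {σ₀ : d.Matching}
    (h : ∀ σ ∈ d.cyl S σ₀, ¬ d.Split N x x' σ) :
    d.cylExp S (fun σ => if d.Split N x x' σ then 1 else 0) σ₀ = 0 := by
  rw [d.cylExp_congr (g' := fun _ => 0) (fun σ hσ => if_neg (h σ hσ)), cylExp_const]

open scoped Classical in
/-- The exploration from `x'` has to avoid the free heads `F` of the part explored from `x`. -/
theorem cylExp_split_le_of_free {A : Finset (Fin n)} {F : Finset d.Head} (hFA : ∀ f ∈ F, f.1 ∈ A)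
    (hm : 0 < Fintype.card d.Tail) (j : ℕ) :
    ∀ (S : Finset d.Tail) (σ₀ : d.Matching) (B : Finset (Fin n)), (∀ e ∈ S, σ₀ e ∉ F) →
      (∀ σ ∈ d.cyl S σ₀, ∀ C, d.Absorbing σ C → x ∈ C → A ⊆ C) →
      (∀ σ ∈ d.cyl S σ₀, ∀ C, d.Absorbing σ C → x' ∈ C → B ⊆ C) → x' ∈ B → B.card + j ≤ N →
      (∀ e ∈ S, e.1 ∈ A ∨ (σ₀ e).1 ∈ B) →
      d.cylExp S (fun σ => if d.Split N x x' σ then 1 else 0) σ₀ ≤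
        (1 - (F.card : ℝ) / Fintype.card d.Tail) ^ j := by
  have hFm : F.card ≤ Fintype.card d.Tail := by
    rw [← card_head]; exact Finset.card_le_univ F
  have hm' : (0 : ℝ) < Fintype.card d.Tail := by exact_mod_cast hm
  have hp0 : (0 : ℝ) ≤ 1 - (F.card : ℝ) / Fintype.card d.Tail := by
    rw [sub_nonneg, div_le_one hm']; exact_mod_cast hFm
  induction j with
  | zero =>
    intro S σ₀ B _ _ _ _ _ _
    rw [pow_zero]
    exact d.cylExp_le_const fun σ _ => by split_ifs <;> norm_num
  | succ j ih =>
    intro S σ₀ B hF hA hB hx' hcard hS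
    by_cases hex : ∃ σ ∈ d.cyl S σ₀, d.Split N x x' σ
    swap
    · rw [cylExp_split_eq_zero (by simpa using hex)]
      positivity
    obtain ⟨σ₂, hσ₂, hlarge, C, C', hC, hC', hdisj, hxC, hxC'⟩ := hex
    have hAC := hA σ₂ hσ₂ C hC hxC
    have hBC := hB σ₂ hσ₂ C' hC' hxC'
    -- Otherwise `B` would be absorbing and too small. Revealed tails that start in `A` do not
    -- matter, as `A` and `B` lie in disjoint sets.
    obtain ⟨e, heB, heS⟩ : ∃ e : d.Tail, e.1 ∈ B ∧ e ∉ S := by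
      by_contra! hall
      have : d.Absorbing σ₂ B := by
        intro e he
        have heS := hall e he
        rcases hS e heS with h | h
        · exact absurd (hBC he) (Finset.disjoint_left.1 hdisj (hAC h))
        · rwa [mem_cyl.1 hσ₂ e heS]
      have := hlarge B this ⟨x', hx'⟩
      omega
    have hlt := d.card_lt_card_tail heS
    have hpos : (0 : ℝ) < (Fintype.card d.Tail : ℝ) - S.card := by
      rw [sub_pos]; exact_mod_cast hlt
    set p : ℝ := (1 - (F.card : ℝ) / Fintype.card d.Tail) ^ j with hp
    have hp0' : 0 ≤ p := pow_nonneg hp0 j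
    rw [cylExp_tower d S e]
    calc _ ≤ d.cylExp S (fun σ₁ => if σ₁ e ∈ F then 0 else p) σ₀ := by
          refine d.cylExp_mono fun σ₁ hσ₁ => ?_
          have hsub := d.cyl_insert_subset S e hσ₁
          have hval : ∀ σ ∈ d.cyl (insert e S) σ₁, σ e = σ₁ e := fun σ hσ =>
            mem_cyl.1 hσ e (Finset.mem_insert_self _ _)
          by_cases hf : σ₁ e ∈ F
          -- A match with a free head of `A` puts a vertex into both absorbing sets.
          · rw [if_pos hf, cylExp_split_eq_zero]
            rintro σ hσ ⟨-, C, C', hC, hC', hdisj, hxC, hxC'⟩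
            refine Finset.disjoint_left.1 hdisj (hA σ (hsub hσ) C hC hxC (hFA _ hf)) ?_
            rw [← hval σ hσ]
            exact hC' e (hB σ (hsub hσ) C' hC' hxC' heB)
          · rw [if_neg hf]
            refine ih (insert e S) σ₁ (insert (σ₁ e).1 B) ?_ (fun σ hσ => hA σ (hsub hσ)) ?_
              (Finset.mem_insert_of_mem hx') ?_ ?_
            · intro e' he'
              rcases Finset.mem_insert.1 he' with rfl | h
              · exact hf
              · rw [mem_cyl.1 hσ₁ e' h]; exact hF e' h
            · intro σ hσ C hC hxC
              have h := hB σ (hsub hσ) C hC hxC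
              refine Finset.insert_subset ?_ h
              rw [← hval σ hσ]; exact hC e (h heB)
            · have := Finset.card_insert_le (σ₁ e).1 B
              omega
            · intro e' he'
              rcases Finset.mem_insert.1 he' with rfl | h
              · exact Or.inr (Finset.mem_insert_self _ _)
              · rw [mem_cyl.1 hσ₁ e' h]
                exact (hS e' h).imp id (fun h' => Finset.mem_insert_of_mem h')
      _ ≤ (∑ f ∈ (F ∪ S.image σ₀)ᶜ, if f ∈ F then 0 else p) /
            ((Fintype.card d.Tail : ℝ) - S.card) := by
          refine d.cylExp_head_le heS σ₀ (φ := fun f => if f ∈ F then 0 else p)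
            (fun f => by split_ifs <;> positivity) _ fun f hf h0 => ?_
          simp only [Finset.mem_compl, not_not, Finset.mem_union, Finset.mem_image] at hf
          rcases hf with h | h
          · simp [h] at h0
          · exact h
      -- The free heads are disjoint from the used ones, so exactly `m - S.card - F.card` of the `m
      -- - S.card` remaining heads keep the sets apart.
      _ = (1 - (F.card : ℝ) / ((Fintype.card d.Tail : ℝ) - S.card)) * p := by
          have hdis : Disjoint F (S.image σ₀) := by
            rw [Finset.disjoint_right]
            intro f hf
            obtain ⟨e', he', rfl⟩ := Finset.mem_image.1 hf
            exact hF e' he'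
          have hc : ((F ∪ S.image σ₀)ᶜ.card : ℝ) = (Fintype.card d.Tail : ℝ) - S.card - F.card := by
            rw [Finset.card_compl, card_head, Nat.cast_sub, Finset.card_union_of_disjoint hdis,
              Finset.card_image_of_injective _ σ₀.injective]
            · push_cast; ring
            · rw [← card_head]; exact Finset.card_le_univ _
          rw [Finset.sum_congr rfl (g := fun _ => p), Finset.sum_const, nsmul_eq_mul, hc]
          · field_simp
          · intro f hf
            simp only [Finset.mem_compl, Finset.mem_union, not_or] at hf
            exact if_neg hf.1
      _ ≤ (1 - (F.card : ℝ) / Fintype.card d.Tail) * p := by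
          gcongr
          linarith [(Nat.cast_nonneg S.card : (0 : ℝ) ≤ S.card)]
      _ = _ := by rw [pow_succ, mul_comm]

/-- The heads of `A` that are not matched to a tail in `S`. -/
def freeHeads (d : BiDegree n) (A : Finset (Fin n)) (S : Finset d.Tail) (σ : d.Matching) :
    Finset d.Head :=
  Finset.univ.filter fun f => f.1 ∈ A ∧ f ∉ S.image σ

theorem mem_freeHeads {A : Finset (Fin n)} {S : Finset d.Tail} {σ : d.Matching} {f : d.Head} :
    f ∈ d.freeHeads A S σ ↔ f.1 ∈ A ∧ ∀ e ∈ S, σ e ≠ f := by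
  simp only [freeHeads, Finset.mem_filter, Finset.mem_univ, true_and, Finset.mem_image, not_exists,
    not_and, ne_eq]

theorem card_freeHeads_le_succ {A : Finset (Fin n)} {S : Finset d.Tail} {σ₀ σ : d.Matching}
    (hσ : σ ∈ d.cyl S σ₀) (e : d.Tail) : (d.freeHeads A S σ₀).card ≤
      (d.freeHeads (insert (σ e).1 A) (insert e S) σ).card + 1 := by
  refine le_trans (Finset.card_le_card fun f hf => ?_) (Finset.card_insert_le (σ e) _)
  rw [mem_freeHeads] at hf
  rw [Finset.mem_insert, mem_freeHeads]
  by_cases h : f = σ e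
  · exact Or.inl h
  · refine Or.inr ⟨Finset.mem_insert_of_mem hf.1, fun e' he' => ?_⟩
    rcases Finset.mem_insert.1 he' with rfl | h'
    · exact fun h'' => h h''.symm
    · rw [mem_cyl.1 hσ e' h']; exact hf.2 e' h'

theorem freeHeads_subset {A : Finset (Fin n)} {S : Finset d.Tail} {σ₀ σ : d.Matching}
    (hσ : σ ∈ d.cyl S σ₀) {e : d.Tail} (he : (σ e).1 ∉ A) : d.freeHeads A S σ₀ ⊆
      d.freeHeads (insert (σ e).1 A) (insert e S) σ := by
  intro f hf
  rw [mem_freeHeads] at hf ⊢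
  refine ⟨Finset.mem_insert_of_mem hf.1, fun e' he' => ?_⟩
  rcases Finset.mem_insert.1 he' with rfl | h'
  · rintro rfl; exact he hf.1
  · rw [mem_cyl.1 hσ e' h']; exact hf.2 e' h'

/-- A new vertex of in-degree at least `2` brings a head besides the one that was just matched. -/
theorem succ_card_freeHeads_le {A : Finset (Fin n)} {S : Finset d.Tail} {σ₀ σ : d.Matching}
    (hσ : σ ∈ d.cyl S σ₀) (hS : ∀ e ∈ S, (σ₀ e).1 ∈ A) {e : d.Tail} (he : (σ e).1 ∉ A)
    (hd : 2 ≤ d.inDeg (σ e).1) : (d.freeHeads A S σ₀).card + 1 ≤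
      (d.freeHeads (insert (σ e).1 A) (insert e S) σ).card := by
  have : Nontrivial (Fin (d.inDeg (σ e).1)) := Fin.nontrivial_iff_two_le.2 hd
  obtain ⟨i, hi⟩ := exists_ne (σ e).2
  rw [← Finset.card_insert_of_notMem (a := (⟨(σ e).1, i⟩ : d.Head))
    (s := d.freeHeads A S σ₀) (fun h => he (mem_freeHeads.1 h).1)]
  refine Finset.card_le_card (Finset.insert_subset ?_ (freeHeads_subset hσ he))
  rw [mem_freeHeads]
  refine ⟨Finset.mem_insert_self _ _, fun e' he' => ?_⟩
  rcases Finset.mem_insert.1 he' with rfl | h'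
  · intro h
    apply hi
    exact (eq_of_heq (Sigma.ext_iff.1 h).2).symm
  · rw [mem_cyl.1 hσ e' h']
    intro h
    exact he (by simpa [h] using hS e' h')

open scoped Classical in
/-- The exploration from `x` collects free heads. -/
theorem cylExp_split_le {N' : ℕ} {Δ r γ : ℝ} (hN : N' < N) (hNm : N' < Fintype.card d.Tail)
    (hΔ : ∀ w, (d.inDeg w : ℝ) ≤ Δ) (hΔ0 : 0 ≤ Δ) (hr0 : 0 < r) (hr1 : r ≤ 1)
    (hr : ∀ k : ℕ, k ≤ Fintype.card d.Tail →
      (1 - (k : ℝ) / Fintype.card d.Tail) ^ N' ≤ r ^ k)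
    (hγ : r + ((N' + 1) * Δ * (r⁻¹ - r) + n * (1 - r)) / ((Fintype.card d.Tail : ℝ) - N') ≤ γ)
    (j : ℕ) :
    ∀ (S : Finset d.Tail) (σ₀ : d.Matching) (A : Finset (Fin n)), S.card + j = N' →
      (∀ σ ∈ d.cyl S σ₀, ∀ C, d.Absorbing σ C → x ∈ C → A ⊆ C) → x ∈ A → A.card ≤ S.card + 1 →
      (∀ e ∈ S, (σ₀ e).1 ∈ A) → (∀ e ∈ S, e.1 ∈ A) →
      d.cylExp S (fun σ => if d.Split N x x' σ then 1 else 0) σ₀ ≤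
        γ ^ j * r ^ (d.freeHeads A S σ₀).card := by
  have hrr : 0 ≤ r⁻¹ - r := by
    have := one_le_inv₀ hr0 |>.2 hr1
    linarith
  have hmN : (0 : ℝ) < (Fintype.card d.Tail : ℝ) - N' := by rw [sub_pos]; exact_mod_cast hNm
  have hγ0 : 0 ≤ γ := by
    refine le_trans ?_ hγ
    have : 0 ≤ 1 - r := by linarith
    positivity
  induction j with
  | zero =>
    intro S σ₀ A hcard hA hx hAc hSA hSA'
    rw [pow_zero, one_mul]
    -- The exploration from `x` is over. That from `x'` makes `N'` attempts, and `hr` turns the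
    -- chance that all miss the free heads into a power of `r`.
    refine (cylExp_split_le_of_free (A := A) (F := d.freeHeads A S σ₀)
      (fun f hf => (mem_freeHeads.1 hf).1) (by omega) N' S σ₀ {x'} ?_ hA ?_
      (Finset.mem_singleton_self x') ?_ (fun e he => Or.inl (hSA' e he))).trans (hr _ ?_)
    · exact fun e he hf => (mem_freeHeads.1 hf).2 e he rfl
    · exact fun σ _ C _ hx => Finset.singleton_subset_iff.2 hx
    · rw [Finset.card_singleton]; omega
    · rw [← card_head]; exact Finset.card_le_univ _
  | succ j ih =>
    intro S σ₀ A hcard hA hx hAc hSA hSA'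
    by_cases hex : ∃ σ ∈ d.cyl S σ₀, d.Split N x x' σ
    swap
    · rw [cylExp_split_eq_zero (by simpa using hex)]
      positivity
    obtain ⟨σ₂, hσ₂, hlarge, -⟩ := hex
    obtain ⟨e, heA, heS⟩ : ∃ e : d.Tail, e.1 ∈ A ∧ e ∉ S := by
      by_contra! hall
      have : d.Absorbing σ₂ A := by
        intro e he
        rw [mem_cyl.1 hσ₂ e (hall e he)]; exact hSA e (hall e he)
      have := hlarge A this ⟨x, hx⟩
      omega
    have hci : (insert e S).card = S.card + 1 := Finset.card_insert_of_notMem heS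
    set b : ℕ := (d.freeHeads A S σ₀).card with hb
    -- One step changes `r ^ b` by a factor of at most `r⁻¹` inside `A` (a free head is lost), `1`
    -- at a new vertex of in-degree one, and `r` at any other new vertex. Here `r + φ` dominates all
    -- three, and its mean is at most `γ`.
    set φ : d.Head → ℝ := fun f =>
      (if f.1 ∈ A then r⁻¹ - r else 0) + (if d.inDeg f.1 = 1 then 1 - r else 0) with hφ
    have hr1' : 0 ≤ 1 - r := by linarith
    have hφ0 : ∀ f, 0 ≤ φ f := fun f => by
      simp only [hφ]; split_ifs <;> linarith
    have hstep : ∀ σ₁ ∈ d.cyl S σ₀, d.cylExp (insert e S)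
        (fun σ => if d.Split N x x' σ then 1 else 0) σ₁ ≤ γ ^ j * r ^ b * (r + φ (σ₁ e)) := by
      intro σ₁ hσ₁
      have hsub := d.cyl_insert_subset S e hσ₁
      have hval : ∀ σ ∈ d.cyl (insert e S) σ₁, σ e = σ₁ e := fun σ hσ =>
        mem_cyl.1 hσ e (Finset.mem_insert_self _ _)
      refine (ih (insert e S) σ₁ (insert (σ₁ e).1 A) (by omega) ?_
        (Finset.mem_insert_of_mem hx) ?_ ?_ ?_).trans ?_
      · intro σ hσ C hC hxC
        have h := hA σ (hsub hσ) C hC hxC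
        refine Finset.insert_subset ?_ h
        rw [← hval σ hσ]; exact hC e (h heA)
      · have := Finset.card_insert_le (σ₁ e).1 A
        omega
      · intro e' he'
        rcases Finset.mem_insert.1 he' with rfl | h
        · exact Finset.mem_insert_self _ _
        · rw [mem_cyl.1 hσ₁ e' h]; exact Finset.mem_insert_of_mem (hSA e' h)
      · intro e' he'
        rcases Finset.mem_insert.1 he' with rfl | h
        · exact Finset.mem_insert_of_mem heA
        · exact Finset.mem_insert_of_mem (hSA' e' h)
      rw [mul_assoc]
      gcongr
      set b' : ℕ := (d.freeHeads (insert (σ₁ e).1 A) (insert e S) σ₁).card with hb'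
      have hrb : 0 ≤ r ^ b := by positivity
      by_cases hfA : (σ₁ e).1 ∈ A
      · have h1 : b ≤ b' + 1 := card_freeHeads_le_succ hσ₁ e
        have h2 : r ^ (b' + 1) ≤ r ^ b := pow_le_pow_of_le_one hr0.le hr1 h1
        have h3 : r ^ b' ≤ r ^ b * r⁻¹ := by
          rw [← div_eq_mul_inv, le_div_iff₀ hr0, ← pow_succ]; exact h2
        refine h3.trans (mul_le_mul_of_nonneg_left ?_ hrb)
        simp only [hφ, hfA, if_true]
        split_ifs <;> linarith
      · by_cases hd : d.inDeg (σ₁ e).1 = 1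
        · have h1 : b ≤ b' := Finset.card_le_card (freeHeads_subset hσ₁ hfA)
          refine (pow_le_pow_of_le_one hr0.le hr1 h1).trans ?_
          simp only [hφ, hfA, hd, if_true, if_false]
          exact le_of_eq (by ring)
        · have hd2 : 2 ≤ d.inDeg (σ₁ e).1 := by have := (σ₁ e).2.pos; omega
          have h1 : b + 1 ≤ b' := succ_card_freeHeads_le hσ₁ hSA hfA hd2
          refine (pow_le_pow_of_le_one hr0.le hr1 h1).trans ?_
          simp only [hφ, hfA, hd, if_false]
          exact le_of_eq (by ring)
    rw [cylExp_tower d S e]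
    calc _ ≤ d.cylExp S (fun σ₁ => γ ^ j * r ^ b * (r + φ (σ₁ e))) σ₀ := d.cylExp_mono hstep
      _ = γ ^ j * r ^ b * (r + d.cylExp S (fun σ₁ => φ (σ₁ e)) σ₀) := by
          rw [cylExp_const_mul, cylExp_add, cylExp_const]
      _ ≤ γ ^ j * r ^ b * γ := by
          gcongr
          refine le_trans (add_le_add_right ?_ _) hγ
          refine (d.cylExp_head_le heS σ₀ hφ0 Finset.univ (fun f hf => by simp at hf)).trans ?_
          have hsum : ∑ f, φ f ≤ (N' + 1) * Δ * (r⁻¹ - r) + n * (1 - r) := by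
            have h0 : ∑ f, φ f = ∑ w, (d.inDeg w : ℝ) * ((if w ∈ A then r⁻¹ - r else 0) +
                (if d.inDeg w = 1 then 1 - r else 0)) :=
              d.sum_heads (fun w => (if w ∈ A then r⁻¹ - r else 0) +
                (if d.inDeg w = 1 then 1 - r else 0))
            rw [h0]
            simp only [mul_add, Finset.sum_add_distrib, mul_ite, mul_zero]
            refine add_le_add ?_ ?_
            · rw [Finset.sum_ite_mem, Finset.univ_inter, ← Finset.sum_mul]
              refine mul_le_mul_of_nonneg_right ?_ hrr
              calc ∑ w ∈ A, (d.inDeg w : ℝ) ≤ ∑ _w ∈ A, Δ := Finset.sum_le_sum fun w _ => hΔ w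
                _ = A.card * Δ := by simp
                _ ≤ (N' + 1) * Δ := by gcongr; exact_mod_cast (by omega)
            -- Vertices of in-degree one own at most `n` heads in total.
            · calc _ ≤ ∑ _w : Fin n, (1 - r) := by
                    refine Finset.sum_le_sum fun w _ => ?_
                    split_ifs with h
                    · simp [h]
                    · exact hr1'
                _ = n * (1 - r) := by rw [Finset.sum_const, Finset.card_fin, nsmul_eq_mul]
          have h4 : (S.card : ℝ) ≤ N' := by exact_mod_cast (by omega : S.card ≤ N')
          have h5 : 0 ≤ (N' + 1) * Δ * (r⁻¹ - r) + n * (1 - r) := by positivity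
          gcongr
      _ = _ := by ring

end Split
end BiDegree
end DCM
-- Existence and uniqueness of stationary distributions
namespace DCM
section Stationary
variable {n : ℕ} {P : Matrix (Fin n) (Fin n) ℝ}

/-- For a stochastic matrix, the absolute value of an invariant vector is invariant. -/
theorem abs_vecMul_eq (hP : ∀ x y, 0 ≤ P x y) (hrow : ∀ x, ∑ y, P x y = 1) {w : Fin n → ℝ}
    (hw : w ᵥ* P = w) : (fun v => |w v|) ᵥ* P = fun v => |w v| := by
  have hle : ∀ v, |w v| ≤ ((fun v => |w v|) ᵥ* P) v := by
    intro v
    conv_lhs => rw [← hw]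
    simp only [Matrix.vecMul, dotProduct]
    refine (Finset.abs_sum_le_sum_abs _ _).trans_eq (Finset.sum_congr rfl fun x _ => ?_)
    rw [abs_mul, abs_of_nonneg (hP x v)]
  have hsum : ∑ v, ((fun v => |w v|) ᵥ* P) v = ∑ v, |w v| := by
    simp only [Matrix.vecMul, dotProduct]
    rw [Finset.sum_comm]
    simp only [← Finset.mul_sum, hrow, mul_one]
  have := (Finset.sum_eq_sum_iff_of_le (fun v _ => hle v)).1 hsum.symm
  ext v; exact (this v (Finset.mem_univ v)).symm

theorem normalize_isStationary {w : Fin n → ℝ} (hw0 : ∀ v, 0 ≤ w v) (hw : w ᵥ* P = w)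
    {v₀ : Fin n} (hv : 0 < w v₀) : IsStationary P (fun v => (∑ u, w u)⁻¹ * w v) := by
  have hs : 0 < ∑ u, w u := Finset.sum_pos' (fun v _ => hw0 v) ⟨v₀, Finset.mem_univ _, hv⟩
  refine ⟨⟨fun v => mul_nonneg (inv_nonneg.2 hs.le) (hw0 v), ?_⟩, ?_⟩
  · rw [← Finset.mul_sum, inv_mul_cancel₀ hs.ne']
  · have : (fun v => (∑ u, w u)⁻¹ * w v) = (∑ u, w u)⁻¹ • w := by ext; simp
    rw [this, Matrix.smul_vecMul, hw]

/-- The constant vector shows that `P - 1` is singular, so there is also a nonzero left null vector;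
its absolute value is invariant and can be normalized. -/
theorem exists_isStationary (hn : 0 < n) (hP : ∀ x y, 0 ≤ P x y)
    (hrow : ∀ x, ∑ y, P x y = 1) : ∃ π, IsStationary P π := by
  have hdet : (P - 1).det = 0 := by
    rw [← Matrix.exists_mulVec_eq_zero_iff]
    refine ⟨fun _ => 1, fun h => by simpa using congrFun h ⟨0, hn⟩, ?_⟩
    ext x
    rw [Matrix.sub_mulVec, Matrix.one_mulVec]
    simp [Matrix.mulVec, dotProduct, hrow x]
  obtain ⟨w, hw0, hw⟩ := Matrix.exists_vecMul_eq_zero_iff.2 hdet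
  rw [Matrix.vecMul_sub, Matrix.vecMul_one, sub_eq_zero] at hw
  obtain ⟨v, hv⟩ := Function.ne_iff.1 hw0
  exact ⟨_, normalize_isStationary (fun v => abs_nonneg (w v)) (abs_vecMul_eq hP hrow hw)
    (abs_pos.2 hv)⟩

/-- Two different stationary distributions yield two with disjoint supports. -/
theorem exists_disjoint_isStationary (hP : ∀ x y, 0 ≤ P x y) (hrow : ∀ x, ∑ y, P x y = 1)
    {π π' : Fin n → ℝ} (h : IsStationary P π) (h' : IsStationary P π') (hne : π' ≠ π) :
    ∃ μ ν, IsStationary P μ ∧ IsStationary P ν ∧ ∀ v, μ v = 0 ∨ ν v = 0 := by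
  -- The positive and negative parts of the difference are invariant, and both are nonzero because
  -- the difference sums to zero. Up to a factor `2` they are `|w| + w` and `|w| - w`.
  set w : Fin n → ℝ := π' - π with hw
  have hwP : w ᵥ* P = w := by rw [hw, Matrix.sub_vecMul, h.2, h'.2]
  have habs := abs_vecMul_eq hP hrow hwP
  have hsum : ∑ v, w v = 0 := by
    simp only [hw, Pi.sub_apply, Finset.sum_sub_distrib, h.1.2, h'.1.2, sub_self]
  obtain ⟨v₀, hv₀⟩ := Function.ne_iff.1 (sub_ne_zero.2 hne)
  obtain ⟨v₁, -, hv₁⟩ : ∃ v ∈ Finset.univ, 0 < w v :=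
    Finset.exists_pos_of_sum_zero_of_exists_nonzero w hsum ⟨v₀, Finset.mem_univ _, hv₀⟩
  obtain ⟨v₂, -, hv₂⟩ : ∃ v ∈ Finset.univ, 0 < (-w) v :=
    Finset.exists_pos_of_sum_zero_of_exists_nonzero (-w) (by simp [hsum])
      ⟨v₀, Finset.mem_univ _, neg_ne_zero.2 hv₀⟩
  have key : ∀ u : Fin n → ℝ, u ᵥ* P = u → (fun v => |u v|) ᵥ* P = (fun v => |u v|) →
      (∃ v, 0 < u v) → IsStationary P (fun v => (∑ x, (|u x| + u x))⁻¹ * (|u v| + u v)) := by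
    rintro u hu hua ⟨v, hv⟩
    refine normalize_isStationary (w := fun v => |u v| + u v) (v₀ := v)
      (fun v => by linarith [neg_abs_le (u v)]) ?_ (by have := abs_nonneg (u v); linarith)
    have : (fun v => |u v| + u v) = (fun v => |u v|) + u := rfl
    rw [this, Matrix.add_vecMul, hu, hua]
  refine ⟨_, _, key w hwP habs ⟨v₁, hv₁⟩, key (-w) (by rw [Matrix.neg_vecMul, hwP])
    (by simpa using habs) ⟨v₂, hv₂⟩, fun v => ?_⟩
  rcases le_total 0 (w v) with hv | hv
  · right; simp [abs_of_nonneg hv]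
  · left; simp [abs_of_nonpos hv]

theorem isStationary_pos_of_pos (hP : ∀ x y, 0 ≤ P x y) {π : Fin n → ℝ} (h : IsStationary P π)
    {x y : Fin n} (hx : 0 < π x) (hxy : 0 < P x y) : 0 < π y := by
  conv_rhs => rw [← h.2]
  exact Finset.sum_pos' (fun z _ => mul_nonneg (h.1.1 z) (hP z y))
    ⟨x, Finset.mem_univ _, mul_pos hx hxy⟩

theorem isStationary_exists_pos {π : Fin n → ℝ} (h : IsStationary P π) : ∃ x, 0 < π x := by
  by_contra! hall
  have := Finset.sum_nonpos fun x (_ : x ∈ Finset.univ) => hall x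
  rw [h.1.2] at this; linarith

end Stationary

namespace BiDegree
variable {n : ℕ} {d : BiDegree n}

theorem walk_row_sum (hout : ∀ v, 2 ≤ d.outDeg v) (σ : d.Matching) (y : Fin n) :
    ∑ x, d.walk σ y x = 1 := by
  have h := d.walkOn_mulVec Finset.univ σ y (fun _ => 1)
  simp only [walkOn_univ, mul_one, Finset.mem_univ, if_true, Finset.sum_const, Finset.card_univ,
    Fintype.card_fin, nsmul_eq_mul] at h
  rw [h, inv_mul_cancel₀]
  have := hout y
  exact_mod_cast (by omega)

theorem walk_nonneg (σ : d.Matching) (y x : Fin n) : 0 ≤ d.walk σ y x := by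
  rw [← walkOn_univ]; exact d.walkOn_nonneg _ σ y x

theorem walk_pos (σ : d.Matching) (e : d.Tail) : 0 < d.walk σ e.1 (σ e).1 := by
  unfold walk
  have h1 : 0 < d.mult σ e.1 (σ e).1 :=
    Nat.card_pos_iff.2 ⟨⟨⟨e.2, rfl⟩⟩, inferInstance⟩
  have h2 : 0 < d.outDeg e.1 := e.2.pos
  positivity

theorem surfer_nonneg {α : ℝ} (h0 : 0 ≤ α) (h1 : α ≤ 1) {lam : Fin n → ℝ}
    (hlam : lam ∈ stdSimplex ℝ (Fin n)) (σ : d.Matching) (x y : Fin n) :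
    0 ≤ d.surfer σ α lam x y :=
  add_nonneg (mul_nonneg (by linarith) (walk_nonneg σ x y)) (mul_nonneg h0 (hlam.1 y))

theorem surfer_row_sum (hout : ∀ v, 2 ≤ d.outDeg v) {α : ℝ} {lam : Fin n → ℝ}
    (hlam : lam ∈ stdSimplex ℝ (Fin n)) (σ : d.Matching) (x : Fin n) :
    ∑ y, d.surfer σ α lam x y = 1 := by
  simp only [surfer, Finset.sum_add_distrib, ← Finset.mul_sum, walk_row_sum hout, hlam.2]
  ring

open scoped Classical in
theorem support_absorbing {σ : d.Matching} {π : Fin n → ℝ}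
    (h : IsStationary (d.walk σ) π) :
    d.Absorbing σ (Finset.univ.filter fun v => 0 < π v) := by
  intro e he
  simp only [Finset.mem_filter, Finset.mem_univ, true_and] at he ⊢
  exact isStationary_pos_of_pos (walk_nonneg σ) h he (walk_pos σ e)

theorem exists_isStationary_surfer (hn : 0 < n) (hout : ∀ v, 2 ≤ d.outDeg v) {α : ℝ}
    (h0 : 0 ≤ α) (h1 : α ≤ 1) {lam : Fin n → ℝ} (hlam : lam ∈ stdSimplex ℝ (Fin n))
    (σ : d.Matching) : ∃ π, IsStationary (d.surfer σ α lam) π :=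
  exists_isStationary hn (surfer_nonneg h0 h1 hlam σ) (surfer_row_sum hout hlam σ)

/-- With teleportation, the stationary distribution is unique. -/
theorem isTheStationary_surfer_of_pos (hout : ∀ v, 2 ≤ d.outDeg v) {α : ℝ}
    (h0 : 0 < α) (h1 : α ≤ 1) {lam : Fin n → ℝ} (hlam : lam ∈ stdSimplex ℝ (Fin n))
    (hpos : ∀ v, 0 < lam v) (σ : d.Matching) {π : Fin n → ℝ}
    (hπ : IsStationary (d.surfer σ α lam) π) : IsTheStationary (d.surfer σ α lam) π := by
  refine ⟨hπ, fun π' hπ' => ?_⟩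
  by_contra hne
  have hP := surfer_nonneg h0.le h1 hlam σ
  obtain ⟨μ, ν, hμ, hν, hdis⟩ :=
    exists_disjoint_isStationary hP (surfer_row_sum hout hlam σ) hπ hπ' hne
  obtain ⟨x, hx⟩ := isStationary_exists_pos hμ
  obtain ⟨y, hy⟩ := isStationary_exists_pos hν
  have hxy : 0 < d.surfer σ α lam x y :=
    add_pos_of_nonneg_of_pos (mul_nonneg (by linarith) (walk_nonneg σ x y)) (mul_pos h0 (hpos y))
  have hμy := isStationary_pos_of_pos hP hμ hx hxy
  rcases hdis y with h | h <;> linarith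

open scoped Classical in
/-- Without teleportation, it is unique when all stationary distributions have large supports and
there are no two disjoint large absorbing sets. -/
theorem isTheStationary_walk (hout : ∀ v, 2 ≤ d.outDeg v) {N : ℕ} {σ : d.Matching}
    (hlarge : ∀ C, d.Absorbing σ C → C.Nonempty → N ≤ C.card)
    (hsplit : ∀ x x', ¬ d.Split N x x' σ) {π : Fin n → ℝ}
    (hπ : IsStationary (d.walk σ) π) : IsTheStationary (d.walk σ) π := by
  refine ⟨hπ, fun π' hπ' => ?_⟩
  by_contra hne
  obtain ⟨μ, ν, hμ, hν, hdis⟩ :=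
    exists_disjoint_isStationary (walk_nonneg σ) (walk_row_sum hout σ) hπ hπ' hne
  obtain ⟨x, hx⟩ := isStationary_exists_pos hμ
  obtain ⟨y, hy⟩ := isStationary_exists_pos hν
  refine hsplit x y ⟨hlarge, _, _, support_absorbing hμ, support_absorbing hν, ?_,
    by simpa using hx, by simpa using hy⟩
  rw [Finset.disjoint_left]
  intro v h1 h2
  simp only [Finset.mem_filter, Finset.mem_univ, true_and] at h1 h2
  rcases hdis v with h | h <;> linarith

end BiDegree
end DCM
-- The influence and deterministic bounds on the score
namespace DCM
namespace BiDegree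
variable {n : ℕ} {d : BiDegree n}

theorem walk_pow_row_sum (hout : ∀ v, 2 ≤ d.outDeg v) (σ : d.Matching) (t : ℕ) (y : Fin n) :
    ∑ x, (d.walk σ ^ t) y x = 1 := by
  induction t generalizing y with
  | zero => simp [Matrix.one_apply]
  | succ t ih =>
    simp only [pow_succ', Matrix.mul_apply]
    rw [Finset.sum_comm]
    simp only [← Finset.mul_sum, ih, mul_one, walk_row_sum hout]

theorem Absorbing.walk_pow_eq_zero {σ : d.Matching} {C : Finset (Fin n)} (hC : d.Absorbing σ C)
    (t : ℕ) {x v : Fin n} (hx : x ∈ C) (hv : v ∉ C) : (d.walk σ ^ t) x v = 0 := by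
  induction t generalizing x with
  | zero => exact Matrix.one_apply_ne (by rintro rfl; exact hv hx)
  | succ t ih =>
    rw [walk_pow_succ, Finset.sum_eq_zero, mul_zero]
    exact fun i _ => ih (hC ⟨x, i⟩ hx)

/-- The walk started in an absorbing set keeps its whole mass there. -/
theorem Absorbing.one_le_card_mul {σ : d.Matching} {C : Finset (Fin n)} (hC : d.Absorbing σ C)
    (hout : ∀ v, 2 ≤ d.outDeg v) {t : ℕ} {b : ℝ} {x : Fin n} (hx : x ∈ C)
    (hb : ∀ v, (d.walk σ ^ t) x v ≤ b) : 1 ≤ C.card * b := by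
  rw [← walk_pow_row_sum hout σ t x, ← nsmul_eq_mul, ← Finset.sum_const]
  rw [← Finset.sum_subset (Finset.subset_univ C) fun v _ hv => hC.walk_pow_eq_zero t hx hv]
  exact Finset.sum_le_sum fun v _ => hb v

/-- The largest contribution of a single vertex to the score of `v` within `T` steps. -/
noncomputable def influence (d : BiDegree n) (T : ℕ) (σ : d.Matching) (v : Fin n) : ℝ :=
  max 1 (⨆ p : Fin (T + 1) × Fin n, (d.inDeg p.2 : ℝ) * (d.walk σ ^ (p.1 : ℕ)) p.2 v)

/-- The floor `1` keeps the weight `(d.influence T σ v)⁻¹` at most `1`, so that bounds on revealed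
walks survive the multiplication by it. -/
theorem one_le_influence (T : ℕ) (σ : d.Matching) (v : Fin n) : 1 ≤ d.influence T σ v :=
  le_max_left _ _

theorem influence_pos (T : ℕ) (σ : d.Matching) (v : Fin n) : 0 < d.influence T σ v :=
  zero_lt_one.trans_le (one_le_influence T σ v)

theorem le_influence {T t : ℕ} (ht : t ≤ T) (σ : d.Matching) (w v : Fin n) :
    (d.inDeg w : ℝ) * (d.walk σ ^ t) w v ≤ d.influence T σ v :=
  (le_ciSup (f := fun p : Fin (T + 1) × Fin n =>
    (d.inDeg p.2 : ℝ) * (d.walk σ ^ (p.1 : ℕ)) p.2 v) (Set.finite_range _).bddAbove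
    (⟨t, by omega⟩, w)).trans (le_max_right _ _)

theorem exists_lt_of_lt_influence {T : ℕ} {σ : d.Matching} {v : Fin n} {D : ℝ} (hD : 1 ≤ D)
    (h : D < d.influence T σ v) :
    ∃ p : Fin (T + 1) × Fin n, D < (d.inDeg p.2 : ℝ) * (d.walk σ ^ (p.1 : ℕ)) p.2 v := by
  have : Nonempty (Fin (T + 1) × Fin n) := ⟨(0, v)⟩
  rcases lt_max_iff.1 h with h | h
  · linarith
  · exact exists_lt_of_lt_ciSup h

theorem influence_le {T : ℕ} {σ : d.Matching} {v : Fin n} {Δ : ℝ} (hΔ1 : 1 ≤ Δ)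
    (hΔ : ∀ w, (d.inDeg w : ℝ) ≤ Δ) : d.influence T σ v ≤ Δ := by
  have : Nonempty (Fin (T + 1) × Fin n) := ⟨(0, v)⟩
  refine max_le hΔ1 (ciSup_le fun p => ?_)
  exact (mul_le_of_le_one_right (Nat.cast_nonneg _) (d.walk_pow_le_one σ _ _ _)).trans (hΔ _)

open scoped Classical in
/-- The upper tail of the influence is controlled by the in-degrees, for every matching. -/
theorem card_lt_influence_le (T : ℕ) (σ : d.Matching) {D κ : ℝ} (hD : 1 ≤ D) (hκ : 1 ≤ κ) :
    ((Finset.univ.filter fun v => D < d.influence T σ v).card : ℝ) * D ^ κ ≤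
      (T + 1) * ∑ w, (d.inDeg w : ℝ) ^ κ := by
  have hD0 : 0 < D := by linarith
  have h1 : (Finset.univ.filter fun v => D < d.influence T σ v) ⊆
      (Finset.univ : Finset (Fin (T + 1) × Fin n)).biUnion fun p => Finset.univ.filter fun v =>
        D < (d.inDeg p.2 : ℝ) * (d.walk σ ^ (p.1 : ℕ)) p.2 v := by
    intro v hv
    simp only [Finset.mem_filter, Finset.mem_univ, true_and, Finset.mem_biUnion] at hv ⊢
    exact exists_lt_of_lt_influence hD hv
  have h2 : ∀ p : Fin (T + 1) × Fin n, ((Finset.univ.filter fun v =>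
      D < (d.inDeg p.2 : ℝ) * (d.walk σ ^ (p.1 : ℕ)) p.2 v).card : ℝ) * D ^ κ ≤
        (d.inDeg p.2 : ℝ) ^ κ := by
    intro p
    set s := Finset.univ.filter fun v =>
      D < (d.inDeg p.2 : ℝ) * (d.walk σ ^ (p.1 : ℕ)) p.2 v with hs
    have h3 : (s.card : ℝ) * D ≤ d.inDeg p.2 := by
      rw [← nsmul_eq_mul, ← Finset.sum_const]
      calc ∑ _v ∈ s, D ≤ ∑ v ∈ s, (d.inDeg p.2 : ℝ) * (d.walk σ ^ (p.1 : ℕ)) p.2 v :=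
            Finset.sum_le_sum fun v hv => (Finset.mem_filter.1 hv).2.le
        _ = (d.inDeg p.2 : ℝ) * ∑ v ∈ s, (d.walk σ ^ (p.1 : ℕ)) p.2 v := by rw [Finset.mul_sum]
        _ ≤ (d.inDeg p.2 : ℝ) * 1 := by
            gcongr
            exact (Finset.sum_le_univ_sum_of_nonneg fun v => d.walk_pow_nonneg σ _ _ v).trans
              (d.walk_row_sum_le σ _ _)
        _ = _ := mul_one _
    -- A nonempty set forces the ratio of the in-degree to `D` to be at least `1`, and then it is
    -- below its `κ`-th power.
    rcases Nat.eq_zero_or_pos s.card with h0 | h0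
    · rw [h0]; simp; positivity
    · have h4 : (s.card : ℝ) ≤ d.inDeg p.2 / D := by rwa [le_div_iff₀ hD0]
      have h5 : (1 : ℝ) ≤ d.inDeg p.2 / D := le_trans (by exact_mod_cast h0) h4
      have h6 : (d.inDeg p.2 : ℝ) / D ≤ ((d.inDeg p.2 : ℝ) / D) ^ κ :=
        Real.self_le_rpow_of_one_le h5 hκ
      rw [Real.div_rpow (Nat.cast_nonneg _) hD0.le] at h6
      rw [← le_div_iff₀ (by positivity)]
      exact h4.trans h6
  calc _ ≤ (∑ p : Fin (T + 1) × Fin n, ((Finset.univ.filter fun v =>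
        D < (d.inDeg p.2 : ℝ) * (d.walk σ ^ (p.1 : ℕ)) p.2 v).card : ℝ)) * D ^ κ := by
        gcongr
        exact_mod_cast (Finset.card_le_card h1).trans Finset.card_biUnion_le
    _ ≤ ∑ p : Fin (T + 1) × Fin n, (d.inDeg p.2 : ℝ) ^ κ := by
        rw [Finset.sum_mul]; exact Finset.sum_le_sum fun p _ => h2 p
    _ = _ := by
        rw [Fintype.sum_prod_type]; simp

theorem isStationary_surfer_apply {α : ℝ} {lam π : Fin n → ℝ} {σ : d.Matching}
    (hπ : IsStationary (d.surfer σ α lam) π) :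
    π = (1 - α) • (π ᵥ* d.walk σ) + α • lam := by
  conv_lhs => rw [← hπ.2]
  ext v
  simp only [Matrix.vecMul, dotProduct, surfer, Pi.add_apply, Pi.smul_apply, smul_eq_mul, mul_add,
    Finset.sum_add_distrib]
  congr 1
  · rw [Finset.mul_sum]; exact Finset.sum_congr rfl fun x _ => by ring
  · rw [← Finset.sum_mul, hπ.1.2, one_mul]

/-- A stationary distribution is a mixture of walks started at `lam` and of long walks. -/
theorem isStationary_surfer_le {α : ℝ} (h0 : 0 ≤ α) (h1 : α ≤ 1) {lam π : Fin n → ℝ}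
    {σ : d.Matching} (hπ : IsStationary (d.surfer σ α lam) π) {T : ℕ} {B : ℝ} {v : Fin n}
    (hshort : ∀ k < T, ∑ x, lam x * (d.walk σ ^ k) x v ≤ B)
    (hlong : ∀ x, (d.walk σ ^ T) x v ≤ B) : π v ≤ B := by
  have h1α : 0 ≤ 1 - α := by linarith
  -- The stationarity equation unrolled `j` times: the walks from `lam` carry total weight `1 - (1 -
  -- α) ^ j`, so a common bound `B` passes to `π` uniformly in `α`.
  have key : ∀ j ≤ T, π v ≤ (1 - (1 - α) ^ j) * B + (1 - α) ^ j * (π ᵥ* d.walk σ ^ j) v := by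
    intro j
    induction j with
    | zero => intro _; simp
    | succ j ih =>
      intro hj
      refine (ih (by omega)).trans ?_
      have h2 : (π ᵥ* d.walk σ ^ j) v =
          (1 - α) * (π ᵥ* d.walk σ ^ (j + 1)) v + α * (lam ᵥ* d.walk σ ^ j) v := by
        conv_lhs => rw [isStationary_surfer_apply hπ, Matrix.add_vecMul, Matrix.smul_vecMul,
          Matrix.smul_vecMul, Matrix.vecMul_vecMul, ← pow_succ']
        rfl
      have h3 : (lam ᵥ* d.walk σ ^ j) v ≤ B := hshort j (by omega)
      rw [h2]
      have h4 : (1 - α) ^ j * (α * (lam ᵥ* d.walk σ ^ j) v) ≤ (1 - α) ^ j * (α * B) := by gcongr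
      calc _ = (1 - (1 - α) ^ j) * B + (1 - α) ^ (j + 1) * (π ᵥ* d.walk σ ^ (j + 1)) v +
            (1 - α) ^ j * (α * (lam ᵥ* d.walk σ ^ j) v) := by ring
        _ ≤ (1 - (1 - α) ^ j) * B + (1 - α) ^ (j + 1) * (π ᵥ* d.walk σ ^ (j + 1)) v +
            (1 - α) ^ j * (α * B) := by gcongr
        _ = _ := by ring
  have h5 : (π ᵥ* d.walk σ ^ T) v ≤ B := by
    calc (π ᵥ* d.walk σ ^ T) v = ∑ x, π x * (d.walk σ ^ T) x v := rfl
      _ ≤ ∑ x, π x * B := Finset.sum_le_sum fun x _ =>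
          mul_le_mul_of_nonneg_left (hlong x) (hπ.1.1 x)
      _ = B := by rw [← Finset.sum_mul, hπ.1.2, one_mul]
  calc π v ≤ _ := key T le_rfl
    _ ≤ (1 - (1 - α) ^ T) * B + (1 - α) ^ T * B := by gcongr
    _ = B := by ring

/-- A stationary distribution is at least proportional to the in-degree. -/
theorem le_isStationary_surfer {α : ℝ} (h0 : 0 ≤ α) (h1 : α ≤ 1) {lam π : Fin n → ℝ}
    {σ : d.Matching} (hπ : IsStationary (d.surfer σ α lam) π) {K : ℕ}
    (hK : ∀ v, d.outDeg v ≤ K) {l : ℝ} (hl0 : 0 ≤ l) (hl : ∀ v, l ≤ lam v) (v : Fin n) :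
    (1 - α) * α * l * (d.inDeg v / K) ≤ π v := by
  have h1α : 0 ≤ 1 - α := by linarith
  -- Teleportation alone gives this mass. One more step sends at least a fraction `1 / K` of it
  -- along each edge into `v`.
  have h2 : ∀ x, α * l ≤ π x := fun x => by
    rw [isStationary_surfer_apply hπ]
    have : 0 ≤ (π ᵥ* d.walk σ) x :=
      Finset.sum_nonneg (s := Finset.univ) fun y _ => mul_nonneg (hπ.1.1 y) (walk_nonneg σ y x)
    have h3 : α * l ≤ α * lam x := by gcongr; exact hl x
    simp only [Pi.add_apply, Pi.smul_apply, smul_eq_mul]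
    have := mul_nonneg h1α this
    linarith
  have hdeg : (d.inDeg v : ℝ) / K ≤ ∑ y, d.walk σ y v := by
    have hm : (d.inDeg v : ℝ) = ∑ y, (d.mult σ y v : ℝ) := by
      rw [← Nat.cast_sum]
      congr 1
      simp only [mult, ← Nat.card_sigma]
      have e1 : (Σ y : Fin n, {i : Fin (d.outDeg y) // (σ ⟨y, i⟩).1 = v}) ≃
          {e : d.Tail // (σ e).1 = v} :=
        { toFun := fun p => ⟨⟨p.1, p.2.1⟩, p.2.2⟩
          invFun := fun e => ⟨e.1.1, ⟨e.1.2, e.2⟩⟩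
          left_inv := fun _ => rfl
          right_inv := fun _ => rfl }
      have e2 : {e : d.Tail // (σ e).1 = v} ≃ {f : d.Head // f.1 = v} :=
        σ.subtypeEquiv fun _ => Iff.rfl
      have e3 : {f : d.Head // f.1 = v} ≃ Fin (d.inDeg v) := Equiv.sigmaSubtype v
      rw [Nat.card_congr ((e1.trans e2).trans e3), Nat.card_fin]
    rw [hm, Finset.sum_div]
    refine Finset.sum_le_sum fun y _ => ?_
    unfold walk
    rcases Nat.eq_zero_or_pos (d.outDeg y) with h | h
    · have : d.mult σ y v = 0 := by
        unfold mult
        rw [Nat.card_eq_zero]; left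
        exact ⟨fun i => by have := i.1.pos; omega⟩
      simp [this]
    · have h' : (0 : ℝ) < d.outDeg y := by exact_mod_cast h
      gcongr
      exact hK y
  calc (1 - α) * α * l * (d.inDeg v / K) ≤ (1 - α) * α * l * ∑ y, d.walk σ y v := by gcongr
    _ = (1 - α) * ∑ y, α * l * d.walk σ y v := by rw [← Finset.mul_sum]; ring
    _ ≤ (1 - α) * ∑ y, π y * d.walk σ y v := by
        gcongr with y
        · exact walk_nonneg σ y v
        · exact h2 y
    _ ≤ π v := by
        conv_rhs => rw [isStationary_surfer_apply hπ]
        have : 0 ≤ α * lam v := mul_nonneg h0 (hl0.trans (hl v))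
        simp only [Pi.add_apply, Pi.smul_apply, smul_eq_mul, Matrix.vecMul, dotProduct]
        linarith

end BiDegree

theorem tail_le_one {n : ℕ} (x : Fin n → ℝ) (t : ℝ) : tail x t ≤ 1 := by
  unfold tail
  rw [Nat.card_eq_fintype_card]
  refine div_le_one_of_le₀ ?_ (Nat.cast_nonneg _)
  exact_mod_cast (Fintype.card_subtype_le _).trans (by simp)

theorem tail_mono {n : ℕ} {x y : Fin n → ℝ} {s t : ℝ} (h : ∀ v, s < x v → t < y v) :
    tail x s ≤ tail y t := by
  unfold tail
  gcongr
  exact Nat.card_le_card_of_injective (fun v => (⟨v.1, h v.1 v.2⟩ : {v // t < y v}))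
    fun a b hab => Subtype.ext (Subtype.mk.inj hab)

theorem tail_eq_zero_iff {n : ℕ} {x : Fin n → ℝ} {t : ℝ} (hn : 0 < n) :
    tail x t = 0 ↔ ∀ v, x v ≤ t := by
  unfold tail
  have : (n : ℝ) ≠ 0 := by positivity
  rw [div_eq_zero_iff]
  simp only [this, or_false, Nat.cast_eq_zero, Nat.card_eq_zero,
    isEmpty_subtype, not_lt]
  constructor
  · rintro (h | h)
    · exact h
    · exact absurd (inferInstance : Finite _) (not_finite_iff_infinite.2 h)
  · exact Or.inl

/-- If `a * κ ≤ ε`, the claimed bound is at least `1`. Otherwise the threshold is lowered by `n ^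
ε₁` and the tail of the influence applies. The exponent loses `ε₁ * κ` from the threshold and `ε₁`
from each of `T + 1` and the moment. -/
theorem upperBounds_of_le_influence {n : ℕ} {d : BiDegree n} {σ : d.Matching} {κ ε ε₁ : ℝ}
    (hn : 1 ≤ n) (hκ : 2 < κ) (hε₁ : 0 < ε₁) (hε : ε₁ * (κ + 2) ≤ ε) {T : ℕ}
    (hT : (T : ℝ) + 1 ≤ (n : ℝ) ^ ε₁) (hΔ : ∀ w, (d.inDeg w : ℝ) ≤ (n : ℝ) ^ (1 / κ + ε₁))
    (hmom : ∑ w, (d.inDeg w : ℝ) ^ κ ≤ (n : ℝ) ^ (1 + ε₁)) {x : Fin n → ℝ}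
    (hx : ∀ v, x v ≤ (n : ℝ) ^ ε₁ * d.influence T σ v) : UpperBounds κ ε x := by
  classical
  have hn1 : (1 : ℝ) ≤ n := by exact_mod_cast hn
  have hn0 : (0 : ℝ) < n := by linarith
  refine ⟨(tail_eq_zero_iff hn).2 fun v => ?_, fun a ha0 ha => ?_⟩
  · have h1 : d.influence T σ v ≤ (n : ℝ) ^ (1 / κ + ε₁) :=
      BiDegree.influence_le (Real.one_le_rpow hn1 (by positivity)) hΔ
    calc x v ≤ (n : ℝ) ^ ε₁ * d.influence T σ v := hx v
      _ ≤ (n : ℝ) ^ ε₁ * (n : ℝ) ^ (1 / κ + ε₁) := by gcongr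
      _ = (n : ℝ) ^ (ε₁ + (1 / κ + ε₁)) := (Real.rpow_add hn0 _ _).symm
      _ ≤ _ := Real.rpow_le_rpow_of_exponent_le hn1 (by nlinarith)
  · by_cases hc : a * κ ≤ ε
    · exact (tail_le_one _ _).trans (Real.one_le_rpow hn1 (by linarith))
    · push Not at hc
      have haε : ε₁ ≤ a := by
        by_contra! h
        nlinarith
      set D : ℝ := (n : ℝ) ^ (a - ε₁) with hD
      have hD1 : 1 ≤ D := Real.one_le_rpow hn1 (by linarith)
      have h1 := BiDegree.card_lt_influence_le T σ (κ := κ) hD1 (by linarith)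
      have h2 : tail x ((n : ℝ) ^ a) ≤ tail (fun v => d.influence T σ v) D := by
        refine tail_mono fun v hv => ?_
        have h3 := hv.trans_le (hx v)
        rw [hD, Real.rpow_sub hn0, div_lt_iff₀ (by positivity)]
        linarith
      have h4 : tail (fun v => d.influence T σ v) D * n =
          ((Finset.univ.filter fun v => D < d.influence T σ v).card : ℝ) := by
        unfold tail
        rw [div_mul_cancel₀ _ hn0.ne', Nat.card_eq_fintype_card, Fintype.card_subtype]
      have h5 : D ^ κ = (n : ℝ) ^ ((a - ε₁) * κ) := by rw [hD, ← Real.rpow_mul hn0.le]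
      refine h2.trans ?_
      have h6 : tail (fun v => d.influence T σ v) D * (n * (n : ℝ) ^ ((a - ε₁) * κ)) ≤
          (n : ℝ) ^ ε₁ * (n : ℝ) ^ (1 + ε₁) := by
        rw [← mul_assoc, h4, ← h5]
        refine h1.trans ?_
        gcongr
      have h7 : (n : ℝ) * (n : ℝ) ^ ((a - ε₁) * κ) = (n : ℝ) ^ (1 + (a - ε₁) * κ) := by
        rw [Real.rpow_add hn0, Real.rpow_one]
      rw [h7, ← le_div_iff₀ (by positivity), ← Real.rpow_add hn0, ← Real.rpow_sub hn0] at h6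
      refine h6.trans (Real.rpow_le_rpow_of_exponent_le hn1 (by nlinarith))

end DCM
-- From moments to probabilities
namespace DCM
namespace BiDegree
variable {n : ℕ} {d : BiDegree n}

theorem law_real_le_cylExp {p : d.Matching → Prop} {g : d.Matching → ℝ} (hg : ∀ σ, 0 ≤ g σ)
    (h : ∀ σ, p σ → 1 ≤ g σ) (σ₀ : d.Matching) : d.law.real {σ | p σ} ≤ d.cylExp ∅ g σ₀ := by
  classical
  rw [law_real_eq_cylExp d p σ₀]
  refine d.cylExp_mono fun σ _ => ?_
  split_ifs with hσ
  · exact h σ hσ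
  · exact hg σ

theorem law_real_exists_le {ι : Type*} [Fintype ι] (p : ι → d.Matching → Prop) {b : ℝ}
    (h : ∀ i, d.law.real {σ | p i σ} ≤ b) :
    d.law.real {σ | ∃ i, p i σ} ≤ Fintype.card ι * b := by
  have : {σ | ∃ i, p i σ} = ⋃ i, {σ | p i σ} := by ext; simp
  rw [this]
  refine (measureReal_iUnion_fintype_le _).trans ((Finset.sum_le_sum fun i _ => h i).trans ?_)
  simp

/-- The walk is spread out after `R` steps, from all starting points. -/
theorem law_real_not_spread_le (hout : ∀ v, 2 ≤ d.outDeg v) {Δ ρ : ℝ}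
    (hΔ : ∀ w, (d.inDeg w : ℝ) ≤ Δ) (hΔ0 : 0 ≤ Δ) (hρ0 : 0 ≤ ρ) {R : ℕ}
    (hL : 4 * R < Fintype.card d.Tail)
    (hρ : (2 * ((4 * R : ℕ) : ℝ) + 2) * Δ ≤ ρ * ((Fintype.card d.Tail : ℝ) - (4 * R : ℕ)))
    {x η : ℝ} (hx : ((4 * R : ℕ) : ℝ) * ρ ≤ x) (hβx : ((R : ℝ) + 1) * (1 / 2) ^ R ≤ x)
    (hx1 : x ≤ 1) (hη : 0 < η) :
    d.law.real {σ | ∃ y z, η < (d.walk σ ^ R) y z} ≤ n * (19 * x ^ 2 / η ^ 4) := by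
  refine (law_real_exists_le (fun y σ => ∃ z, η < (d.walk σ ^ R) y z)
    (b := 19 * x ^ 2 / η ^ 4) fun y => ?_).trans (by simp)
  obtain ⟨σ₀⟩ := (inferInstance : Nonempty d.Matching)
  refine (law_real_le_cylExp
    (g := fun σ => (η ^ 4)⁻¹ * ∑ z, ((d.walk σ ^ R) y z) ^ 4) (fun σ => ?_) (fun σ => ?_) σ₀).trans ?_
  · exact mul_nonneg (by positivity) (Finset.sum_nonneg fun z _ =>
      pow_nonneg (d.walk_pow_nonneg σ R y z) 4)
  · rintro ⟨z, hz⟩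
    rw [← div_eq_inv_mul, one_le_div (by positivity)]
    refine le_trans ?_ (Finset.single_le_sum (f := fun z => ((d.walk σ ^ R) y z) ^ 4)
      (fun z _ => pow_nonneg (d.walk_pow_nonneg σ R y z) 4) (Finset.mem_univ z))
    exact pow_le_pow_left₀ hη.le hz.le 4
  · rw [cylExp_const_mul, ← div_eq_inv_mul]
    gcongr
    exact cylExp_sum_pow_le hout hΔ hΔ0 hρ0 hL hρ hβx hx1 y σ₀ hx le_rfl hx1

/-- A walk confined to few edges dies out if the walk is spread out. -/
theorem walkOn_pow_le_of_spread {σ : d.Matching} {R : ℕ} (hR : 1 ≤ R) {η : ℝ} (hη : 0 ≤ η)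
    (hspread : ∀ y z, (d.walk σ ^ R) y z ≤ η) {S : Finset d.Tail} {L : ℕ} (hS : S.card ≤ L)
    (J : ℕ) (x v : Fin n) : (d.walkOn S σ ^ (J * R)) x v ≤ (L * η) ^ J := by
  classical
  induction J generalizing x with
  | zero => simpa using d.walkOn_pow_le_one S σ 0 x v
  | succ J ih =>
    -- After at least one step the confined walk sits at the end of an edge in `S`. There are at
    -- most `L` such vertices, each of mass at most `η`, so every block of `R` steps gains a factor
    -- `L * η`.
    have hcol : ∀ z, z ∉ S.image (fun e => (σ e).1) → (d.walkOn S σ ^ R) x z = 0 := by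
      intro z hz
      obtain ⟨R', rfl⟩ := Nat.exists_eq_add_of_le' hR
      rw [pow_succ, Matrix.mul_apply]
      refine Finset.sum_eq_zero fun u _ => ?_
      rw [walkOn, Finset.sum_eq_zero, mul_zero]
      intro i _
      rw [if_neg]
      rintro ⟨h1, h2⟩
      exact hz (Finset.mem_image.2 ⟨_, h1, h2⟩)
    have hsum : ∑ z, (d.walkOn S σ ^ R) x z ≤ L * η := by
      rw [← Finset.sum_subset (Finset.subset_univ (S.image fun e => (σ e).1))
        fun z _ hz => hcol z hz]
      calc _ ≤ ∑ _z ∈ S.image (fun e => (σ e).1), η := Finset.sum_le_sum fun z _ =>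
            (d.walkOn_pow_le_walk S σ R x z).trans (hspread x z)
        _ = (S.image fun e => (σ e).1).card * η := by simp
        _ ≤ L * η := by gcongr; exact Finset.card_image_le.trans hS
    rw [show (J + 1) * R = R + J * R by ring, pow_add, Matrix.mul_apply]
    calc _ ≤ ∑ z, (d.walkOn S σ ^ R) x z * (L * η) ^ J := Finset.sum_le_sum fun z _ =>
          mul_le_mul_of_nonneg_left (ih z) (d.walkOn_pow_nonneg S σ R x z)
      _ = (∑ z, (d.walkOn S σ ^ R) x z) * (L * η) ^ J := by rw [Finset.sum_mul]
      _ ≤ L * η * (L * η) ^ J := by gcongr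
      _ = _ := by ring

/-- The Markov inequality for the moments relative to the influence. -/
theorem law_real_influence_lt_le (ind : d.Matching → Prop) (v : Fin n) {T h L : ℕ} (hh : h ≤ T)
    (hL : L < Fintype.card d.Tail) {ν : Fin n → ℝ} (hν : ∀ x, 0 ≤ ν x) (hν1 : ∑ x, ν x ≤ 1)
    {β : ℝ} (hβ0 : 0 ≤ β) (hβ : ∀ σ (S : Finset d.Tail), ind σ → S.card ≤ L →
      ∑ x, ν x * (d.walkOn S σ ^ h) x v ≤ β) {q : ℕ} (hq : q * T ≤ L) {s B : ℝ} (hs : 0 < s)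
    (hB : β + T * (((L : ℝ) + 2) / ((Fintype.card d.Tail : ℝ) - L)) ≤ B) :
    d.law.real {σ | ind σ ∧ s * d.influence T σ v < ∑ x, ν x * (d.walk σ ^ h) x v} ≤
      (B / s) ^ q := by
  classical
  have hmL : (0 : ℝ) < (Fintype.card d.Tail : ℝ) - L := by rw [sub_pos]; exact_mod_cast hL
  obtain ⟨σ₀⟩ := (inferInstance : Nonempty d.Matching)
  have hk0 : ∀ σ, 0 ≤ (d.influence T σ v)⁻¹ := fun σ => inv_nonneg.2 (influence_pos T σ v).le
  have hν0 : ∀ σ, 0 ≤ ∑ x, ν x * (d.walk σ ^ h) x v := fun σ =>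
    Finset.sum_nonneg fun x _ => mul_nonneg (hν x) (d.walk_pow_nonneg σ h x v)
  -- With the inverse influence as weight, every entrance into the revealed part is cheap by
  -- definition.
  have hmoment := d.cylExp_pow_le (ind := fun σ => if ind σ then 1 else 0)
    (k := fun σ => (d.influence T σ v)⁻¹) (fun σ => by split_ifs <;> norm_num)
    (fun σ => by split_ifs <;> norm_num) hk0 v hL (h := h)
    (fun σ w t ht => by
      rw [← div_eq_inv_mul, div_le_one (influence_pos T σ v)]
      exact le_influence (ht.trans hh) σ w v) hν hν1 hβ0
    (fun σ S hi hS => by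
      have hi' : ind σ := by by_contra h'; exact hi (if_neg h')
      refine le_trans ?_ (hβ σ S hi' hS)
      refine mul_le_of_le_one_left (Finset.sum_nonneg fun x _ =>
        mul_nonneg (hν x) (d.walkOn_pow_nonneg S σ h x v)) ?_
      exact inv_le_one_of_one_le₀ (one_le_influence T σ v)) q ∅ σ₀
    (by simpa using (Nat.mul_le_mul_left q hh).trans hq)
  have hB' : β + h * (((L : ℝ) + 2) / ((Fintype.card d.Tail : ℝ) - L)) ≤ B := by
    refine le_trans ?_ hB
    gcongr
  refine (law_real_le_cylExp (g := fun σ => (s ^ q)⁻¹ * ((if ind σ then 1 else 0) *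
    ((d.influence T σ v)⁻¹ * ∑ x, ν x * (d.walk σ ^ h) x v) ^ q)) (fun σ => ?_) (fun σ => ?_)
    σ₀).trans ?_
  · have := mul_nonneg (hk0 σ) (hν0 σ)
    split_ifs <;> positivity
  · rintro ⟨hi, hlt⟩
    rw [if_pos hi, one_mul, ← div_eq_inv_mul, one_le_div (by positivity)]
    refine pow_le_pow_left₀ hs.le ?_ q
    rw [← div_eq_inv_mul, le_div_iff₀ (influence_pos T σ v)]
    exact hlt.le
  · rw [cylExp_const_mul, ← div_eq_inv_mul, div_pow]
    gcongr
    refine hmoment.trans ?_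
    gcongr

/-- Here `ν` is a point mass. The spreading event enters as the indicator, since `β = (L * η) ^ J`
bounds the confined walk only on it. -/
theorem law_real_long_le {R J L q : ℕ} (hR : 1 ≤ R) {η : ℝ} (hη : 0 ≤ η)
    (hL : L < Fintype.card d.Tail) (hq : q * (J * R) ≤ L) {s B : ℝ} (hs : 0 < s)
    (hB : (L * η) ^ J + ((J * R : ℕ) : ℝ) * (((L : ℝ) + 2) / ((Fintype.card d.Tail : ℝ) - L)) ≤ B) :
    d.law.real {σ | ∃ p : Fin n × Fin n, (∀ y z, (d.walk σ ^ R) y z ≤ η) ∧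
      s * d.influence (J * R) σ p.2 < (d.walk σ ^ (J * R)) p.1 p.2} ≤ (n * n : ℝ) * (B / s) ^ q := by
  refine (law_real_exists_le (b := (B / s) ^ q) (fun (p : Fin n × Fin n) σ =>
    (∀ y z, (d.walk σ ^ R) y z ≤ η) ∧
      s * d.influence (J * R) σ p.2 < (d.walk σ ^ (J * R)) p.1 p.2) ?_).trans (by simp)
  rintro ⟨x, v⟩
  have h := law_real_influence_lt_le (d := d) (fun σ => ∀ y z, (d.walk σ ^ R) y z ≤ η) v
    (T := J * R) (h := J * R) le_rfl hL (ν := Pi.single x 1)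
    (fun y => by by_cases h : y = x <;> simp [h]) (by simp)
    (β := (L * η) ^ J) (by positivity)
    (fun σ S hσ hS => by
      simpa [Pi.single_apply] using walkOn_pow_le_of_spread hR hη hσ hS J x v) hq hs hB
  simpa [Pi.single_apply] using h

/-- Apart from `v` itself, only starting points that own a tail in `S` contribute. With uniform `ν`
this gives `β = (L + 1) / n`, without any spreading. -/
theorem sum_walkOn_pow_le (S : Finset d.Tail) (σ : d.Matching) (k : ℕ) (v : Fin n) :
    ∑ x, (d.walkOn S σ ^ k) x v ≤ S.card + 1 := by
  classical
  rw [← Finset.sum_subset (Finset.subset_univ (insert v (S.image Sigma.fst)))]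
  · calc _ ≤ ∑ _x ∈ insert v (S.image Sigma.fst), (1 : ℝ) :=
          Finset.sum_le_sum fun x _ => d.walkOn_pow_le_one S σ k x v
      _ = ((insert v (S.image Sigma.fst)).card : ℝ) := by simp
      _ ≤ S.card + 1 := by
          exact_mod_cast (Finset.card_insert_le _ _).trans
            (Nat.add_le_add_right Finset.card_image_le 1)
  · intro x _ hx
    simp only [Finset.mem_insert, Finset.mem_image, not_or, not_exists, not_and] at hx
    exact d.walkOn_pow_eq_zero σ k hx.2 hx.1

theorem law_real_short_le (hn : 0 < n) {T L q : ℕ}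
    (hL : L < Fintype.card d.Tail) (hq : q * T ≤ L) {s B : ℝ} (hs : 0 < s)
    (hB : ((L : ℝ) + 1) / n + T * (((L : ℝ) + 2) / ((Fintype.card d.Tail : ℝ) - L)) ≤ B) :
    d.law.real {σ | ∃ p : Fin T × Fin n,
      s * d.influence T σ p.2 < (n : ℝ)⁻¹ * ∑ x, (d.walk σ ^ (p.1 : ℕ)) x p.2} ≤
        (T * n : ℝ) * (B / s) ^ q := by
  refine (law_real_exists_le (b := (B / s) ^ q) (fun (p : Fin T × Fin n) σ =>
    s * d.influence T σ p.2 < (n : ℝ)⁻¹ * ∑ x, (d.walk σ ^ (p.1 : ℕ)) x p.2) ?_).trans (by simp)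
  rintro ⟨k, v⟩
  have hn' : (n : ℝ) ≠ 0 := by positivity
  have h := law_real_influence_lt_le (d := d) (fun _ => True) v
    (T := T) (h := k) k.2.le hL (ν := fun _ => (n : ℝ)⁻¹)
    (fun y => by positivity) (by simp [hn'])
    (β := ((L : ℝ) + 1) / n) (by positivity)
    (fun σ S _ hS => by
      rw [← Finset.mul_sum, div_eq_inv_mul]
      gcongr
      refine (sum_walkOn_pow_le S σ k v).trans ?_
      gcongr) hq hs hB
  simpa [← Finset.mul_sum] using h

theorem law_real_split_le {N N' : ℕ} {Δ r γ : ℝ} (hN : N' < N) (hNm : N' < Fintype.card d.Tail)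
    (hΔ : ∀ w, (d.inDeg w : ℝ) ≤ Δ) (hΔ0 : 0 ≤ Δ) (hr0 : 0 < r) (hr1 : r ≤ 1)
    (hr : ∀ k : ℕ, k ≤ Fintype.card d.Tail →
      (1 - (k : ℝ) / Fintype.card d.Tail) ^ N' ≤ r ^ k)
    (hγ0 : 0 ≤ γ)
    (hγ : r + ((N' + 1) * Δ * (r⁻¹ - r) + n * (1 - r)) / ((Fintype.card d.Tail : ℝ) - N') ≤ γ) :
    d.law.real {σ | ∃ p : Fin n × Fin n, d.Split N p.1 p.2 σ} ≤ (n * n : ℝ) * γ ^ N' := by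
  classical
  refine (law_real_exists_le (b := γ ^ N') (fun (p : Fin n × Fin n) σ => d.Split N p.1 p.2 σ)
    ?_).trans (by simp)
  rintro ⟨x, x'⟩
  obtain ⟨σ₀⟩ := (inferInstance : Nonempty d.Matching)
  rw [law_real_eq_cylExp d _ σ₀]
  refine (cylExp_split_le hN hNm hΔ hΔ0 hr0 hr1 hr hγ N' ∅ σ₀ {x} (by simp)
    (fun σ _ C _ hx => Finset.singleton_subset_iff.2 hx) (Finset.mem_singleton_self x) (by simp)
    (by simp) (by simp)).trans ?_
  exact mul_le_of_le_one_right (pow_nonneg hγ0 _) (pow_le_one₀ hr0.le hr1)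

end BiDegree
end DCM
-- Logarithms, power laws and the lower bounds
namespace DCM

theorem natLog_succ_le {n : ℕ} {τ : ℝ} (hτ : 0 < τ) :
    ((Nat.log 2 n + 1 : ℕ) : ℝ) ≤ 1 + (n : ℝ) ^ τ / (τ * Real.log 2) := by
  have hlog2 : 0 < Real.log 2 := Real.log_pos one_lt_two
  rcases Nat.eq_zero_or_pos n with rfl | hn
  · simp; positivity
  have h1 : ((2 : ℝ) ^ (Nat.log 2 n)) ≤ n := by exact_mod_cast Nat.pow_log_le_self 2 hn.ne'
  have h2 := Real.log_le_log (by positivity) h1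
  rw [Real.log_pow] at h2
  have h3 := Real.log_le_rpow_div (Nat.cast_nonneg n) hτ
  have h4 : (Nat.log 2 n : ℝ) ≤ (n : ℝ) ^ τ / (τ * Real.log 2) := by
    rw [← div_div, le_div_iff₀ hlog2]; exact h2.trans h3
  push_cast; linarith

theorem tendsto_natCast_rpow {θ : ℝ} (hθ : 0 < θ) :
    Tendsto (fun n : ℕ => (n : ℝ) ^ θ) atTop atTop :=
  (tendsto_rpow_atTop hθ).comp tendsto_natCast_atTop_atTop

theorem eventually_le_rpow (C : ℝ) {θ : ℝ} (hθ : 0 < θ) : ∀ᶠ n : ℕ in atTop, C ≤ (n : ℝ) ^ θ :=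
  (tendsto_natCast_rpow hθ).eventually_ge_atTop C

/-- Powers of the logarithm are below every power. -/
theorem eventually_natLog_le {C : ℝ} (hC : 0 ≤ C) (k : ℕ) {θ : ℝ} (hθ : 0 < θ) :
    ∀ᶠ n : ℕ in atTop, C * ((Nat.log 2 n + 1 : ℕ) : ℝ) ^ k ≤ (n : ℝ) ^ θ := by
  -- The `k` factors use at most half of the exponent `θ`; the other half absorbs the constants.
  set τ : ℝ := θ / (2 * (k + 1)) with hτd
  have hτ : 0 < τ := by positivity
  set A : ℝ := 1 + 1 / (τ * Real.log 2) with hA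
  have hlog2 : 0 < Real.log 2 := Real.log_pos one_lt_two
  have hA0 : 0 < A := by positivity
  filter_upwards [eventually_ge_atTop 1, eventually_le_rpow (C * A ^ k) (half_pos hθ)] with n hn h
  have hn1 : (1 : ℝ) ≤ n := by exact_mod_cast hn
  have hn0 : (0 : ℝ) < n := by linarith
  have h1 : ((Nat.log 2 n + 1 : ℕ) : ℝ) ≤ A * (n : ℝ) ^ τ := by
    refine (natLog_succ_le hτ).trans ?_
    have := Real.one_le_rpow hn1 hτ.le
    rw [hA, add_mul, one_mul, one_div_mul_eq_div]
    linarith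
  calc C * ((Nat.log 2 n + 1 : ℕ) : ℝ) ^ k ≤ C * (A * (n : ℝ) ^ τ) ^ k := by gcongr
    _ = C * A ^ k * (n : ℝ) ^ (τ * k) := by rw [mul_pow, Real.rpow_mul_natCast hn0.le]; ring
    _ ≤ (n : ℝ) ^ (θ / 2) * (n : ℝ) ^ (θ / 2) := by
        gcongr
        rw [hτd, div_mul_eq_mul_div, div_le_div_iff₀ (by positivity) two_pos]
        nlinarith
    _ = (n : ℝ) ^ θ := by rw [← Real.rpow_add hn0]; ring_nf

theorem one_half_pow_natLog_succ_le {n : ℕ} (hn : 0 < n) :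
    ((1 : ℝ) / 2) ^ (Nat.log 2 n + 1) ≤ (n : ℝ)⁻¹ := by
  rw [one_div, inv_pow]
  gcongr
  exact_mod_cast (Nat.lt_pow_succ_log_self one_lt_two n).le

section PowerLaw
variable {κ : ℝ}

/-- The power-law bounds at finitely many exponents. -/
theorem HasPowerLaw.eventually_grid {x : ∀ n : ℕ, Fin n → ℝ} (h : HasPowerLaw κ x)
    {θ : ℝ} (hθ : 0 < θ) : ∀ᶠ n : ℕ in atTop, ∀ i : ℕ, 1 ≤ i → i * θ < 1 / κ →
      (n : ℝ) ^ (-(i * θ) * κ - θ) ≤ tail (x n) ((n : ℝ) ^ (i * θ)) ∧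
      tail (x n) ((n : ℝ) ^ (i * θ)) ≤ (n : ℝ) ^ (-(i * θ) * κ + θ) := by
  have : ∀ᶠ n : ℕ in atTop, ∀ i ∈ Finset.range (⌈1 / κ / θ⌉₊ + 1), 1 ≤ i → i * θ < 1 / κ →
      (n : ℝ) ^ (-(i * θ) * κ - θ) ≤ tail (x n) ((n : ℝ) ^ (i * θ)) ∧
      tail (x n) ((n : ℝ) ^ (i * θ)) ≤ (n : ℝ) ^ (-(i * θ) * κ + θ) := by
    rw [Filter.eventually_all_finset]
    intro i _
    by_cases hi : 1 ≤ i ∧ i * θ < 1 / κ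
    · have hi0 : (0 : ℝ) < i := by exact_mod_cast hi.1
      filter_upwards [h θ hθ (i * θ) (by positivity) hi.2] with n hn _ _
      exact ⟨hn.1, hn.2.1⟩
    · exact Eventually.of_forall fun n h1 h2 => absurd ⟨h1, h2⟩ hi
  filter_upwards [this] with n hn i hi1 hi2
  refine hn i (Finset.mem_range.2 ?_) hi1 hi2
  have h1 : (i : ℝ) < 1 / κ / θ := by rwa [lt_div_iff₀ hθ]
  have h2 : (i : ℝ) < ⌈1 / κ / θ⌉₊ := h1.trans_le (Nat.le_ceil _)
  have h3 : i < ⌈1 / κ / θ⌉₊ := by exact_mod_cast h2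
  omega

theorem HasPowerLaw.eventually_le {x : ∀ n : ℕ, Fin n → ℝ} (h : HasPowerLaw κ x) (hκ : 0 < κ)
    {θ : ℝ} (hθ : 0 < θ) : ∀ᶠ n : ℕ in atTop, ∀ v, x n v ≤ (n : ℝ) ^ (1 / κ + θ) := by
  have h0 : 0 < 1 / κ := by positivity
  filter_upwards [h θ hθ (1 / κ / 2) (by positivity) (by linarith), eventually_gt_atTop 0]
    with n hn hn0
  exact (tail_eq_zero_iff hn0).1 hn.2.2

theorem tail_mul_eq {n : ℕ} (hn : 0 < n) (x : Fin n → ℝ) (t : ℝ) [DecidablePred fun v => t < x v] :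
    tail x t * n = ((Finset.univ.filter fun v => t < x v).card : ℝ) := by
  have : (n : ℝ) ≠ 0 := by positivity
  unfold tail
  rw [div_mul_cancel₀ _ this, Nat.card_eq_fintype_card, Fintype.card_subtype]

/-- The moment of order `κ` is almost bounded. -/
theorem HasPowerLaw.eventually_sum_rpow_le {x : ∀ n : ℕ, Fin n → ℝ} (h : HasPowerLaw κ x)
    (hx : ∀ n v, 0 ≤ x n v) (hκ : 0 < κ) {ε : ℝ} (hε : 0 < ε) :
    ∀ᶠ n : ℕ in atTop, ∑ v, x n v ^ κ ≤ (n : ℝ) ^ (1 + ε) := by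
  classical
  -- The losses are `2 * θ * κ` from rounding to the grid, `θ` from the tail bounds and `θ` from the
  -- number of grid points. The second bound puts the grid point `i = 1` below `1 / κ`.
  set θ : ℝ := min (ε / (2 * κ + 2)) (1 / κ / 2) with hθd
  have hθ : 0 < θ := lt_min (by positivity) (by positivity)
  have hθ1 : θ * (2 * κ + 2) ≤ ε := by
    have := min_le_left (ε / (2 * κ + 2)) (1 / κ / 2)
    rwa [← hθd, le_div_iff₀ (by positivity)] at this
  have hθ2 : θ < 1 / κ := by
    have := min_le_right (ε / (2 * κ + 2)) (1 / κ / 2)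
    have h0 : 0 < 1 / κ := by positivity
    rw [← hθd] at this; linarith
  set M : ℕ := ⌈1 / κ / θ⌉₊ + 1 with hM
  set I : Finset ℕ := (Finset.range M).filter fun i => 1 ≤ i ∧ i * θ < 1 / κ with hI
  have hmemI : ∀ i : ℕ, i ∈ I ↔ 1 ≤ i ∧ i * θ < 1 / κ := by
    intro i
    simp only [hI, Finset.mem_filter, Finset.mem_range, and_iff_right_iff_imp]
    rintro ⟨-, h2⟩
    have h1 : (i : ℝ) < 1 / κ / θ := by rwa [lt_div_iff₀ hθ]
    have h3 : (i : ℝ) < ⌈1 / κ / θ⌉₊ := h1.trans_le (Nat.le_ceil _)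
    have h4 : i < ⌈1 / κ / θ⌉₊ := by exact_mod_cast h3
    omega
  filter_upwards [h.eventually_grid hθ, h.eventually_le hκ hθ, eventually_ge_atTop 1,
    eventually_le_rpow ((M : ℝ) + 1) hθ] with n hgrid hmax hn hMn
  have hn1 : (1 : ℝ) ≤ n := by exact_mod_cast hn
  have hn0 : (0 : ℝ) < n := by linarith
  have hpt : ∀ v, x n v ^ κ ≤ (n : ℝ) ^ (2 * θ * κ) *
      (1 + ∑ i ∈ I, (n : ℝ) ^ (i * θ * κ) * if (n : ℝ) ^ (i * θ) < x n v then 1 else 0) := by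
    intro v
    have hnn : ∀ i ∈ I, (0 : ℝ) ≤
        (n : ℝ) ^ (i * θ * κ) * if (n : ℝ) ^ (i * θ) < x n v then 1 else 0 :=
      fun i _ => by split_ifs <;> positivity
    have hpow : ∀ b : ℝ, x n v ≤ (n : ℝ) ^ b → x n v ^ κ ≤ (n : ℝ) ^ (b * κ) := fun b hb => by
      rw [Real.rpow_mul hn0.le]; exact Real.rpow_le_rpow (hx n v) hb hκ.le
    rcases (I.filter fun i : ℕ => (n : ℝ) ^ (i * θ) < x n v).eq_empty_or_nonempty with he | hne
    · have h1 : x n v ≤ (n : ℝ) ^ (2 * θ) := by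
        by_contra! hc
        have : 1 ∈ I.filter fun i : ℕ => (n : ℝ) ^ (i * θ) < x n v := by
          rw [Finset.mem_filter, hmemI]
          refine ⟨⟨le_rfl, by simpa using hθ2⟩, lt_of_le_of_lt ?_ hc⟩
          exact Real.rpow_le_rpow_of_exponent_le hn1 (by push_cast; linarith)
        rw [he] at this; simp at this
      refine (hpow _ h1).trans (le_mul_of_one_le_right (by positivity) ?_)
      linarith [Finset.sum_nonneg hnn]
    · obtain ⟨i, hi, himax⟩ := Finset.exists_max_image _ id hne
      rw [Finset.mem_filter] at hi
      have hi' := (hmemI i).1 hi.1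
      -- By maximality of `i`, the next grid point is an upper bound. At the end of the grid the
      -- maximum bound `1 / κ + θ` takes its place, which is why the index is `i + 2`.
      have h1 : x n v ≤ (n : ℝ) ^ ((i + 2) * θ) := by
        by_cases hi1 : ((i + 1 : ℕ) : ℝ) * θ < 1 / κ
        · by_contra! hc
          have : i + 1 ∈ I.filter fun i : ℕ => (n : ℝ) ^ (i * θ) < x n v := by
            rw [Finset.mem_filter, hmemI]
            refine ⟨⟨by omega, hi1⟩, lt_of_le_of_lt ?_ hc⟩
            exact Real.rpow_le_rpow_of_exponent_le hn1 (by push_cast; nlinarith)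
          have := himax _ this
          simp only [id] at this; omega
        · refine (hmax v).trans (Real.rpow_le_rpow_of_exponent_le hn1 ?_)
          push_cast at hi1; push Not at hi1; linarith
      calc x n v ^ κ ≤ (n : ℝ) ^ ((i + 2) * θ * κ) := hpow _ h1
        _ = (n : ℝ) ^ (2 * θ * κ) * ((n : ℝ) ^ (i * θ * κ) *
              if (n : ℝ) ^ (i * θ) < x n v then 1 else 0) := by
            rw [if_pos hi.2, mul_one, ← Real.rpow_add hn0]; ring_nf
        _ ≤ _ := by
            gcongr
            have := Finset.single_le_sum hnn hi.1
            linarith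
  calc ∑ v, x n v ^ κ ≤ ∑ v, (n : ℝ) ^ (2 * θ * κ) *
        (1 + ∑ i ∈ I, (n : ℝ) ^ (i * θ * κ) * if (n : ℝ) ^ (i * θ) < x n v then 1 else 0) :=
        Finset.sum_le_sum fun v _ => hpt v
    _ = (n : ℝ) ^ (2 * θ * κ) * (n + ∑ i ∈ I, (n : ℝ) ^ (i * θ * κ) *
          (tail (x n) ((n : ℝ) ^ (i * θ)) * n)) := by
        rw [← Finset.mul_sum, Finset.sum_add_distrib, Finset.sum_comm]
        simp only [← Finset.mul_sum, tail_mul_eq hn, Finset.sum_boole]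
        simp
    _ ≤ (n : ℝ) ^ (2 * θ * κ) * (n + ∑ _i ∈ I, (n : ℝ) ^ θ * n) := by
        refine mul_le_mul_of_nonneg_left (add_le_add le_rfl (Finset.sum_le_sum fun i hi => ?_))
          (by positivity)
        have hi' := (hmemI i).1 hi
        rw [← mul_assoc]
        gcongr
        calc _ ≤ (n : ℝ) ^ (i * θ * κ) * (n : ℝ) ^ (-(i * θ) * κ + θ) := by
              gcongr; exact (hgrid i hi'.1 hi'.2).2
          _ = (n : ℝ) ^ θ := by rw [← Real.rpow_add hn0]; ring_nf
    _ = (n : ℝ) ^ (2 * θ * κ) * (n * (1 + I.card * (n : ℝ) ^ θ)) := by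
        rw [Finset.sum_const, nsmul_eq_mul]; ring
    _ ≤ (n : ℝ) ^ (2 * θ * κ) * (n * ((n : ℝ) ^ θ * (n : ℝ) ^ θ)) := by
        gcongr
        have hIM : (I.card : ℝ) ≤ M := by
          exact_mod_cast (Finset.card_filter_le _ _).trans_eq (Finset.card_range M)
        have h1 : 1 ≤ (n : ℝ) ^ θ := Real.one_le_rpow hn1 hθ.le
        nlinarith
    _ = (n : ℝ) ^ (2 * θ * κ + (1 + (θ + θ))) := by
        rw [Real.rpow_add hn0, Real.rpow_add hn0 1, Real.rpow_one, Real.rpow_add hn0]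
    _ ≤ _ := Real.rpow_le_rpow_of_exponent_le hn1 (by linarith)

end PowerLaw

/-- The lower bounds hold for every realization of the graph. -/
theorem eventually_lowerBounds {d : ∀ n : ℕ, BiDegree n} {K : ℕ} (hK0 : 0 < K)
    (hK : ∀ n v, (d n).outDeg v ≤ K) {κ : ℝ} (hκ : 0 < κ)
    (hφ : HasPowerLaw κ (fun n v => ((d n).inDeg v : ℝ))) {lam : ∀ n : ℕ, Fin n → ℝ}
    (hlam : NearUniform lam) {α : ℝ} (h0 : 0 < α) (h1 : α < 1) {ε b : ℝ} (hε : 0 < ε)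
    (hb : b < 1 / κ) : ∀ᶠ n : ℕ in atTop, ∀ (σ : (d n).Matching) (π : Fin n → ℝ),
      IsStationary ((d n).surfer σ α (lam n)) π → LowerBounds κ ε b (fun v => (n : ℝ) * π v) := by
  set θ : ℝ := min (ε / (3 * κ + 1)) ((1 / κ - b) / 4) with hθd
  have hθ : 0 < θ := lt_min (by positivity) (by linarith)
  have hθ1 : θ * (3 * κ + 1) ≤ ε := by
    have := min_le_left (ε / (3 * κ + 1)) ((1 / κ - b) / 4)
    rwa [← hθd, le_div_iff₀ (by positivity)] at this
  have hθ2 : b + 3 * θ < 1 / κ := by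
    have := min_le_right (ε / (3 * κ + 1)) ((1 / κ - b) / 4)
    rw [← hθd] at this; linarith
  have hc : 0 < (1 - α) * α / K := by
    have : 0 < 1 - α := by linarith
    positivity
  filter_upwards [hφ.eventually_grid hθ, hlam.2 θ hθ, eventually_ge_atTop 1,
    eventually_le_rpow ((1 - α) * α / K)⁻¹ hθ] with n hgrid hl hn hcn σ π hπ a ha0 hab
  have hn1 : (1 : ℝ) ≤ n := by exact_mod_cast hn
  have hn0 : (0 : ℝ) < n := by linarith
  have hdeg : ∀ v, (n : ℝ) ^ (-2 * θ) * (d n).inDeg v ≤ n * π v := by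
    intro v
    have h2 := BiDegree.le_isStationary_surfer h0.le h1.le hπ (hK n) (l := (n : ℝ) ^ (-1 - θ))
      (by positivity) (fun v => (hl v).1) v
    have h3 : (n : ℝ) ^ (-θ) ≤ (1 - α) * α / K := by
      rw [Real.rpow_neg hn0.le]
      exact inv_le_of_inv_le₀ hc hcn
    calc (n : ℝ) ^ (-2 * θ) * (d n).inDeg v
        = (n : ℝ) ^ (-θ) * ((n : ℝ) ^ (-θ) * (d n).inDeg v) := by
          rw [← mul_assoc, ← Real.rpow_add hn0]; ring_nf
      _ ≤ (1 - α) * α / K * ((n : ℝ) ^ (-θ) * (d n).inDeg v) := by gcongr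
      _ = n * ((1 - α) * α * (n : ℝ) ^ (-1 - θ) * ((d n).inDeg v / K)) := by
          rw [show -θ = 1 + (-1 - θ) by ring, Real.rpow_add hn0, Real.rpow_one]; ring
      _ ≤ _ := by gcongr
  -- The grid exponent lies between `a + 2 * θ` and `a + 3 * θ`. The shift `2 * θ` pays for the loss
  -- in `hdeg`, and the fixed finite grid makes the bound simultaneous in `a`.
  set i : ℕ := ⌈a / θ⌉₊ + 2 with hi
  have hi1 : a + 2 * θ ≤ i * θ := by
    have := Nat.le_ceil (a / θ)
    rw [div_le_iff₀ hθ] at this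
    rw [hi]; push_cast; linarith
  have hi2 : i * θ ≤ a + 3 * θ := by
    have := (Nat.ceil_lt_add_one (div_pos ha0 hθ).le).le
    have h3 := mul_le_mul_of_nonneg_right this hθ.le
    rw [add_mul, div_mul_cancel₀ _ hθ.ne'] at h3
    rw [hi]; push_cast; linarith
  calc (n : ℝ) ^ (-a * κ - ε) ≤ (n : ℝ) ^ (-(i * θ) * κ - θ) :=
        Real.rpow_le_rpow_of_exponent_le hn1 (by nlinarith)
    _ ≤ tail (fun v => ((d n).inDeg v : ℝ)) ((n : ℝ) ^ (i * θ)) :=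
        (hgrid i (by omega) (by linarith)).1
    _ ≤ _ := tail_mono fun v hv => by
        refine lt_of_lt_of_le ?_ (hdeg v)
        calc (n : ℝ) ^ a = (n : ℝ) ^ (-2 * θ) * (n : ℝ) ^ (a + 2 * θ) := by
              rw [← Real.rpow_add hn0]; ring_nf
          _ ≤ (n : ℝ) ^ (-2 * θ) * (n : ℝ) ^ (i * θ) := by gcongr
          _ < _ := by gcongr

end DCM
-- The events of high probability
namespace DCM

theorem two_mul_le_card_tail {n : ℕ} {d : BiDegree n} (hout : ∀ v, 2 ≤ d.outDeg v) :
    2 * n ≤ Fintype.card d.Tail := by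
  rw [Fintype.card_sigma]
  calc 2 * n = ∑ _v : Fin n, 2 := by simp [mul_comm]
    _ ≤ _ := Finset.sum_le_sum fun v _ => by simpa using hout v

theorem card_tail_le {n : ℕ} {d : BiDegree n} {K : ℕ} (hK : ∀ v, d.outDeg v ≤ K) :
    Fintype.card d.Tail ≤ K * n := by
  rw [Fintype.card_sigma]
  calc _ ≤ ∑ _v : Fin n, K := Finset.sum_le_sum fun v _ => by simpa using hK v
    _ = K * n := by simp [mul_comm]

section Asymptotics
variable {d : ∀ n : ℕ, BiDegree n} {κ : ℝ}

/-- Here `x ^ 2 = n ^ (-2 + 2 / κ + g / 4)` bounds the cost of two collisions up to a constant. The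
union over `n` starting points and Markov's inequality with `η ^ 4 = n ^ (-(g / 4))` leave `19 * n ^
(-(g / 2))`; the gap `g` is positive exactly because `κ > 2`. -/
theorem eventually_spread (hout : ∀ n v, 2 ≤ (d n).outDeg v) (hκ : 2 < κ)
    (hφ : HasPowerLaw κ (fun n v => ((d n).inDeg v : ℝ))) {g : ℝ} (hg : g = 1 - 2 / κ)
    {δ : ℝ} (hδ : 0 < δ) : ∀ᶠ n : ℕ in atTop, (d n).law.real {σ | ∃ y z,
      (n : ℝ) ^ (-(g / 16)) < ((d n).walk σ ^ (Nat.log 2 n + 1)) y z} ≤ δ := by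
  have hκ0 : 0 < κ := by linarith
  have hg0 : 0 < g := by rw [hg, sub_pos, div_lt_one hκ0]; exact hκ
  have hκg : 1 / κ = (1 - g) / 2 := by rw [hg]; ring
  have hg1 : g < 1 := by rw [hg]; have : 0 < 2 / κ := by positivity
                         linarith
  have he : 0 < g / 16 := by positivity
  filter_upwards [hφ.eventually_le hκ0 he, eventually_ge_atTop 1,
    eventually_natLog_le (C := 40) (by norm_num) 2 he,
    eventually_natLog_le (C := 4) (by norm_num) 1 (zero_lt_one' ℝ),
    eventually_le_rpow (19 / δ) (half_pos hg0)] with n hΔ hn hR2 hR1 hδn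
  have hn1 : (1 : ℝ) ≤ n := by exact_mod_cast hn
  have hn0 : (0 : ℝ) < n := by linarith
  set R : ℕ := Nat.log 2 n + 1 with hR
  have hR1' : (1 : ℝ) ≤ R := by exact_mod_cast (by omega : 1 ≤ R)
  rw [Real.rpow_one, pow_one] at hR1
  have hRn : 4 * R ≤ n := by exact_mod_cast hR1
  have hm2 := two_mul_le_card_tail (hout n)
  have hm : (n : ℝ) ≤ (Fintype.card (d n).Tail : ℝ) - (4 * R : ℕ) := by
    have h1 : ((2 * n : ℕ) : ℝ) ≤ (Fintype.card (d n).Tail : ℝ) := by exact_mod_cast hm2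
    have h2 : ((4 * R : ℕ) : ℝ) ≤ n := by exact_mod_cast hRn
    push_cast at h1 h2 ⊢; linarith
  set Δ : ℝ := (n : ℝ) ^ (1 / κ + g / 16) with hΔd
  have hΔ0 : 0 < Δ := by positivity
  set x : ℝ := (n : ℝ) ^ (-1 + 1 / κ + g / 8) with hx
  have hRe : (R : ℝ) + 1 ≤ (n : ℝ) ^ (g / 16) := by nlinarith
  have hx_eq : x = (n : ℝ) ^ (g / 16) * Δ / n := by
    rw [hx, hΔd, ← Real.rpow_add hn0, ← Real.rpow_sub_one hn0.ne']; ring_nf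
  have hbound := BiDegree.law_real_not_spread_le (hout n) (Δ := Δ)
    (ρ := (8 * (R : ℝ) + 2) * Δ / n) hΔ hΔ0.le (by positivity) (R := R) (by omega)
    (by
      rw [div_mul_eq_mul_div, le_div_iff₀ hn0]
      push_cast at hm ⊢
      rw [show 2 * (4 * (R : ℝ)) + 2 = 8 * R + 2 by ring]
      gcongr)
    (x := x) (η := (n : ℝ) ^ (-(g / 16)))
    (by
      rw [hx_eq, mul_div_assoc', ← mul_assoc]
      gcongr
      push_cast
      nlinarith)
    (by
      rw [hx_eq]
      have h1 := one_half_pow_natLog_succ_le hn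
      have h2 : 1 ≤ Δ := Real.one_le_rpow hn1 (by positivity)
      calc ((R : ℝ) + 1) * (1 / 2) ^ R ≤ (n : ℝ) ^ (g / 16) * (n : ℝ)⁻¹ := by gcongr
        _ ≤ (n : ℝ) ^ (g / 16) * Δ * (n : ℝ)⁻¹ := by
            gcongr; exact le_mul_of_one_le_right (by positivity) h2
        _ = _ := (div_eq_mul_inv _ _).symm)
    (Real.rpow_le_one_of_one_le_of_nonpos hn1 (by rw [hκg]; linarith))
    (by positivity)
  refine hbound.trans ?_
  have h1 : (n : ℝ) * (19 * x ^ 2 / ((n : ℝ) ^ (-(g / 16))) ^ 4) = 19 * (n : ℝ) ^ (-(g / 2)) := by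
    rw [hx, ← Real.rpow_mul_natCast hn0.le, ← Real.rpow_mul_natCast hn0.le, mul_div_assoc,
      ← Real.rpow_sub hn0, mul_left_comm, ← Real.rpow_one_add' hn0.le]
    · rw [hκg]; congr 2; push_cast; ring
    · rw [hκg]; push_cast; intro h; linarith
  rw [h1, Real.rpow_neg hn0.le, ← div_eq_mul_inv, div_le_iff₀ (by positivity)]
  rw [div_le_iff₀ hδ] at hδn
  linarith

/-- Both families of walks are controlled by the influence. -/
theorem eventually_influence (hout : ∀ n v, 2 ≤ (d n).outDeg v) {c ε : ℝ} (hc : 0 < c)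
    (hε : 0 < ε) {J : ℕ} (hJ1 : 1 ≤ J) (hJ : 2 ≤ c * J) {δ : ℝ} (hδ : 0 < δ) :
    ∀ᶠ n : ℕ in atTop, (d n).law.real {σ | ∃ p : Fin n × Fin n,
        (∀ y z, ((d n).walk σ ^ (Nat.log 2 n + 1)) y z ≤ (n : ℝ) ^ (-c)) ∧
        (n : ℝ) ^ (ε - 1) * (d n).influence (J * (Nat.log 2 n + 1)) σ p.2 <
          ((d n).walk σ ^ (J * (Nat.log 2 n + 1))) p.1 p.2} ≤ δ ∧
      (d n).law.real {σ | ∃ p : Fin (J * (Nat.log 2 n + 1)) × Fin n,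
        (n : ℝ) ^ (ε - 1) * (d n).influence (J * (Nat.log 2 n + 1)) σ p.2 <
          (n : ℝ)⁻¹ * ∑ x, ((d n).walk σ ^ (p.1 : ℕ)) x p.2} ≤ δ := by
  -- One moment gains `B / s = n ^ (-(ε / 2))`; its `q`-th power is at most `n ^ (-3)`, which beats
  -- a union over `n * n` pairs.
  set q : ℕ := ⌈6 / ε⌉₊ + 1 with hq
  have hq1 : 1 ≤ q := by omega
  have hqε : 3 ≤ ε / 2 * q := by
    have := Nat.le_ceil (6 / ε)
    rw [div_le_iff₀ hε] at this
    rw [hq]; push_cast; nlinarith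
  filter_upwards [eventually_ge_atTop 1,
    eventually_natLog_le (C := 9 * (q * J : ℝ) ^ 2) (by positivity) 2 (half_pos hε),
    eventually_natLog_le (C := (q * J : ℝ)) (by positivity) 1 (half_pos hc),
    eventually_natLog_le (C := (q * J : ℝ)) (by positivity) 1 (zero_lt_one' ℝ),
    eventually_le_rpow (1 / δ) (zero_lt_one' ℝ)] with n hn hL2 hLc hLn hδn
  have hn1 : (1 : ℝ) ≤ n := by exact_mod_cast hn
  have hn0 : (0 : ℝ) < n := by linarith
  set R : ℕ := Nat.log 2 n + 1 with hR
  rw [Real.rpow_one] at hLn hδn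
  set L : ℕ := q * (J * R) with hL
  have hLr : (L : ℝ) = q * J * R := by rw [hL]; push_cast; ring
  have hT1 : 1 ≤ J * R := Nat.mul_pos hJ1 (by omega)
  have hTL : J * R ≤ L := Nat.le_mul_of_pos_left _ hq1
  have hTL' : ((J * R : ℕ) : ℝ) ≤ L := by exact_mod_cast hTL
  have hL1 : (1 : ℝ) ≤ L := by exact_mod_cast hT1.trans hTL
  rw [pow_one, ← hLr] at hLc hLn
  rw [mul_assoc, ← mul_pow, ← hLr] at hL2
  have hLn' : L ≤ n := by exact_mod_cast hLn
  have hm2 := two_mul_le_card_tail (hout n)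
  have hm : (n : ℝ) ≤ (Fintype.card (d n).Tail : ℝ) - L := by
    have h1 : ((2 * n : ℕ) : ℝ) ≤ (Fintype.card (d n).Tail : ℝ) := by exact_mod_cast hm2
    push_cast at h1; linarith
  have hLm : L < Fintype.card (d n).Tail := by omega
  set B : ℝ := (n : ℝ) ^ (ε / 2) / n with hB
  set s : ℝ := (n : ℝ) ^ (ε - 1) with hs
  have hs0 : 0 < s := by positivity
  have hTc : ((J * R : ℕ) : ℝ) * (((L : ℝ) + 2) / ((Fintype.card (d n).Tail : ℝ) - L)) ≤
      L * (L + 2) / n := by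
    rw [mul_div_assoc]
    exact mul_le_mul hTL' (by gcongr) (div_nonneg (by positivity) (hn0.le.trans hm)) (by positivity)
  have hBs : (B / s) ^ q ≤ (n : ℝ) ^ (-3 : ℝ) := by
    have : B / s = (n : ℝ) ^ (-(ε / 2)) := by
      rw [hB, hs, ← Real.rpow_sub_one hn0.ne', ← Real.rpow_sub hn0]; ring_nf
    rw [this, ← Real.rpow_mul_natCast hn0.le]
    exact Real.rpow_le_rpow_of_exponent_le hn1 (by linarith)
  have hfin : (n * n : ℝ) * (B / s) ^ q ≤ δ := by
    calc (n * n : ℝ) * (B / s) ^ q ≤ (n * n : ℝ) * (n : ℝ) ^ (-3 : ℝ) := by gcongr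
      _ = (n : ℝ)⁻¹ := by
          rw [← Real.rpow_neg_one, show (-1 : ℝ) = 1 + 1 + -3 by norm_num, Real.rpow_add hn0,
            Real.rpow_add hn0, Real.rpow_one]
      _ ≤ δ := by
          rw [div_le_iff₀ hδ] at hδn
          rw [inv_le_iff_one_le_mul₀ hn0]; linarith
  refine ⟨(BiDegree.law_real_long_le (L := L) (q := q) (B := B) (by omega) (by positivity) hLm
    le_rfl hs0 ?_).trans hfin, (BiDegree.law_real_short_le hn (L := L) (q := q) (B := B) hLm le_rfl
    hs0 ?_).trans ?_⟩
  -- The logarithmic factor `L` costs half of `c`, and `2 ≤ c * J` then gives `1 / n` after `J`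
  -- blocks.
  · have h1 : (L * (n : ℝ) ^ (-c)) ^ J ≤ 1 / n := by
      calc (L * (n : ℝ) ^ (-c)) ^ J ≤ ((n : ℝ) ^ (c / 2) * (n : ℝ) ^ (-c)) ^ J := by gcongr
        _ = (n : ℝ) ^ (-(c / 2) * J) := by
            rw [← Real.rpow_add hn0, ← Real.rpow_mul_natCast hn0.le]; ring_nf
        _ ≤ (n : ℝ) ^ (-1 : ℝ) := Real.rpow_le_rpow_of_exponent_le hn1 (by linarith)
        _ = _ := by rw [Real.rpow_neg_one, one_div]
    calc _ ≤ 1 / (n : ℝ) + L * (L + 2) / n := add_le_add h1 hTc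
      _ = (1 + L * (L + 2)) / n := by rw [add_div]
      _ ≤ B := by rw [hB]; gcongr; nlinarith
  · calc _ ≤ ((L : ℝ) + 1) / n + L * (L + 2) / n := by gcongr
      _ = (L + 1 + L * (L + 2)) / n := by ring
      _ ≤ B := by rw [hB]; gcongr; nlinarith
  · refine le_trans ?_ hfin
    gcongr
    exact_mod_cast hTL.trans hLn'

/-- With `N'` about `n ^ (1 / 2 + g / 8)`, one exploration collects order `N'` free heads and the
other makes `N'` attempts, so missing has probability about `exp (-c * n ^ (g / 4))`. At the same
time `N' * Δ` is of order `n ^ (1 - 5 * g / 16)`, so returns to the explored part are rare. -/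
theorem eventually_not_split (hout : ∀ n v, 2 ≤ (d n).outDeg v) {K : ℕ} (hK0 : 0 < K)
    (hK : ∀ n v, (d n).outDeg v ≤ K) (hκ : 2 < κ)
    (hφ : HasPowerLaw κ (fun n v => ((d n).inDeg v : ℝ))) {g : ℝ} (hg : g = 1 - 2 / κ)
    {δ : ℝ} (hδ : 0 < δ) : ∀ᶠ n : ℕ in atTop, (d n).law.real {σ | ∃ p : Fin n × Fin n,
      (d n).Split (⌈(n : ℝ) ^ (1 / 2 + g / 8)⌉₊ + 1) p.1 p.2 σ} ≤ δ := by
  have hκ0 : 0 < κ := by linarith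
  have hg0 : 0 < g := by rw [hg, sub_pos, div_lt_one hκ0]; exact hκ
  have hκg : 1 / κ = (1 - g) / 2 := by rw [hg]; ring
  have hg1 : g < 1 := by rw [hg]; have : 0 < 2 / κ := by positivity
                         linarith
  have he : 0 < g / 16 := by positivity
  filter_upwards [hφ.eventually_le hκ0 he, eventually_ge_atTop 1,
    eventually_natLog_le (C := 24 * K) (by positivity) 1 (by positivity : 0 < g / 4),
    eventually_le_rpow 30 (by positivity : 0 < 5 * g / 16),
    eventually_le_rpow (1 / δ) (zero_lt_one' ℝ)] with n hΔ hn hlog h30 hδn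
  have hn1 : (1 : ℝ) ≤ n := by exact_mod_cast hn
  have hn0 : (0 : ℝ) < n := by linarith
  rw [Real.rpow_one] at hδn
  rw [pow_one] at hlog
  set Δ : ℝ := (n : ℝ) ^ (1 / κ + g / 16) with hΔd
  have hΔ1 : 1 ≤ Δ := Real.one_le_rpow hn1 (by positivity)
  set z : ℝ := (n : ℝ) ^ (1 / 2 + g / 8) with hz
  have hz1 : 1 ≤ z := Real.one_le_rpow hn1 (by positivity)
  set N' : ℕ := ⌈z⌉₊ with hN'
  have hNz : z ≤ N' := Nat.le_ceil z
  have hNz' : (N' : ℝ) + 1 ≤ 3 * z := by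
    have := Nat.ceil_lt_add_one (by linarith : 0 ≤ z)
    linarith
  have hNΔ : 10 * (((N' : ℝ) + 1) * Δ) ≤ n := by
    calc 10 * (((N' : ℝ) + 1) * Δ) ≤ 10 * (3 * z * Δ) := by gcongr
      _ = 30 * (n : ℝ) ^ (1 - 5 * g / 16) := by
          rw [hz, hΔd, mul_assoc 3, ← Real.rpow_add hn0, ← mul_assoc, hκg]; ring_nf
      _ ≤ (n : ℝ) ^ (5 * g / 16) * (n : ℝ) ^ (1 - 5 * g / 16) := by gcongr
      _ = n := by rw [← Real.rpow_add hn0]; ring_nf; exact Real.rpow_one _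
  have hN'Δ : (N' : ℝ) + 1 ≤ ((N' : ℝ) + 1) * Δ := le_mul_of_one_le_right (by positivity) hΔ1
  set m : ℝ := (Fintype.card (d n).Tail : ℝ) with hm
  have hm2 : 2 * (n : ℝ) ≤ m := by
    have := Nat.cast_le (α := ℝ).2 (two_mul_le_card_tail (hout n))
    push_cast at this; exact this
  have hmK : m ≤ K * n := by
    have := Nat.cast_le (α := ℝ).2 (card_tail_le (hK n))
    push_cast at this; exact this
  have hm0 : 0 < m := by linarith
  -- With `r = exp (-u)`, the bound `1 - k / m ≤ exp (-(k / m))` gives `(1 - k / m) ^ N' ≤ r ^ k`.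
  set u : ℝ := N' / m with hu
  have hu0 : 0 ≤ u := by positivity
  have hu1 : u ≤ 1 / 2 := by rw [hu, div_le_iff₀ hm0]; linarith
  set r : ℝ := Real.exp (-u) with hr
  have hr0 : 0 < r := Real.exp_pos _
  have hr1 : r ≤ 1 := Real.exp_le_one_iff.2 (by linarith)
  have hr2 : 1 / 2 ≤ r := by have := Real.add_one_le_exp (-u); linarith
  have hru : u / 2 ≤ 1 - r := by
    have h1 : r ≤ (1 + u)⁻¹ := by
      rw [hr, Real.exp_neg]; gcongr; have := Real.add_one_le_exp u; linarith
    have h2 : (1 + u)⁻¹ ≤ 1 - u / 2 := by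
      rw [inv_le_iff_one_le_mul₀ (by linarith)]; nlinarith
    linarith
  have hrr : r⁻¹ - r ≤ 4 * (1 - r) := by
    have h1 : r⁻¹ ≤ 2 := by
      rw [inv_le_comm₀ hr0 two_pos]; linarith
    have h2 : r⁻¹ - r = (1 - r) * ((1 + r) * r⁻¹) := by field_simp; ring
    have h3 : (1 + r) * r⁻¹ ≤ 2 * 2 := by gcongr; linarith
    rw [h2]; nlinarith
  have hmN : 0 < m - N' := by linarith
  have hbound := BiDegree.law_real_split_le (d := d n) (N := N' + 1) (N' := N') (Δ := Δ) (r := r)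
    (γ := 1 - (1 - r) / 4) (by omega) (by
      have : (N' : ℝ) < m := by linarith
      exact Nat.cast_lt.1 this) hΔ (by linarith) hr0 hr1
    (fun k hk => by
      have hk' : (k : ℝ) ≤ m := Nat.cast_le.2 hk
      have h1 : 0 ≤ 1 - (k : ℝ) / m := by rw [sub_nonneg, div_le_one hm0]; exact hk'
      have h2 : 1 - (k : ℝ) / m ≤ Real.exp (-(k / m)) := by
        have := Real.add_one_le_exp (-((k : ℝ) / m)); linarith
      calc (1 - (k : ℝ) / m) ^ N' ≤ (Real.exp (-(k / m))) ^ N' := by gcongr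
        _ = r ^ k := by
            rw [hr, ← Real.exp_nat_mul, ← Real.exp_nat_mul, hu]; congr 1; ring)
    (by linarith)
    (by
      -- Since `m ≥ 2 * n`, at most half of the heads sit at vertices of in-degree one. Together
      -- with the rare returns they use up at most `3 / 4` of the gain `1 - r`, which leaves a
      -- contraction by `1 - (1 - r) / 4`.
      have h1 : (N' + 1) * Δ * (r⁻¹ - r) + n * (1 - r) ≤ 3 / 4 * (1 - r) * (m - N') := by
        have h2 : (N' + 1) * Δ * (r⁻¹ - r) ≤ (N' + 1) * Δ * (4 * (1 - r)) := by gcongr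
        have h3 : 4 * ((N' + 1) * Δ) + n ≤ 3 / 4 * (m - N') := by linarith
        have h4 := mul_le_mul_of_nonneg_right h3 (by linarith : 0 ≤ 1 - r)
        linarith
      rw [← div_le_iff₀ hmN] at h1
      linarith)
  refine hbound.trans ?_
  have hγ : 1 - (1 - r) / 4 ≤ Real.exp (-(u / 8)) := by
    have := Real.add_one_le_exp (-(u / 8)); linarith
  have hexp : (1 - (1 - r) / 4) ^ N' ≤ (n : ℝ) ^ (-3 : ℝ) := by
    calc (1 - (1 - r) / 4) ^ N' ≤ (Real.exp (-(u / 8))) ^ N' := by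
          gcongr; linarith
      _ = Real.exp (-(N' * u / 8)) := by rw [← Real.exp_nat_mul]; congr 1; ring
      _ ≤ Real.exp (Real.log n * (-3)) := by
          gcongr
          have h1 : (n : ℝ) ^ (g / 4) / K ≤ N' * u := by
            rw [hu, mul_div_assoc', div_le_div_iff₀ (by positivity) hm0]
            calc (n : ℝ) ^ (g / 4) * m ≤ (n : ℝ) ^ (g / 4) * (K * n) := by gcongr
              _ = z * z * K := by
                  rw [hz, ← Real.rpow_add hn0, show 1 / 2 + g / 8 + (1 / 2 + g / 8) = g / 4 + 1 by
                    ring, Real.rpow_add_one hn0.ne']; ring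
              _ ≤ N' * N' * K := by gcongr
          have h2 : Real.log n ≤ ((Nat.log 2 n + 1 : ℕ) : ℝ) := by
            have h3 : (n : ℝ) ≤ 2 ^ (Nat.log 2 n + 1) := by
              exact_mod_cast (Nat.lt_pow_succ_log_self one_lt_two n).le
            have h4 := Real.log_le_log hn0 h3
            rw [Real.log_pow] at h4
            refine h4.trans (mul_le_of_le_one_right (by positivity) ?_)
            have := Real.log_two_lt_d9; linarith
          have hK0' : (0 : ℝ) < K := by exact_mod_cast hK0
          have h5 : 24 * Real.log n ≤ (n : ℝ) ^ (g / 4) / K := by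
            rw [le_div_iff₀ hK0']
            refine le_trans ?_ hlog
            have := mul_le_mul_of_nonneg_left h2 hK0'.le
            linarith
          linarith
      _ = (n : ℝ) ^ (-3 : ℝ) := by rw [Real.rpow_def_of_pos hn0]
  calc (n * n : ℝ) * (1 - (1 - r) / 4) ^ N' ≤ (n * n : ℝ) * (n : ℝ) ^ (-3 : ℝ) := by gcongr
    _ = (n : ℝ)⁻¹ := by
        rw [← Real.rpow_neg_one, show (-1 : ℝ) = 1 + 1 + -3 by norm_num, Real.rpow_add hn0,
          Real.rpow_add hn0, Real.rpow_one]
    _ ≤ δ := by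
        rw [div_le_iff₀ hδ] at hδn
        rw [inv_le_iff_one_le_mul₀ hn0]; linarith

end Asymptotics
end DCM
-- Assembling the upper bounds
namespace DCM

theorem surfer_zero {n : ℕ} (d : BiDegree n) (σ : d.Matching) (lam : Fin n → ℝ) :
    d.surfer σ 0 lam = d.walk σ := by
  ext x y; simp [BiDegree.surfer]

/-- On an event that does not depend on the teleporting probability, the stationary distribution
is unique and satisfies the upper bounds. -/
theorem eventually_upperBounds {d : ∀ n : ℕ, BiDegree n} {κ : ℝ}
    (hout : ∀ n v, 2 ≤ (d n).outDeg v) {K : ℕ} (hK0 : 0 < K)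
    (hK : ∀ n v, (d n).outDeg v ≤ K) (hκ : 2 < κ)
    (hφ : HasPowerLaw κ (fun n v => ((d n).inDeg v : ℝ))) {lam : ∀ n : ℕ, Fin n → ℝ}
    (hlam : NearUniform lam) {ε δ : ℝ} (hε : 0 < ε) (hδ : 0 < δ) :
    ∀ᶠ n : ℕ in atTop, 1 - δ ≤ (d n).law.real {σ | ∀ α : ℝ, 0 ≤ α → α ≤ 1 →
      ∃ π : Fin n → ℝ, IsTheStationary ((d n).surfer σ α (lam n)) π ∧
        UpperBounds κ ε (fun v => (n : ℝ) * π v)} := by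
  have hκ0 : 0 < κ := by linarith
  obtain ⟨g, hg⟩ : ∃ g : ℝ, g = 1 - 2 / κ := ⟨_, rfl⟩
  have hg0 : 0 < g := by rw [hg, sub_pos, div_lt_one hκ0]; exact hκ
  have hκg : 1 / κ = (1 - g) / 2 := by rw [hg]; ring
  -- The first bound keeps the total loss in the tail below `ε`; the second keeps absorbing sets
  -- larger than `n ^ (1 / 2 + g / 8)`.
  set e : ℝ := min (ε / (2 * (κ + 2))) (g / 32) with he_def
  have he : 0 < e := lt_min (by positivity) (by positivity)
  have heε : 2 * e * (κ + 2) ≤ ε := by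
    have := min_le_left (ε / (2 * (κ + 2))) (g / 32)
    rw [← he_def, le_div_iff₀ (by positivity)] at this
    linarith
  have heg : e ≤ g / 32 := min_le_right _ _
  set J : ℕ := ⌈2 / (g / 16)⌉₊ + 1 with hJ
  have hJc : 2 ≤ g / 16 * J := by
    have := Nat.le_ceil (2 / (g / 16))
    rw [div_le_iff₀ (by positivity)] at this
    rw [hJ]; push_cast; linarith
  have hδ4 : 0 < δ / 4 := by positivity
  filter_upwards [eventually_spread hout hκ hφ hg hδ4,
    eventually_influence hout (by positivity : 0 < g / 16) he (by omega : 1 ≤ J) hJc hδ4,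
    eventually_not_split hout hK0 hK hκ hφ hg hδ4,
    hφ.eventually_le hκ0 he, hφ.eventually_sum_rpow_le (fun n v => Nat.cast_nonneg _) hκ0
      (by positivity : 0 < 2 * e), hlam.2 e he, eventually_ge_atTop 1,
    eventually_natLog_le (C := 2 * J) (by positivity) 1 (by positivity : 0 < 2 * e),
    eventually_le_rpow 3 (by positivity : 0 < g / 8)]
    with n hspread hinfl hsplit hΔ hmom hl hn hT h3
  have hn1 : (1 : ℝ) ≤ n := by exact_mod_cast hn
  have hn0 : (0 : ℝ) < n := by linarith
  set R : ℕ := Nat.log 2 n + 1 with hR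
  rw [pow_one] at hT
  have hT' : ((J * R : ℕ) : ℝ) + 1 ≤ (n : ℝ) ^ (2 * e) := by
    have h1 : (1 : ℝ) ≤ (J * R : ℕ) := by
      exact_mod_cast Nat.mul_pos (by omega : 0 < J) (by omega : 0 < R)
    push_cast at h1 ⊢; linarith
  have hlams := hlam.1 n hn
  set G := {σ | ∀ α : ℝ, 0 ≤ α → α ≤ 1 →
      ∃ π : Fin n → ℝ, IsTheStationary ((d n).surfer σ α (lam n)) π ∧
        UpperBounds κ ε (fun v => (n : ℝ) * π v)} with hG
  set B₁ := {σ : (d n).Matching | ∃ y z, (n : ℝ) ^ (-(g / 16)) < ((d n).walk σ ^ R) y z} with hB₁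
  set B₂ := {σ | ∃ p : Fin n × Fin n,
        (∀ y z, ((d n).walk σ ^ R) y z ≤ (n : ℝ) ^ (-(g / 16))) ∧
        (n : ℝ) ^ (e - 1) * (d n).influence (J * R) σ p.2 <
          ((d n).walk σ ^ (J * R)) p.1 p.2} with hB₂
  set B₃ := {σ | ∃ p : Fin (J * R) × Fin n,
        (n : ℝ) ^ (e - 1) * (d n).influence (J * R) σ p.2 <
          (n : ℝ)⁻¹ * ∑ x, ((d n).walk σ ^ (p.1 : ℕ)) x p.2} with hB₃
  set B₄ := {σ | ∃ p : Fin n × Fin n,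
      (d n).Split (⌈(n : ℝ) ^ (1 / 2 + g / 8)⌉₊ + 1) p.1 p.2 σ} with hB₄
  -- None of the four bad events mentions `α`, so outside them all teleporting probabilities are
  -- handled at once.
  have hcover : (Set.univ : Set (d n).Matching) ⊆ G ∪ (B₁ ∪ B₂ ∪ (B₃ ∪ B₄)) := by
    intro σ _
    by_contra hσ
    simp only [Set.mem_union, not_or] at hσ
    obtain ⟨hσG, ⟨h1, h2⟩, h3', h4⟩ := hσ
    simp only [hB₁, Set.mem_ofPred_eq, not_exists, not_lt] at h1
    simp only [hB₂, Set.mem_ofPred_eq, not_exists, not_and, not_lt] at h2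
    simp only [hB₃, Set.mem_ofPred_eq, not_exists, not_lt] at h3'
    simp only [hB₄, Set.mem_ofPred_eq, not_exists] at h4
    refine hσG fun α hα0 hα1 => ?_
    have hlong : ∀ x v, ((d n).walk σ ^ (J * R)) x v ≤
        (n : ℝ) ^ (e - 1) * (d n).influence (J * R) σ v := fun x v => h2 (x, v) h1
    obtain ⟨π, hπ⟩ := BiDegree.exists_isStationary_surfer (d := d n) hn (hout n) hα0 hα1 hlams σ
    have hbound : ∀ v, (n : ℝ) * π v ≤ (n : ℝ) ^ (2 * e) * (d n).influence (J * R) σ v := by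
      intro v
      have hi0 := BiDegree.influence_pos (J * R) σ v
      have h5 : π v ≤ (n : ℝ) ^ (2 * e - 1) * (d n).influence (J * R) σ v := by
        refine BiDegree.isStationary_surfer_le hα0 hα1 hπ (T := J * R) (fun k hk => ?_)
          fun x => (hlong x v).trans ?_
        · calc ∑ x, lam n x * ((d n).walk σ ^ k) x v
              ≤ ∑ x, (n : ℝ) ^ (-1 + e) * ((d n).walk σ ^ k) x v :=
                Finset.sum_le_sum fun x _ => mul_le_mul_of_nonneg_right (hl x).2
                  ((d n).walk_pow_nonneg σ k x v)
            _ = (n : ℝ) ^ e * ((n : ℝ)⁻¹ * ∑ x, ((d n).walk σ ^ k) x v) := by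
                rw [← Finset.mul_sum, ← mul_assoc, ← Real.rpow_neg_one, ← Real.rpow_add hn0,
                  add_comm]
            _ ≤ (n : ℝ) ^ e * ((n : ℝ) ^ (e - 1) * (d n).influence (J * R) σ v) := by
                exact mul_le_mul_of_nonneg_left (h3' (⟨k, hk⟩, v)) (by positivity)
            _ = _ := by rw [← mul_assoc, ← Real.rpow_add hn0]; ring_nf
        · gcongr
          linarith
      calc (n : ℝ) * π v ≤ n * ((n : ℝ) ^ (2 * e - 1) * (d n).influence (J * R) σ v) := by gcongr
        _ = _ := by rw [Real.rpow_sub_one hn0.ne']; field_simp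
    -- The long walk puts at most `n ^ (2 * e - 1 + 1 / κ)` on a vertex, and an absorbing set has to
    -- hold its full mass.
    have hlarge : ∀ C, (d n).Absorbing σ C → C.Nonempty →
        ⌈(n : ℝ) ^ (1 / 2 + g / 8)⌉₊ + 1 ≤ C.card := by
      rintro C hC ⟨x, hx⟩
      have h5 := hC.one_le_card_mul (hout n) (t := J * R) (b := (n : ℝ) ^ (2 * e - 1 + 1 / κ)) hx
        fun v => (hlong x v).trans (by
          calc _ ≤ (n : ℝ) ^ (e - 1) * (n : ℝ) ^ (1 / κ + e) := by
                gcongr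
                exact BiDegree.influence_le (Real.one_le_rpow hn1 (by positivity)) hΔ
            _ = _ := by rw [← Real.rpow_add hn0]; ring_nf)
      have hz1 : 1 ≤ (n : ℝ) ^ (1 / 2 + g / 8) := Real.one_le_rpow hn1 (by positivity)
      have h6 : 3 * (n : ℝ) ^ (1 / 2 + g / 8) ≤ C.card := by
        calc 3 * (n : ℝ) ^ (1 / 2 + g / 8) ≤ (n : ℝ) ^ (g / 8) * (n : ℝ) ^ (1 / 2 + g / 8) := by
              gcongr
          _ ≤ (n : ℝ) ^ (-(2 * e - 1 + 1 / κ)) := by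
              rw [← Real.rpow_add hn0]
              exact Real.rpow_le_rpow_of_exponent_le hn1 (by rw [hκg]; linarith)
          _ ≤ C.card := by
              rw [Real.rpow_neg hn0.le, inv_le_iff_one_le_mul₀ (by positivity)]; exact h5
      have h7 := Nat.ceil_lt_add_one (by linarith : 0 ≤ (n : ℝ) ^ (1 / 2 + g / 8))
      have h8 : ((⌈(n : ℝ) ^ (1 / 2 + g / 8)⌉₊ + 1 : ℕ) : ℝ) ≤ C.card := by push_cast; linarith
      exact_mod_cast h8
    refine ⟨π, ?_, upperBounds_of_le_influence hn hκ (by positivity) heε hT'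
      (fun w => (hΔ w).trans (Real.rpow_le_rpow_of_exponent_le hn1 (by linarith))) hmom hbound⟩
    -- Only `α = 0` needs the statement on disjoint absorbing sets; otherwise positivity of `lam` is
    -- enough.
    rcases hα0.eq_or_lt with rfl | hα
    · rw [surfer_zero] at hπ ⊢
      exact BiDegree.isTheStationary_walk (hout n) hlarge (fun x x' => h4 (x, x')) hπ
    · exact BiDegree.isTheStationary_surfer_of_pos (hout n) hα hα1 hlams
        (fun v => lt_of_lt_of_le (by positivity) (hl v).1) σ hπ
  have h1 : (1 : ℝ) ≤ (d n).law.real (G ∪ (B₁ ∪ B₂ ∪ (B₃ ∪ B₄))) := by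
    rw [← probReal_univ (μ := (d n).law)]; exact measureReal_mono hcover
  have h2 := measureReal_union_le (μ := (d n).law) G (B₁ ∪ B₂ ∪ (B₃ ∪ B₄))
  have h4 := measureReal_union_le (μ := (d n).law) (B₁ ∪ B₂) (B₃ ∪ B₄)
  have h5 := measureReal_union_le (μ := (d n).law) B₁ B₂
  have h6 := measureReal_union_le (μ := (d n).law) B₃ B₄
  linarith [hinfl.1, hinfl.2]

end DCM

theorem mainTheorem3 (d : ∀ n : ℕ, DCM.BiDegree n) (hd : DCM.DegreeAssumption d)
    (κ : ℝ) (hκ : 2 < κ)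
    (hφ : DCM.HasPowerLaw κ (fun n v => ((d n).inDeg v : ℝ)))
    (lam : ∀ n : ℕ, Fin n → ℝ) (hlam : DCM.NearUniform lam) :
    (∀ α : ℝ, 0 < α → α < 1 → ∀ ε : ℝ, 0 < ε → ∀ b : ℝ, 0 < b → b < 1 / κ →
      Tendsto (fun n : ℕ => (d n).law.real
          {σ | ∃ π : Fin n → ℝ, DCM.IsTheStationary ((d n).surfer σ α (lam n)) π ∧
            DCM.UpperBounds κ ε (fun v => (n : ℝ) * π v) ∧
            DCM.LowerBounds κ ε b (fun v => (n : ℝ) * π v)})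
        atTop (𝓝 1)) ∧
    (∀ ε : ℝ, 0 < ε → ∀ δ : ℝ, 0 < δ → ∀ᶠ n : ℕ in atTop, ∀ α : ℝ, 0 ≤ α → α ≤ 1 →
      1 - δ ≤ (d n).law.real
          {σ | ∃ π : Fin n → ℝ, DCM.IsTheStationary ((d n).surfer σ α (lam n)) π ∧
            DCM.UpperBounds κ ε (fun v => (n : ℝ) * π v)}) := by
  obtain ⟨η, C, K, -, -, hK2, hall⟩ := hd
  have hout : ∀ n v, 2 ≤ (d n).outDeg v := fun n => (hall n).1
  have hK : ∀ n v, (d n).outDeg v ≤ K := fun n => (hall n).2.1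
  have hup := fun (ε δ : ℝ) (hε : 0 < ε) (hδ : 0 < δ) =>
    DCM.eventually_upperBounds hout (by omega) hK hκ hφ hlam hε hδ
  refine ⟨fun α h0 h1 ε hε b _ hb => ?_, fun ε hε δ hδ => ?_⟩
  · rw [tendsto_order]
    refine ⟨fun a ha => ?_, fun a ha => Eventually.of_forall fun n =>
      measureReal_le_one.trans_lt ha⟩
    filter_upwards [hup ε ((1 - a) / 2) hε (by linarith),
      DCM.eventually_lowerBounds (by omega : 0 < K) hK (by linarith) hφ hlam h0 h1 hε hb]
      with n hn hlow
    refine lt_of_lt_of_le (by linarith) (hn.trans (measureReal_mono fun σ hσ => ?_))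
    obtain ⟨π, hπ, hπu⟩ := hσ α h0.le h1.le
    exact ⟨π, hπ, hπu, hlow σ π hπ.1⟩
  · filter_upwards [hup ε δ hε hδ] with n hn α h0 h1
    exact hn.trans (measureReal_mono fun σ hσ => hσ α h0 h1)
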